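/- Let $p>2$ be a prime, let $K=\mathbb F_p(x_{ij}\mid i\in\{1,2\},\,j\in\{1,2,3,4\})$ be the field of rational functions in eight indeterminates, and let $\mathcal M=(x_{ij})$ be the generic $2\times 4$ matrix. Let $E=\langle e_1,e_2,e_3,e_4\rangle\cong(\mathbb Z/p)^4$ act on $K[V_{\mathcal M}]=K[x,y,z]$ by algebra automorphisms with $$x\cdot e_j=x,\qquad y\cdot e_j=y+x_{1j}x,\qquad z\cdot e_j=z+2x_{1j}y+(x_{1j}^2+x_{2j})x ,$$ and let $K[V_{\mathcal M}]^E$ be the ring of invariants. Let $N_{\mathcal M}(z)$ be the product of the elements of the $E$-orbit of $z$. Use the graded reverse lexicographic order with $x<y<z$; LM, LT denote lead monomial and lead term. *The invariants.* Let $\Gamma$ be the $10\times 4$ matrix whose rows $2k+1$ and $2k+2$, $k=0,\dots,4$, are the entrywise $p^k$-th powers of the first and second row of $\mathcal M$, and let $\gamma_{ijk\ell}$ be its $4\times4$ minor with rows $i,j,k,\ell$. Put $\delta=y^2-xz$ and let $\widetilde\Gamma$ be $\Gamma$ augmented on the right by the column with entries $(y/x)^{p^k}$ in row $2k+1$ and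 $(-\delta/x^2)^{p^k}$ in row $2k+2$. For $J=(j_1,\dots,j_5)$ let $f_J\in K[x,y,z]$ be obtained from the $5\times 5$ minor of $\widetilde\Gamma$ with rows $J$ by multiplying with the least power of $x$ that clears the denominator. Let $$f_1=f_{12345},\qquad f_2=\frac{f_1^2+\gamma_{1234}f_{12346}}{2x^{p^2-2p}}$$ (the division is exact). For a finite sequence $h=(h_1,\dots,h_\ell)$ in $K[x,y,z]$ write $h^I=\prod_j h_j^{i_j}$. A *subduction step* replaces a nonzero $f$ by $f-ch^I$, where $c\in K$ and $\mathrm{LT}(f)=\mathrm{LT}(ch^I)$; a *tête-à-tête* is a pair $(h^I,h^J)$ with $\mathrm{LM}(h^I)=\mathrm{LM}(h^J)$; its subduction starts from $h^I-ch^J$, where $\mathrm{LT}(h^I)=\mathrm{LT}(ch^J)$. If subduction steps lead from $h^I-ch^J$ to $0$, and $q\in K[t_1,\dots,t_\ell]$ is the sum of the corresponding terms $c't^{I'}$, then $t^I-ct^J-q$ is *a relation coming from the subduction of* $(h^I,h^J)$. Let $f_3$ be any polynomial obtained as follows: subduct the tête-à-tête $(f_2^p,f_1^{p+2})$ using $x,f_1,f_2,N_{\mathcal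 M}(z)$ until no further step is possible, the result being nonzero; divide the result by the highest possible power of $x$; and scale so that the lead coefficient is $\gamma_{1357}$. Such an $f_3$ exists, and for $p\ge5$ one of them is given by $$-\frac{\gamma_{1234}^{2p+2}}{\gamma_{1235}}\,x^{2p^2-2}f_3=\gamma_{1235}^pf_1^{p+2}-\gamma_{1234}^2f_2^p-2\gamma_{1235}^px^{p^2-2p}f_1^pf_2+\gamma_{1234}\gamma_{1245}^px^{p^2}f_1^{p+1}+\frac{\gamma_{1234}^{p+1}\gamma_{1237}}{\gamma_{1235}}x^{2p^2-2p}f_1^{p-1}f_2+\frac{\gamma_{1234}^{p+3}\gamma_{1257}}{\gamma_{1235}^{(p+3)/2}}x^{2p^2-p}f_1^{(p-3)/2}f_2^{(p+1)/2}.$$ **Theorem.** For every such $f_3$ the following hold. 1. $\mathrm{LT}(f_3)=\gamma_{1357}y^{p^3+2}$, and $x,f_1,f_2,f_3,N_{\mathcal M}(z)$ are homogeneous of degrees $1,\ p^2,\ p^2+2p,\ p^3+2,\ p^4$ respectively. 2. $\mathcal B=\{x,f_1,f_2,f_3,N_{\mathcal M}(z)\}$ is a SAGBI basis of $K[V_{\mathcal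 M}]^E$, that is, $\mathcal B\subset K[V_{\mathcal M}]^E$ and the lead monomials of the elements of $\mathcal B$ generate the lead term algebra of $K[V_{\mathcal M}]^E$; and $\mathcal B$ generates the $K$-algebra $K[V_{\mathcal M}]^E$. 3. $A=K[V_{\mathcal M}]^E$ is a complete intersection (it has a finite presentation whose ideal of relations is generated by a regular sequence) of embedding dimension $\dim_K A_+/A_+^2=5$, where $A_+$ is the ideal of elements of $A$ with zero constant term. 4. $(f_2^p,\,f_1^{p+2})$ and $(f_3^p,\,f_2f_1^{p^2-1})$ are tête-à-têtes for $\mathcal B$ that subduct to zero using $\mathcal B$, and whenever $\rho_1$ and $\rho_2$ are relations coming from subductions of the first and of the second one, $(\rho_1,\rho_2)$ is a regular sequence in $K[t_1,\dots,t_5]$ and generates the ideal of all algebraic relations among $x,f_1,f_2,f_3,N_{\mathcal M}(z)$. -/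

import Mathlib

noncomputable section

namespace RankFour

open MvPolynomial

/-! ### The graded reverse lexicographic order

The variables are `z = X 0`, `y = X 1`, `x = X 2`, ordered by `x < y < z`. -/

/-- Exponent vectors of monomials in `z, y, x`, to be ordered by graded reverse lex. -/
def GrevLex : Type := Fin 3 →₀ ℕ

instance : AddCommMonoid GrevLex := inferInstanceAs (AddCommMonoid (Fin 3 →₀ ℕ))

/-- The key `(total degree, degree in y and z, degree in z)`; see `grevLex_lt_iff`. -/
def grevLexKey (a : Fin 3 →₀ ℕ) : ℕ ×ₗ (ℕ ×ₗ ℕ) :=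
  toLex (a 0 + a 1 + a 2, toLex (a 0 + a 1, a 0))

theorem grevLexKey_injective : Function.Injective grevLexKey := by
  intro a b h
  simp only [grevLexKey, EmbeddingLike.apply_eq_iff_eq, Prod.mk.injEq] at h
  obtain ⟨h1, h2, h3⟩ := h
  ext i
  fin_cases i <;> simp <;> omega

theorem grevLexKey_add (a b : Fin 3 →₀ ℕ) :
    grevLexKey (a + b) = grevLexKey a + grevLexKey b := by
  have e1 : (a + b) 0 + (a + b) 1 + (a + b) 2 = (a 0 + a 1 + a 2) + (b 0 + b 1 + b 2) := by
    simp only [Finsupp.add_apply]; omega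
  have e2 : (a + b) 0 + (a + b) 1 = (a 0 + a 1) + (b 0 + b 1) := by
    simp only [Finsupp.add_apply]; omega
  have e3 : (a + b) 0 = a 0 + b 0 := rfl
  unfold grevLexKey
  rw [e1, e2, e3]
  rfl

instance : LinearOrder GrevLex := LinearOrder.lift' grevLexKey grevLexKey_injective

theorem GrevLex.le_iff_key {a b : GrevLex} : a ≤ b ↔ grevLexKey a ≤ grevLexKey b := Iff.rfl

instance : IsOrderedAddMonoid GrevLex where
  add_le_add_left a b h c := by
    rw [GrevLex.le_iff_key] at h ⊢
    have e : ∀ u : GrevLex, grevLexKey (u + c) = grevLexKey u + grevLexKey c :=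
      fun u => grevLexKey_add u c
    rw [e, e]
    exact add_le_add_left h _

instance : WellFoundedLT GrevLex :=
  ⟨InvImage.wf grevLexKey (wellFounded_lt : WellFounded (α := ℕ ×ₗ (ℕ ×ₗ ℕ)) (· < ·))⟩

/-- The graded reverse lexicographic order with `x < y < z`. -/
def grevLex : MonomialOrder (Fin 3) where
  syn := GrevLex
  toSyn := { toEquiv := Equiv.refl (Fin 3 →₀ ℕ), map_add' := fun _ _ => rfl }
  toSyn_monotone a b h := by
    have h0 := h 0
    have h1 := h 1
    have h2 := h 2
    change grevLexKey a ≤ grevLexKey b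
    simp only [grevLexKey, Prod.Lex.toLex_le_toLex]
    omega

theorem grevLex_lt_iff (a b : Fin 3 →₀ ℕ) :
    grevLex.toSyn a < grevLex.toSyn b ↔
      a 0 + a 1 + a 2 < b 0 + b 1 + b 2 ∨
        (a 0 + a 1 + a 2 = b 0 + b 1 + b 2 ∧ (b 2 < a 2 ∨ (a 2 = b 2 ∧ b 1 < a 1))) := by
  change grevLexKey a < grevLexKey b ↔ _
  simp only [grevLexKey, Prod.Lex.toLex_lt_toLex]
  omega

/-! ### SAGBI bases, subduction and tête-à-têtes -/

section Sagbi

variable {K : Type*} [Field K]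

/-- The lead term algebra of a subalgebra of `K[x, y, z]`. -/
def leadTermAlgebra (A : Subalgebra K (MvPolynomial (Fin 3) K)) :
    Subalgebra K (MvPolynomial (Fin 3) K) :=
  Algebra.adjoin K (grevLex.leadingTerm '' (A : Set (MvPolynomial (Fin 3) K)))

/-- `B ⊆ A` is a SAGBI basis of `A`: the lead monomials of the elements of `B` generate the
lead term algebra of `A`. -/
def IsSagbiBasis (B : Set (MvPolynomial (Fin 3) K))
    (A : Subalgebra K (MvPolynomial (Fin 3) K)) : Prop :=
  B ⊆ A ∧
    Algebra.adjoin K ((fun f => monomial (grevLex.degree f) (1 : K)) '' B) = leadTermAlgebra A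

variable {n : ℕ} (h : Fin n → MvPolynomial (Fin 3) K)

/-- The product `h^I` of powers of the `h j`. -/
def powProd (I : Fin n →₀ ℕ) : MvPolynomial (Fin 3) K := ∏ j, h j ^ I j

/-- `Subduction h f q r`: finitely many subduction steps by `h` lead from `f` to `r`, where a step
replaces a nonzero `g` by `g - c h^I` with `LT(g) = LT(c h^I)`; the polynomial `q`, in one
indeterminate per `h j`, is the sum of the terms `c t^I` of all the steps
(so that `f = q(h) + r`). -/
inductive Subduction :
    MvPolynomial (Fin 3) K → MvPolynomial (Fin n) K → MvPolynomial (Fin 3) K → Prop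
  | refl (f : MvPolynomial (Fin 3) K) : Subduction f 0 f
  | step (f : MvPolynomial (Fin 3) K) (c : K) (I : Fin n →₀ ℕ) (q : MvPolynomial (Fin n) K)
      (r : MvPolynomial (Fin 3) K) (hf : f ≠ 0)
      (hI : grevLex.leadingTerm f = grevLex.leadingTerm (C c * powProd h I))
      (hr : Subduction (f - C c * powProd h I) q r) : Subduction f (monomial I c + q) r

/-- `(h^I, h^J)` is a tête-à-tête. -/
def IsTat (I J : Fin n →₀ ℕ) : Prop :=
  grevLex.degree (powProd h I) = grevLex.degree (powProd h J)

/-- The scalar `c` with `LT(h^I) = LT(c h^J)`, for a tête-à-tête `(h^I, h^J)`. -/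
def tatScalar (I J : Fin n →₀ ℕ) : K :=
  grevLex.leadingCoeff (powProd h I) / grevLex.leadingCoeff (powProd h J)

/-- The difference `h^I - c h^J` of a tête-à-tête, where the lead terms cancel. -/
def tatDiff (I J : Fin n →₀ ℕ) : MvPolynomial (Fin 3) K :=
  powProd h I - C (tatScalar h I J) * powProd h J

/-- `ρ` is a relation among the `h j` coming from a subduction of the tête-à-tête `(h^I, h^J)`
to zero. -/
def IsTatRelation (I J : Fin n →₀ ℕ) (ρ : MvPolynomial (Fin n) K) : Prop :=
  IsTat h I J ∧ ∃ q, Subduction h (tatDiff h I J) q 0 ∧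
    ρ = monomial I 1 - monomial J (tatScalar h I J) - q

end Sagbi

/-! ### Complete intersections and embedding dimension -/

/-- A `K`-algebra with a finite presentation whose ideal of relations is generated by a regular
sequence. -/
def IsCompleteIntersection (K A : Type*) [Field K] [CommRing A] [Algebra K A] : Prop :=
  ∃ (n : ℕ) (φ : MvPolynomial (Fin n) K →ₐ[K] A) (rs : List (MvPolynomial (Fin n) K)),
    Function.Surjective φ ∧ RingTheory.Sequence.IsRegular (MvPolynomial (Fin n) K) rs ∧
      RingHom.ker φ = Ideal.ofList rs

/-- For a subalgebra `A` of `K[x, y, z]`, the ideal `A₊` of elements with constant term zero. -/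
def augmentationIdeal {K : Type*} [Field K] (A : Subalgebra K (MvPolynomial (Fin 3) K)) :
    Ideal A :=
  RingHom.ker ((constantCoeff (R := K) (σ := Fin 3)).comp (A.val : A →+* MvPolynomial (Fin 3) K))

/-- The embedding dimension `dim A₊ / A₊²` of a (graded) subalgebra `A` of `K[x, y, z]`. -/
def embeddingDim {K : Type*} [Field K] (A : Subalgebra K (MvPolynomial (Fin 3) K)) : ℕ :=
  Module.finrank K (augmentationIdeal A).Cotangent

/-! ### The representation and its ring of invariants -/

section Rep

variable {K : Type*} [Field K]

/-- The matrix `σ(c₁, c₂)`. -/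
def sigma (c₁ c₂ : K) : Matrix (Fin 3) (Fin 3) K :=
  !![1, 2 * c₁, c₁ ^ 2 + c₂; 0, 1, c₁; 0, 0, 1]

theorem sigma_zero : sigma (0 : K) 0 = 1 := by
  ext i j; fin_cases i <;> fin_cases j <;> simp [sigma]

theorem sigma_add (c₁ c₂ d₁ d₂ : K) :
    sigma (c₁ + d₁) (c₂ + d₂) = sigma c₁ c₂ * sigma d₁ d₂ := by
  ext i j
  fin_cases i <;> fin_cases j <;> simp [sigma, Matrix.mul_apply, Fin.sum_univ_three] <;> ring

variable (p : ℕ) [Algebra (ZMod p) K] (M : Matrix (Fin 2) (Fin 4) K)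

/-- The representation `V_M` of `E = (ℤ/p)⁴`, sending the generator `e_j` to
`σ(M 0 j, M 1 j)` (see `rep_generator`). -/
def rep : Multiplicative (Fin 4 → ZMod p) →* Matrix (Fin 3) (Fin 3) K where
  toFun a := sigma (∑ j, Multiplicative.toAdd a j • M 0 j) (∑ j, Multiplicative.toAdd a j • M 1 j)
  map_one' := by simp [sigma_zero]
  map_mul' a b := by simp [add_smul, Finset.sum_add_distrib, sigma_add]

theorem rep_generator (j : Fin 4) :
    rep p M (Multiplicative.ofAdd (Pi.single j 1)) = sigma (M 0 j) (M 1 j) := by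
  simp [rep, Pi.single_apply, ite_smul]

/-- The action of a group element on `K[x, y, z]`: right multiplication by its matrix on the row
vectors `z = X 0 = [1 0 0]`, `y = X 1 = [0 1 0]`, `x = X 2 = [0 0 1]`. -/
def act (a : Multiplicative (Fin 4 → ZMod p)) :
    MvPolynomial (Fin 3) K →ₐ[K] MvPolynomial (Fin 3) K :=
  aeval fun i => ∑ j, C (rep p M a i j) * X j

/-- The ring of invariants `K[V_M]^E`. -/
def invariants : Subalgebra K (MvPolynomial (Fin 3) K) where
  carrier := {f | ∀ a, act p M a f = f}
  mul_mem' hf hg a := by rw [map_mul, hf a, hg a]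
  add_mem' hf hg a := by rw [map_add, hf a, hg a]
  algebraMap_mem' r a := (act p M a).commutes r

open Classical in
/-- The orbit product `N_M(f)`, for `p` positive. -/
def orbitNorm [NeZero p] (f : MvPolynomial (Fin 3) K) : MvPolynomial (Fin 3) K :=
  ∏ g ∈ Finset.univ.image (fun a : Multiplicative (Fin 4 → ZMod p) => act p M a f), g

end Rep

/-! ### The minors and the invariants built from them -/

section Minors

variable {K : Type*} [Field K] (p : ℕ) (M : Matrix (Fin 2) (Fin 4) K)

/-- The entry in row `r = 1, 2, 3, …` and column `j` of the matrix `Γ`: the rows are the two rows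
of `M`, then their entrywise `p`-th powers, then their `p²`-th powers, and so on. -/
def Gam (r : ℕ) (j : Fin 4) : K :=
  if Odd r then M 0 j ^ p ^ ((r - 1) / 2) else M 1 j ^ p ^ ((r - 1) / 2)

/-- The `4 × 4` minor `γ_J` of `Γ` with rows `J`. -/
def gam (J : Fin 4 → ℕ) : K := (Matrix.of fun i j => Gam p M (J i) j).det

/-- `δ = y² - x z`. -/
def delta : MvPolynomial (Fin 3) K := X 1 ^ 2 - X 2 * X 0

/-- The entry in row `r` of the column `y/x, -δ/x², (y/x)^p, (-δ/x²)^p, …`, in the field of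
fractions of `K[x, y, z]`. -/
def extraCol (r : ℕ) : FractionRing (MvPolynomial (Fin 3) K) :=
  if Odd r then
    (algebraMap (MvPolynomial (Fin 3) K) _ (X 1) /
      algebraMap (MvPolynomial (Fin 3) K) _ (X 2)) ^ p ^ ((r - 1) / 2)
  else
    (-(algebraMap (MvPolynomial (Fin 3) K) _ delta /
      algebraMap (MvPolynomial (Fin 3) K) _ (X 2) ^ 2)) ^ p ^ ((r - 1) / 2)

/-- The `5 × 5` minor with rows `J` of `Γ` augmented by the extra column on the right. -/
def fTilde (J : Fin 5 → ℕ) : FractionRing (MvPolynomial (Fin 3) K) :=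
  (Matrix.of fun i : Fin 5 =>
    (Fin.snoc (fun j : Fin 4 => algebraMap (MvPolynomial (Fin 3) K) _ (C (Gam p M (J i) j)))
      (extraCol p (J i)) : Fin 5 → FractionRing (MvPolynomial (Fin 3) K))).det

open Classical in
/-- Minimally clearing the denominator of an element `g` of `K[x, y, z][x⁻¹]`: the product
`x^d g`, where `d` is least such that it is a polynomial. (The value is `0` if `g` is not in
`K[x, y, z][x⁻¹]`.) -/
def clearDenom (g : FractionRing (MvPolynomial (Fin 3) K)) : MvPolynomial (Fin 3) K :=
  if hg : ∃ d : ℕ, ∃ f : MvPolynomial (Fin 3) K,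
      algebraMap _ (FractionRing (MvPolynomial (Fin 3) K)) f =
        algebraMap (MvPolynomial (Fin 3) K) _ (X 2) ^ d * g
  then (Nat.find_spec hg).choose else 0

/-- The polynomial `f_J`. -/
def fJ (J : Fin 5 → ℕ) : MvPolynomial (Fin 3) K := clearDenom (fTilde p M J)

/-- `f₁ = f_{12345}`. -/
def f₁ : MvPolynomial (Fin 3) K := fJ p M ![1, 2, 3, 4, 5]

/-- `f₂ = (f₁² + γ₁₂₃₄ f_{12346}) / (2 x^(p² - 2p))`. -/
def f₂ : MvPolynomial (Fin 3) K :=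
  C (2⁻¹ : K) * divMonomial (f₁ p M ^ 2 + C (gam p M ![1, 2, 3, 4]) * fJ p M ![1, 2, 3, 4, 6])
    (Finsupp.single 2 (p ^ 2 - 2 * p))

/-- The polynomial `f̃₃`, for `p ≥ 5`. -/
def f₃Tilde : MvPolynomial (Fin 3) K :=
  C (gam p M ![1, 2, 3, 5] ^ p) * f₁ p M ^ (p + 2)
    - C (gam p M ![1, 2, 3, 4] ^ 2) * f₂ p M ^ p
    + C (-2 * gam p M ![1, 2, 3, 5] ^ p) * X 2 ^ (p ^ 2 - 2 * p) * f₁ p M ^ p * f₂ p M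
    + C (gam p M ![1, 2, 3, 4] * gam p M ![1, 2, 4, 5] ^ p) * X 2 ^ p ^ 2 * f₁ p M ^ (p + 1)
    + C (gam p M ![1, 2, 3, 4] ^ (p + 1) * gam p M ![1, 2, 3, 7] / gam p M ![1, 2, 3, 5])
      * X 2 ^ (2 * p ^ 2 - 2 * p) * f₁ p M ^ (p - 1) * f₂ p M
    + C (gam p M ![1, 2, 3, 4] ^ (p + 3) * gam p M ![1, 2, 5, 7]
        / gam p M ![1, 2, 3, 5] ^ ((p + 3) / 2))
      * X 2 ^ (2 * p ^ 2 - p) * f₁ p M ^ ((p - 3) / 2) * f₂ p M ^ ((p + 1) / 2)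

variable [Algebra (ZMod p) K] [NeZero p]

/-- The starting set `x, f₁, f₂, N_M(z)` of the SAGBI/Divide-by-`x` algorithm. -/
def startSet : Fin 4 → MvPolynomial (Fin 3) K := ![X 2, f₁ p M, f₂ p M, orbitNorm p M (X 0)]

/-- `f₃` is an output of one round of SAGBI/Divide-by-`x`: it arises from the tête-à-tête
`(f₂^p, f₁^(p+2))` by subducting it with `x, f₁, f₂, N_M(z)` as far as possible to some `r ≠ 0`
and dividing `r` by the highest possible power of `x`; it is scaled to have lead
coefficient `γ₁₃₅₇`. -/
def IsThirdInvariant (f₃ : MvPolynomial (Fin 3) K) : Prop :=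
  IsTat (startSet p M) (Finsupp.single 2 p) (Finsupp.single 1 (p + 2)) ∧
  (∃ q r, Subduction (startSet p M)
      (tatDiff (startSet p M) (Finsupp.single 2 p) (Finsupp.single 1 (p + 2))) q r ∧
    r ≠ 0 ∧ (∀ I, grevLex.degree (powProd (startSet p M) I) ≠ grevLex.degree r) ∧
    ∃ (c : K) (k : ℕ), r = C c * X 2 ^ k * f₃) ∧
  ¬ X 2 ∣ f₃ ∧
  grevLex.leadingCoeff f₃ = gam p M ![1, 3, 5, 7]

/-- The generating sequence `x, f₁, f₂, f₃, N_M(z)`. -/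
def gens (f₃ : MvPolynomial (Fin 3) K) : Fin 5 → MvPolynomial (Fin 3) K :=
  ![X 2, f₁ p M, f₂ p M, f₃, orbitNorm p M (X 0)]

end Minors

/-! ### The generic matrix -/

/-- The field `𝔽_p(x_{ij} : i = 1, 2, j = 1, 2, 3, 4)`. -/
abbrev GenericField (p : ℕ) [Fact p.Prime] : Type :=
  FractionRing (MvPolynomial (Fin 2 × Fin 4) (ZMod p))

/-- The generic matrix `(x_{ij})`. -/
def genericMatrix (p : ℕ) [Fact p.Prime] : Matrix (Fin 2) (Fin 4) (GenericField p) :=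
  Matrix.of fun i j => algebraMap (MvPolynomial (Fin 2 × Fin 4) (ZMod p)) _ (X (i, j))

end RankFour

end

open RankFour MvPolynomial

noncomputable section

namespace RankFour

/-! ### Monomial orders and lead terms -/

/-! Put u = y/x, w = z/x and v = w - u² = -δ/x². A group element translates u and v by constants of
K, and the p^k-th powers of these constants are 𝔽_p-combinations of the entries in the rows of Γ.
Hence it changes the last column of a 5 × 5 minor by a combination of the other four, and the minor
is invariant (`actFrac_fTilde`). Up to powers of x, the polynomials f₁, f_{12346}, f₂ are
expressions `F₁`, `G`, `F₂` in u and w.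

Lead terms are read off from the filtration `xFil`: since x is the smallest variable, the form x^n g
has lead monomial y^n as soon as g agrees with c u^n (c ≠ 0) modulo filtration degree n - 1. Plücker
relations between minors of Γ, and such relations with some factors raised to the p-th power,
control the cancellation in f₂^p against f₁^(p+2). After the correction terms, what survives is a
multiple of γ₁₃₅₇ u^(p³+2) (`lead_five`, `lead_three`). Another way of subducting leads to the same
lead monomial, because two irreducible remainders with different lead monomials would differ by an
element whose lead monomial is reducible (`IsThirdInvariant.spec`).

The five generators have lead monomials x, y^(p²), y^(p²+2p), y^(p³+2), z^(p⁴). Products in which f₂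
and f₃ have exponents below p have distinct lead monomials (`lead_exponent_injective`). So once
there are two relations whose lead monomials in `tOrder` are the p-th powers of the variables of f₂
and of f₃, division by them gives normal forms, and the rest is formal: the two relations generate
the ideal of relations (`ker_aeval_eq`), form a regular sequence (`isRegular_pair`), every lead
monomial of the algebra is a product of the five (`exists_lead`), and the algebra is closed under
exact division by x (`exists_eq_X_mul`).

The first relation is the subduction that defines f₃. The second is found without computing it.
After inverting x, the invariants are generated by x, f₁, f_{12346}
(`exists_X_pow_mul_mem_smallAlgebra`): the p⁴ monomials u^i v^j with i, j < p² restrict to linearly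
independent functions on the group, so an invariant combination of them is its constant term. Thus
x^m N(z) is a polynomial in x, f₁, f₂, and the first relation rewrites it with f₂-exponents below p.
A second order, by weight 2 deg_z + deg_y, forces exactly one term x^k f₃^p in this expression, with
m = k + 2p. In grevlex the other terms have distinct lead monomials, so x^k cancels and a relation
for f₃^p remains (`exists_second_relation`).

The same localization, followed by cancelling powers of x, shows that the five elements generate all
invariants. Comparing degrees shows that relations have no linear terms, which gives embedding
dimension five. For the generic matrix the required minors are nonzero because a substitution turns
them into Vandermonde determinants. -/

/-- The monomial order obtained by comparing the values of an injective additive key. -/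
def orderOfKey {σ Γ : Type*} [AddCommMonoid Γ] [LinearOrder Γ] [IsOrderedAddMonoid Γ]
    [WellFoundedLT Γ] (key : (σ →₀ ℕ) →+ Γ) (hinj : Function.Injective key)
    (hmono : Monotone key) : MonomialOrder σ where
  syn := AddMonoidHom.mrange key
  toSyn :=
    { toEquiv := Equiv.ofBijective (fun a => (⟨key a, a, rfl⟩ : AddMonoidHom.mrange key))
        ⟨fun _ _ h => hinj (congrArg Subtype.val h), fun ⟨_, a, ha⟩ => ⟨a, Subtype.ext ha⟩⟩
      map_add' := fun a b => by
        apply Subtype.ext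
        exact key.map_add a b }
  toSyn_monotone a b h := hmono h
  wellFoundedLT_syn := ⟨InvImage.wf Subtype.val (wellFounded_lt : WellFounded (α := Γ) (· < ·))⟩

theorem orderOfKey_lt_iff {σ Γ : Type*} [AddCommMonoid Γ] [LinearOrder Γ] [IsOrderedAddMonoid Γ]
    [WellFoundedLT Γ] (key : (σ →₀ ℕ) →+ Γ) (hinj : Function.Injective key)
    (hmono : Monotone key) (a b : σ →₀ ℕ) :
    (orderOfKey key hinj hmono).toSyn a < (orderOfKey key hinj hmono).toSyn b ↔
      key a < key b := Iff.rfl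

section Order

variable {σ K : Type*} [Field K] (m : MonomialOrder σ)

theorem degree_eq_of_coeff_ne_zero {f : MvPolynomial σ K} {d : σ →₀ ℕ} (hd : coeff d f ≠ 0)
    (h : ∀ e ∈ f.support, m.toSyn e ≤ m.toSyn d) : m.degree f = d :=
  m.toSyn.injective (le_antisymm (m.degree_le_iff.2 h) (m.le_degree (mem_support_iff.2 hd)))

/-- Distinct lead monomials cannot cancel, so the largest one is the lead monomial of the sum. Every
normal form argument below rests on this. -/
theorem exists_degree_sum_eq {ι : Type*} (s : Finset ι) (g : ι → MvPolynomial σ K)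
    (hs : s.Nonempty) (hg : ∀ i ∈ s, g i ≠ 0)
    (hinj : Set.InjOn (fun i => m.degree (g i)) s) :
    ∃ i ∈ s, m.degree (∑ j ∈ s, g j) = m.degree (g i) ∧
      m.leadingCoeff (∑ j ∈ s, g j) = m.leadingCoeff (g i) ∧
      ∀ j ∈ s, m.toSyn (m.degree (g j)) ≤ m.toSyn (m.degree (g i)) := by
  classical
  obtain ⟨i, hi, hmax⟩ := s.exists_max_image (fun i => m.toSyn (m.degree (g i))) hs
  have hc : coeff (m.degree (g i)) (∑ j ∈ s, g j) = m.leadingCoeff (g i) := by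
    rw [coeff_sum, Finset.sum_eq_single_of_mem i hi]
    · rfl
    · intro j hj hji
      refine m.coeff_eq_zero_of_lt (lt_of_le_of_ne (hmax j hj) fun h => hji ?_)
      exact hinj hj hi (m.toSyn.injective h)
  have hd : m.degree (∑ j ∈ s, g j) = m.degree (g i) := by
    refine degree_eq_of_coeff_ne_zero m ?_ fun e he => ?_
    · rw [hc]; exact m.leadingCoeff_ne_zero_iff.2 (hg i hi)
    · obtain ⟨j, hj, hje⟩ := Finset.mem_biUnion.1 (support_sum he)
      exact (m.le_degree hje).trans (hmax j hj)
  exact ⟨i, hi, hd, by rw [MonomialOrder.leadingCoeff, hd, hc], hmax⟩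

theorem sub_eq_zero_or_degree_lt {f g : MvPolynomial σ K}
    (h : m.leadingTerm f = m.leadingTerm g) :
    -- The zero case is separate because zero has degree 0 by convention, so the strict inequality
    -- fails when f is a constant.
    f - g = 0 ∨ m.toSyn (m.degree (f - g)) < m.toSyn (m.degree f) := by
  rw [or_iff_not_imp_left]
  intro h0
  have hd : m.degree f = m.degree g := by
    rw [← m.degree_leadingTerm f, h, m.degree_leadingTerm]
  have hc : m.leadingCoeff f = m.leadingCoeff g := by
    rw [← m.leadingCoeff_leadingTerm f, h, m.leadingCoeff_leadingTerm]
  refine lt_of_le_of_ne ?_ fun he => ?_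
  · refine m.degree_sub_le.trans ?_
    rw [hd, sup_idem]
  · have := m.leadingCoeff_ne_zero_iff.2 h0
    rw [MonomialOrder.leadingCoeff, m.toSyn.injective he, coeff_sub] at this
    apply this
    rw [MonomialOrder.leadingCoeff, MonomialOrder.leadingCoeff, ← hd] at hc
    rw [hc, sub_self]

theorem leadingTerm_eq_monomial (f : MvPolynomial σ K) :
    m.leadingTerm f = monomial (m.degree f) (m.leadingCoeff f) := rfl

theorem degree_C_mul {c : K} (hc : c ≠ 0) (f : MvPolynomial σ K) :
    m.degree (C c * f) = m.degree f := by
  by_cases hf : f = 0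
  · simp [hf]
  · rw [m.degree_mul (by simpa using hc) hf, m.degree_C, zero_add]

theorem leadingCoeff_C_mul (c : K) (f : MvPolynomial σ K) :
    m.leadingCoeff (C c * f) = c * m.leadingCoeff f := by
  rw [m.leadingCoeff_mul, m.leadingCoeff_C]

end Order

/-! ### Subduction -/

section Sagbi

variable {K : Type*} [Field K] {n : ℕ} {h : Fin n → MvPolynomial (Fin 3) K}

theorem powProd_ne_zero (h0 : ∀ j, h j ≠ 0) (I : Fin n →₀ ℕ) : powProd h I ≠ 0 :=
  Finset.prod_ne_zero_iff.2 fun j _ => pow_ne_zero _ (h0 j)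

theorem powProd_add (I J : Fin n →₀ ℕ) : powProd h (I + J) = powProd h I * powProd h J := by
  simp [powProd, pow_add, Finset.prod_mul_distrib]

theorem powProd_single (j : Fin n) (k : ℕ) : powProd h (Finsupp.single j k) = h j ^ k := by
  classical
  rw [powProd, Finset.prod_eq_single j]
  · simp
  · intro i _ hij
    simp [Finsupp.single_eq_of_ne hij]
  · simp

theorem aeval_monomial_eq_powProd (I : Fin n →₀ ℕ) (c : K) :
    aeval h (monomial I c) = C c * powProd h I := by
  rw [aeval_monomial, Finsupp.prod_fintype _ _ (by simp)]
  rfl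

theorem aeval_eq_sum_powProd (q : MvPolynomial (Fin n) K) :
    aeval h q = ∑ I ∈ q.support, C (coeff I q) * powProd h I := by
  conv_lhs => rw [q.as_sum, map_sum]
  exact Finset.sum_congr rfl fun I _ => aeval_monomial_eq_powProd I _

theorem degree_powProd (m : MonomialOrder (Fin 3)) (h0 : ∀ j, h j ≠ 0) (I : Fin n →₀ ℕ) :
    m.degree (powProd h I) = ∑ j, I j • m.degree (h j) := by
  rw [powProd, m.degree_prod fun j _ => pow_ne_zero _ (h0 j)]
  exact Finset.sum_congr rfl fun j _ => m.degree_pow _ _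

theorem Subduction.eq_add {f r : MvPolynomial (Fin 3) K} {q : MvPolynomial (Fin n) K}
    (H : Subduction h f q r) : f = aeval h q + r := by
  induction H with
  | refl f => simp
  | step f c I q r hf hI hr ih =>
    rw [map_add, aeval_monomial_eq_powProd, add_assoc, ← ih]
    ring

theorem ne_zero_of_leadingTerm_eq {f : MvPolynomial (Fin 3) K} {c : K} {I : Fin n →₀ ℕ}
    (hf : f ≠ 0) (hI : grevLex.leadingTerm f = grevLex.leadingTerm (C c * powProd h I)) :
    c ≠ 0 ∧ grevLex.degree (powProd h I) = grevLex.degree f := by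
  have h1 : C c * powProd h I ≠ 0 := by
    rw [Ne, ← grevLex.leadingTerm_eq_zero_iff, ← hI, grevLex.leadingTerm_eq_zero_iff]
    exact hf
  have hc : c ≠ 0 := by
    rintro rfl
    simp at h1
  refine ⟨hc, ?_⟩
  rw [← degree_C_mul grevLex hc, ← grevLex.degree_leadingTerm, ← hI, grevLex.degree_leadingTerm]

theorem Subduction.degree_le {f r : MvPolynomial (Fin 3) K} {q : MvPolynomial (Fin n) K}
    (H : Subduction h f q r) :
    (∀ J ∈ q.support, grevLex.toSyn (grevLex.degree (powProd h J)) ≤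
      grevLex.toSyn (grevLex.degree f)) ∧
    grevLex.toSyn (grevLex.degree r) ≤ grevLex.toSyn (grevLex.degree f) := by
  classical
  induction H with
  | refl f => simp
  | step f c I q r hf hI hr ih =>
    have hle : grevLex.toSyn (grevLex.degree (f - C c * powProd h I)) ≤
        grevLex.toSyn (grevLex.degree f) := by
      rcases sub_eq_zero_or_degree_lt grevLex hI with h0 | h0
      · rw [h0, grevLex.degree_zero, map_zero]; exact grevLex.zero_le _
      · exact h0.le
    refine ⟨fun J hJ => ?_, ih.2.trans hle⟩
    rcases Finset.mem_union.1 (support_add hJ) with hJ | hJ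
    · rw [support_monomial, if_neg (ne_zero_of_leadingTerm_eq hf hI).1,
        Finset.mem_singleton] at hJ
      rw [hJ, (ne_zero_of_leadingTerm_eq hf hI).2]
    · exact (ih.1 J hJ).trans hle

theorem Subduction.of_zero {q : MvPolynomial (Fin n) K} {r : MvPolynomial (Fin 3) K}
    (H : Subduction h 0 q r) : q = 0 := by
  cases H with
  | refl => rfl
  | step _ c I q r hf => exact absurd rfl hf

/-- Products of homogeneous generators are homogeneous, and sharing its lead monomial with f forces
the subtracted product into the degree of f. -/
theorem Subduction.isHomogeneous {d : Fin n → ℕ} (hd : ∀ j, (h j).IsHomogeneous (d j))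
    {f r : MvPolynomial (Fin 3) K} {q : MvPolynomial (Fin n) K}
    (H : Subduction h f q r) {N : ℕ} (hf : f.IsHomogeneous N) : r.IsHomogeneous N := by
  induction H with
  | refl f => exact hf
  | step f c I q r hf0 hI hr ih =>
    apply ih
    have h1 : (C c * powProd h I).IsHomogeneous (0 + ∑ j, d j * I j) :=
      (isHomogeneous_C _ c).mul (IsHomogeneous.prod _ _ _ fun j _ => (hd j).pow _)
    have hc := (ne_zero_of_leadingTerm_eq hf0 hI).1
    have h2 : grevLex.degree (C c * powProd h I) = grevLex.degree f := by
      rw [degree_C_mul _ hc, (ne_zero_of_leadingTerm_eq hf0 hI).2]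
    have h3 : C c * powProd h I ≠ 0 := by
      rw [Ne, ← grevLex.leadingTerm_eq_zero_iff, ← hI, grevLex.leadingTerm_eq_zero_iff]
      exact hf0
    have h4 := h1 (grevLex.coeff_degree_ne_zero_iff.2 h3)
    have h5 := hf (grevLex.coeff_degree_ne_zero_iff.2 hf0)
    rw [h2, h5] at h4
    rw [← h4] at h1
    exact hf.sub h1

/-- Lets an explicit formula, written with decreasing lead monomials, be read as a chain of
subduction steps. -/
theorem Subduction.exists_cons {f g e : MvPolynomial (Fin 3) K} {c : K} {I : Fin n →₀ ℕ}
    (h0 : ∀ j, h j ≠ 0)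
    (hf : f = C c * powProd h I + g)
    (hg : grevLex.toSyn (grevLex.degree g) < grevLex.toSyn (grevLex.degree (powProd h I)))
    (H : ∃ q, Subduction h g q e) : ∃ q, Subduction h f q e := by
  -- A term with zero coefficient is not a legal step and is skipped; the explicit coefficients used
  -- later may vanish.
  by_cases hc : c = 0
  · subst hc
    simpa [hf] using H
  obtain ⟨q, H⟩ := H
  have hlt : grevLex.toSyn (grevLex.degree g) <
      grevLex.toSyn (grevLex.degree (C c * powProd h I)) := by rwa [degree_C_mul _ hc]
  have hlt' : grevLex.leadingTerm f = grevLex.leadingTerm (C c * powProd h I) := by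
    rw [hf, leadingTerm_eq_monomial, leadingTerm_eq_monomial, grevLex.degree_add_of_lt hlt,
      grevLex.leadingCoeff_add_of_lt hlt]
  refine ⟨monomial I c + q, .step f c I q e ?_ hlt' ?_⟩
  · rw [Ne, ← grevLex.leadingTerm_eq_zero_iff, hlt', grevLex.leadingTerm_eq_zero_iff]
    exact mul_ne_zero (by simpa using hc) (powProd_ne_zero h0 I)
  · rwa [hf, add_sub_cancel_left]

/-- If every lead monomial of the algebra is a product of lead monomials of generators, a nonzero
element can always be reduced, and well-foundedness of the order ends the process at zero. -/
theorem exists_subduction_zero (h0 : ∀ j, h j ≠ 0)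
    (hA : ∀ q : MvPolynomial (Fin n) K, aeval h q ≠ 0 → ∃ I, grevLex.degree (aeval h q) = grevLex.degree (powProd h I))
    (q : MvPolynomial (Fin n) K) : ∃ q', Subduction h (aeval h q) q' 0 := by
  obtain ⟨d, hd⟩ : ∃ d, d = grevLex.toSyn (grevLex.degree (aeval h q)) := ⟨_, rfl⟩
  induction d using WellFoundedLT.induction generalizing q with
  | ind d ih =>
    by_cases hq : aeval h q = 0
    · exact ⟨0, hq ▸ .refl _⟩
    obtain ⟨I, hI⟩ := hA q hq
    set c := grevLex.leadingCoeff (aeval h q) / grevLex.leadingCoeff (powProd h I)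
    have hp := powProd_ne_zero h0 I
    have hc : c ≠ 0 := div_ne_zero (grevLex.leadingCoeff_ne_zero_iff.2 hq)
      (grevLex.leadingCoeff_ne_zero_iff.2 hp)
    have hlt : grevLex.leadingTerm (aeval h q) = grevLex.leadingTerm (C c * powProd h I) := by
      rw [leadingTerm_eq_monomial, leadingTerm_eq_monomial, degree_C_mul _ hc, hI,
        leadingCoeff_C_mul, div_mul_cancel₀ _ (grevLex.leadingCoeff_ne_zero_iff.2 hp)]
    have he : aeval h q - C c * powProd h I = aeval h (q - monomial I c) := by
      rw [map_sub, aeval_monomial_eq_powProd]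
    rcases sub_eq_zero_or_degree_lt grevLex hlt with h1 | h1
    · exact ⟨_, .step _ c I 0 0 hq hlt (h1 ▸ .refl _)⟩
    · rw [he, ← hd] at h1
      obtain ⟨q', hq'⟩ := ih _ h1 _ rfl
      exact ⟨_, .step _ c I q' 0 hq hlt (he ▸ hq')⟩

theorem tatDiff_degree_lt (h0 : ∀ j, h j ≠ 0) {I J : Fin n →₀ ℕ} (H : IsTat h I J) :
    tatDiff h I J = 0 ∨ grevLex.toSyn (grevLex.degree (tatDiff h I J)) <
      grevLex.toSyn (grevLex.degree (powProd h I)) := by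
  apply sub_eq_zero_or_degree_lt
  have hI := grevLex.leadingCoeff_ne_zero_iff.2 (powProd_ne_zero h0 I)
  have hJ := grevLex.leadingCoeff_ne_zero_iff.2 (powProd_ne_zero h0 J)
  have hc : tatScalar h I J ≠ 0 := div_ne_zero hI hJ
  rw [leadingTerm_eq_monomial, leadingTerm_eq_monomial, degree_C_mul _ hc, leadingCoeff_C_mul,
    tatScalar, div_mul_cancel₀ _ hJ, show grevLex.degree _ = _ from H]

end Sagbi

/-! ### Lead monomials in the graded reverse lexicographic order -/

section GrevLex

variable {K : Type*} [Field K]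

theorem grevLex_le_iff (a b : Fin 3 →₀ ℕ) :
    grevLex.toSyn a ≤ grevLex.toSyn b ↔
      a 0 + a 1 + a 2 < b 0 + b 1 + b 2 ∨
        (a 0 + a 1 + a 2 = b 0 + b 1 + b 2 ∧ (b 2 < a 2 ∨ (a 2 = b 2 ∧ b 1 ≤ a 1))) := by
  rw [← not_lt, grevLex_lt_iff]
  omega

theorem degree_fin_three (d : Fin 3 →₀ ℕ) : Finsupp.degree d = d 0 + d 1 + d 2 := by
  rw [Finsupp.degree_eq_sum, Fin.sum_univ_three]

theorem isHomogeneous_sum_eq {f : MvPolynomial (Fin 3) K} {n : ℕ} (hf : f.IsHomogeneous n)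
    {d : Fin 3 →₀ ℕ} (hd : coeff d f ≠ 0) : d 0 + d 1 + d 2 = n := by
  have := hf hd
  rwa [show Finsupp.weight (1 : Fin 3 → ℕ) d = Finsupp.degree d from
    (DFunLike.congr_fun Finsupp.degree_eq_weight_one d).symm, degree_fin_three] at this

theorem coeff_eq_zero_of_X_dvd {f : MvPolynomial (Fin 3) K} (hf : X 2 ∣ f) {d : Fin 3 →₀ ℕ}
    (hd : d 2 = 0) : coeff d f = 0 := by
  obtain ⟨g, rfl⟩ := hf
  rw [coeff_X_mul', if_neg]
  simpa using hd

/-- In a fixed degree grevlex prefers small exponents of x, so the lead monomial has the least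
x-exponent of all monomials of a form. -/
theorem X_dvd_of_degree {f : MvPolynomial (Fin 3) K} {n : ℕ} (hf : f.IsHomogeneous n)
    (h : (grevLex.degree f) 2 ≠ 0) : X 2 ∣ f := by
  rw [X_dvd_iff_modMonomial_eq_zero]
  ext d
  by_cases hd : Finsupp.single 2 1 ≤ d
  · rw [coeff_modMonomial_of_le _ hd, coeff_zero]
  · rw [coeff_modMonomial_of_not_le _ hd, coeff_zero]
    by_contra hc
    apply hd
    have h0 : f ≠ 0 := by rintro rfl; simp at hc
    have h1 := grevLex.le_degree (mem_support_iff.2 hc)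
    have h2 := isHomogeneous_sum_eq hf hc
    have h3 := isHomogeneous_sum_eq hf (grevLex.coeff_degree_ne_zero_iff.2 h0)
    rw [grevLex_le_iff] at h1
    rw [Finsupp.single_le_iff]
    omega

/-- Monomials of a form that are free of x beat all others of the same degree, so the lead term can
be computed modulo x. -/
theorem degree_of_sub_mem_X {f g : MvPolynomial (Fin 3) K} {n : ℕ} {c : K} (hc : c ≠ 0)
    (hf : f.IsHomogeneous n) (h : f = C c * X 1 ^ n + X 2 * g) :
    grevLex.degree f = Finsupp.single 1 n ∧ grevLex.leadingCoeff f = c := by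
  have e : ∀ d : Fin 3 →₀ ℕ, d 2 = 0 → coeff d f = coeff d (C c * X 1 ^ n) := by
    intro d hd
    rw [h, coeff_add, coeff_eq_zero_of_X_dvd (dvd_mul_right _ _) hd, add_zero]
  have h1 : coeff (Finsupp.single 1 n) f = c := by
    rw [e _ (by simp), coeff_C_mul, coeff_X_pow]; simp
  have hd : grevLex.degree f = Finsupp.single 1 n := by
    refine degree_eq_of_coeff_ne_zero _ (by rwa [h1]) fun d hd => ?_
    have hd' := mem_support_iff.1 hd
    have h2 := isHomogeneous_sum_eq hf hd'
    rw [grevLex_le_iff]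
    simp only [Finsupp.single_apply]
    by_cases hd2 : d 2 = 0
    · rw [e _ hd2, coeff_C_mul, coeff_X_pow] at hd'
      have : Finsupp.single 1 n = d := by
        by_contra hne
        simp [hne] at hd'
      rw [← this]
      simp
    · simp
      omega
  exact ⟨hd, by rw [MonomialOrder.leadingCoeff, hd, h1]⟩

end GrevLex

/-! ### Algebras with lead monomials `x, y^(p²), y^(p²+2p), y^(p³+2), z^(p⁴)` -/

section Lead

/-- The key of `tOrder`: the total degree and the degree in `y, z` of the lead monomial of `h^I`,
followed by the exponents of the last three generators. -/
def tKey (p : ℕ) : (Fin 5 →₀ ℕ) →+ ℕ ×ₗ (ℕ ×ₗ (ℕ ×ₗ (ℕ ×ₗ ℕ))) where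
  toFun I := toLex (I 0 + (p ^ 2 * I 1 + (p ^ 2 + 2 * p) * I 2 + (p ^ 3 + 2) * I 3 + p ^ 4 * I 4),
    toLex (p ^ 2 * I 1 + (p ^ 2 + 2 * p) * I 2 + (p ^ 3 + 2) * I 3 + p ^ 4 * I 4,
      toLex (I 4, toLex (I 3, I 2))))
  map_zero' := by simp
  map_add' a b := by
    simp only [Finsupp.add_apply, ← toLex_add, Prod.mk_add_mk]
    ring_nf

theorem tKey_injective {p : ℕ} (hp : 0 < p) : Function.Injective (tKey p) := by
  intro a b h
  simp only [tKey, AddMonoidHom.coe_mk, ZeroHom.coe_mk, EmbeddingLike.apply_eq_iff_eq,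
    Prod.mk.injEq] at h
  obtain ⟨h1, h2, h3, h4, h5⟩ := h
  rw [h3, h4, h5] at h2
  have h6 : a 1 = b 1 := Nat.eq_of_mul_eq_mul_left (pow_pos hp 2) (by omega)
  rw [h3, h4, h5, h6] at h1
  have h0 : a 0 = b 0 := by omega
  ext i
  fin_cases i <;> assumption

theorem tKey_monotone (p : ℕ) : Monotone (tKey p) := by
  intro a b h
  have e : ∀ c i, c * a i ≤ c * b i := fun c i => Nat.mul_le_mul_left c (h i)
  have h0 := h 0
  have h1 := e (p ^ 2) 1
  have h2 := e (p ^ 2 + 2 * p) 2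
  have h3 := e (p ^ 3 + 2) 3
  have h4 := e (p ^ 4) 4
  have h2' := h 2
  have h3' := h 3
  have h4' := h 4
  simp only [tKey, AddMonoidHom.coe_mk, ZeroHom.coe_mk, Prod.Lex.toLex_le_toLex]
  omega

/-- A monomial order on the exponents of five generators, refining the order of lead monomials. -/
def tOrder (p : ℕ) [NeZero p] : MonomialOrder (Fin 5) :=
  orderOfKey (tKey p) (tKey_injective (NeZero.pos p)) (tKey_monotone p)

variable {K : Type*} [Field K]

/-- The family `h` has the lead monomials of the generators `x, f₁, f₂, f₃, N(z)`. -/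
structure HasLeads (p : ℕ) (h : Fin 5 → MvPolynomial (Fin 3) K) : Prop where
  ne_zero : ∀ j, h j ≠ 0
  eq_X : h 0 = X 2
  deg_one : grevLex.degree (h 1) = Finsupp.single 1 (p ^ 2)
  deg_two : grevLex.degree (h 2) = Finsupp.single 1 (p ^ 2 + 2 * p)
  deg_three : grevLex.degree (h 3) = Finsupp.single 1 (p ^ 3 + 2)
  deg_four : grevLex.degree (h 4) = Finsupp.single 0 (p ^ 4)

theorem exists_degree_aeval_eq {n : ℕ} (m : MonomialOrder (Fin 3))
    {h : Fin n → MvPolynomial (Fin 3) K} (h0 : ∀ j, h j ≠ 0)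
    {q : MvPolynomial (Fin n) K} (hq : q ≠ 0)
    (hinj : Set.InjOn (fun I => m.degree (powProd h I)) q.support) :
    ∃ I ∈ q.support, aeval h q ≠ 0 ∧ m.degree (aeval h q) = m.degree (powProd h I) ∧
      ∀ J ∈ q.support, m.toSyn (m.degree (powProd h J)) ≤ m.toSyn (m.degree (powProd h I)) := by
  rw [aeval_eq_sum_powProd]
  have hc : ∀ I ∈ q.support, m.degree (C (coeff I q) * powProd h I) = m.degree (powProd h I) :=
    fun I hI => degree_C_mul m (mem_support_iff.1 hI) _
  have hn : ∀ I ∈ q.support, C (coeff I q) * powProd h I ≠ 0 := fun I hI =>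
    mul_ne_zero (by simpa using hI) (powProd_ne_zero h0 I)
  obtain ⟨I, hI, h1, h2, h3⟩ := exists_degree_sum_eq m q.support
    (fun I => C (coeff I q) * powProd h I)
    (Finset.nonempty_iff_ne_empty.2 fun h => hq (support_eq_empty.1 h)) hn
    (fun I hI J hJ hIJ => hinj hI hJ (by
      simpa only [hc I hI, hc J hJ] using hIJ))
  refine ⟨I, hI, ?_, h1.trans (hc I hI), fun J hJ => ?_⟩
  · rw [← m.leadingCoeff_ne_zero_iff, h2, m.leadingCoeff_ne_zero_iff]
    exact hn I hI
  · rw [← hc I hI, ← hc J hJ]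
    exact h3 J hJ

/-- Modulo p the sum is 2c, which determines c < p since p is odd; after removing c and one factor
p, the same argument determines b. -/
theorem lead_exponent_injective {p : ℕ} (hp : p.Prime) (h2 : 2 < p) {a b c a' b' c' : ℕ}
    (hb : b < p) (hb' : b' < p) (hc : c < p) (hc' : c' < p)
    (h : p ^ 2 * a + (p ^ 2 + 2 * p) * b + (p ^ 3 + 2) * c =
      p ^ 2 * a' + (p ^ 2 + 2 * p) * b' + (p ^ 3 + 2) * c') : a = a' ∧ b = b' ∧ c = c' := by
  have hcop : Nat.gcd p 2 = 1 := (Nat.coprime_primes hp Nat.prime_two).2 (by omega)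
  have key : ∀ s t m n : ℕ, m < p → n < p → p * s + 2 * m = p * t + 2 * n → m = n := by
    intro s t m n hm hn hmn
    have h3 : 2 * m ≡ 2 * n [MOD p] := by
      have := congrArg (· % p) hmn
      simpa [Nat.ModEq, Nat.mul_add_mod] using this
    exact (Nat.ModEq.cancel_left_of_coprime hcop h3).eq_of_lt_of_lt hm hn
  have hcc := key (p * a + (p + 2) * b + p ^ 2 * c) (p * a' + (p + 2) * b' + p ^ 2 * c') c c' hc hc'
    (by linarith)
  subst hcc
  have h4 : p * (p * a + p * b + 2 * b) = p * (p * a' + p * b' + 2 * b') := by linarith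
  have h5 := Nat.eq_of_mul_eq_mul_left hp.pos h4
  have hbb := key (a + b) (a' + b') b b' hb hb' (by linarith)
  subst hbb
  exact ⟨Nat.eq_of_mul_eq_mul_left hp.pos (by omega), rfl, rfl⟩

section

variable {p : ℕ} {h : Fin 5 → MvPolynomial (Fin 3) K}

theorem HasLeads.degree_powProd (H : HasLeads p h) (I : Fin 5 →₀ ℕ) :
    (grevLex.degree (powProd h I)) 0 = p ^ 4 * I 4 ∧
    (grevLex.degree (powProd h I)) 1 =
      p ^ 2 * I 1 + (p ^ 2 + 2 * p) * I 2 + (p ^ 3 + 2) * I 3 ∧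
    (grevLex.degree (powProd h I)) 2 = I 0 := by
  rw [RankFour.degree_powProd _ H.ne_zero, Fin.sum_univ_five, H.eq_X, H.deg_one, H.deg_two,
    H.deg_three, H.deg_four, grevLex.degree_X]
  refine ⟨?_, ?_, ?_⟩ <;> simp <;> ring

theorem HasLeads.injective (H : HasLeads p h) (hp : p.Prime) (h2 : 2 < p) {I J : Fin 5 →₀ ℕ}
    (hI2 : I 2 < p) (hI3 : I 3 < p) (hJ2 : J 2 < p) (hJ3 : J 3 < p)
    (hIJ : grevLex.degree (powProd h I) = grevLex.degree (powProd h J)) : I = J := by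
  obtain ⟨a0, a1, a2⟩ := H.degree_powProd I
  obtain ⟨b0, b1, b2⟩ := H.degree_powProd J
  rw [hIJ] at a0 a1 a2
  obtain ⟨c1, c2, c3⟩ := lead_exponent_injective hp h2 hI2 hJ2 hI3 hJ3 (a1.symm.trans b1)
  have c4 := Nat.eq_of_mul_eq_mul_left (pow_pos hp.pos 4) (a0.symm.trans b0)
  have c0 := a2.symm.trans b2
  ext i
  fin_cases i <;> assumption

/-- `tOrder` compares lead monomials of products and breaks ties by the exponents of the fourth and
then the third generator. Hence in each of the two tête-à-têtes the pure p-th power is the larger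
side. -/
theorem HasLeads.tOrder_lt_iff [NeZero p] (H : HasLeads p h) (I J : Fin 5 →₀ ℕ) :
    (tOrder p).toSyn I < (tOrder p).toSyn J ↔
      grevLex.toSyn (grevLex.degree (powProd h I)) < grevLex.toSyn (grevLex.degree (powProd h J)) ∨
      (grevLex.degree (powProd h I) = grevLex.degree (powProd h J) ∧
        (I 3 < J 3 ∨ (I 3 = J 3 ∧ I 2 < J 2))) := by
  obtain ⟨a0, a1, a2⟩ := H.degree_powProd I
  obtain ⟨b0, b1, b2⟩ := H.degree_powProd J
  have hp4 : 0 < p ^ 4 := pow_pos (NeZero.pos p) 4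
  have e : grevLex.degree (powProd h I) = grevLex.degree (powProd h J) ↔
      (grevLex.degree (powProd h I)) 0 = (grevLex.degree (powProd h J)) 0 ∧
      (grevLex.degree (powProd h I)) 1 = (grevLex.degree (powProd h J)) 1 ∧
      (grevLex.degree (powProd h I)) 2 = (grevLex.degree (powProd h J)) 2 := by
    constructor
    · intro h; simp [h]
    · rintro ⟨h0, h1, h2⟩
      ext i; fin_cases i <;> assumption
  have l1 : I 4 < J 4 ↔ p ^ 4 * I 4 < p ^ 4 * J 4 := (Nat.mul_lt_mul_left hp4).symm
  have l2 : I 4 = J 4 ↔ p ^ 4 * I 4 = p ^ 4 * J 4 := (Nat.mul_right_inj hp4.ne').symm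
  rw [tOrder, orderOfKey_lt_iff, grevLex_lt_iff, e, a0, a1, a2, b0, b1, b2]
  simp only [tKey, AddMonoidHom.coe_mk, ZeroHom.coe_mk, Prod.Lex.toLex_lt_toLex]
  omega

variable [NeZero p] {ρ₁ ρ₂ : MvPolynomial (Fin 5) K}

/-- `ρ` is a relation among the `h j` with lead monomial `t^I` and lead coefficient one. -/
def IsMonicRel (p : ℕ) [NeZero p] (h : Fin 5 → MvPolynomial (Fin 3) K) (I : Fin 5 →₀ ℕ)
    (ρ : MvPolynomial (Fin 5) K) : Prop :=
  aeval h ρ = 0 ∧ (tOrder p).degree ρ = I ∧ (tOrder p).leadingCoeff ρ = 1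

theorem isMonicRel_of_lt {ρ q : MvPolynomial (Fin 5) K} {I : Fin 5 →₀ ℕ} (h0 : aeval h ρ = 0)
    (hI : I ≠ 0) (e : ρ = monomial I 1 + q)
    (hq : ∀ J ∈ q.support, (tOrder p).toSyn J < (tOrder p).toSyn I) : IsMonicRel p h I ρ := by
  classical
  have hI' : 0 < (tOrder p).toSyn I :=
    (tOrder p).toSyn_lt_iff_ne_zero.2 (by simpa using hI)
  have hd : (tOrder p).degree (monomial I (1 : K)) = I := by
    rw [MonomialOrder.degree_monomial, if_neg one_ne_zero]
  have hlt : (tOrder p).toSyn ((tOrder p).degree q) <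
      (tOrder p).toSyn ((tOrder p).degree (monomial I (1 : K))) := by
    rw [hd, (tOrder p).degree_lt_iff (by simpa using hI')]
    exact hq
  refine ⟨h0, ?_, ?_⟩
  · rw [e, (tOrder p).degree_add_of_lt hlt, hd]
  · rw [e, (tOrder p).leadingCoeff_add_of_lt hlt, (tOrder p).leadingCoeff_monomial]

/-- Division with remainder by two monic relations, which confines the exponents of the third and
fourth generators to the range below p. -/
theorem exists_normalForm (h1 : IsMonicRel p h (Finsupp.single 2 p) ρ₁)
    (h2 : IsMonicRel p h (Finsupp.single 3 p) ρ₂) (f : MvPolynomial (Fin 5) K) :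
    ∃ r, f - r ∈ Ideal.span {ρ₁, ρ₂} ∧ aeval h r = aeval h f ∧
      ∀ I ∈ r.support, I 2 < p ∧ I 3 < p := by
  obtain ⟨g, r, e, -, hr⟩ := (tOrder p).div (b := ![ρ₁, ρ₂])
    (fun i => by fin_cases i <;> simp [h1.2.2, h2.2.2]) f
  have hmem : f - r ∈ Ideal.span {ρ₁, ρ₂} := by
    rw [e, add_sub_cancel_right, Finsupp.linearCombination_apply, Finsupp.sum_fintype _ _ (by simp),
      Fin.sum_univ_two]
    exact add_mem (Ideal.mul_mem_left _ _ (Ideal.subset_span (by simp)))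
      (Ideal.mul_mem_left _ _ (Ideal.subset_span (by simp)))
  refine ⟨r, hmem, ?_, fun I hI => ?_⟩
  · have : Ideal.span {ρ₁, ρ₂} ≤ RingHom.ker (aeval h) := by
      rw [Ideal.span_le]
      rintro x (rfl | rfl)
      exacts [h1.1, h2.1]
    have := this hmem
    rw [RingHom.mem_ker, map_sub, sub_eq_zero] at this
    exact this.symm
  · have hr0 := hr I hI 0
    have hr1 := hr I hI 1
    simp only [Matrix.cons_val_zero, Matrix.cons_val_one, h1.2.1, h2.2.1,
      Finsupp.single_le_iff, not_le] at hr0 hr1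
    exact ⟨hr0, hr1⟩

omit [NeZero p] in
theorem exists_lead_of_normalForm (hp : p.Prime) (hp2 : 2 < p) (H : HasLeads p h)
    {r : MvPolynomial (Fin 5) K} (hr0 : r ≠ 0) (hr : ∀ I ∈ r.support, I 2 < p ∧ I 3 < p) :
    ∃ I ∈ r.support, aeval h r ≠ 0 ∧
      grevLex.degree (aeval h r) = grevLex.degree (powProd h I) ∧ ∀ J ∈ r.support,
        grevLex.toSyn (grevLex.degree (powProd h J)) ≤
          grevLex.toSyn (grevLex.degree (powProd h I)) :=
  exists_degree_aeval_eq grevLex H.ne_zero hr0 fun I hI J hJ hIJ =>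
    H.injective hp hp2 (hr I hI).1 (hr I hI).2 (hr J hJ).1 (hr J hJ).2 hIJ

theorem exists_lead (hp : p.Prime) (hp2 : 2 < p) (H : HasLeads p h)
    (h1 : IsMonicRel p h (Finsupp.single 2 p) ρ₁)
    (h2 : IsMonicRel p h (Finsupp.single 3 p) ρ₂) (q : MvPolynomial (Fin 5) K)
    (hq : aeval h q ≠ 0) :
    ∃ I, grevLex.degree (aeval h q) = grevLex.degree (powProd h I) := by
  obtain ⟨r, -, he, hr⟩ := exists_normalForm h1 h2 q
  have hr0 : r ≠ 0 := by
    rintro rfl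
    exact hq (by rw [← he, map_zero])
  obtain ⟨I, -, -, hI, -⟩ := exists_lead_of_normalForm hp hp2 H hr0 hr
  exact ⟨I, he ▸ hI⟩

theorem ker_aeval_eq (hp : p.Prime) (hp2 : 2 < p) (H : HasLeads p h)
    (h1 : IsMonicRel p h (Finsupp.single 2 p) ρ₁)
    (h2 : IsMonicRel p h (Finsupp.single 3 p) ρ₂) :
    RingHom.ker (aeval h : MvPolynomial (Fin 5) K →ₐ[K] MvPolynomial (Fin 3) K) =
      Ideal.span {ρ₁, ρ₂} := by
  refine le_antisymm (fun q hq => ?_) ?_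
  · obtain ⟨r, hm, he, hr⟩ := exists_normalForm h1 h2 q
    by_cases hr0 : r = 0
    · simpa [hr0] using hm
    · obtain ⟨I, -, hI, -⟩ := exists_lead_of_normalForm hp hp2 H hr0 hr
      exact absurd (he.trans hq) hI
  · rw [Ideal.span_le]
    rintro x (rfl | rfl)
    exacts [h1.1, h2.1]

/-- The part of the normal form that is free of the variable of x would, if nonzero, have a lead
monomial free of x. As its value is divisible by x, this part vanishes. -/
theorem exists_eq_X_mul (hp : p.Prime) (hp2 : 2 < p) (H : HasLeads p h)
    (h1 : IsMonicRel p h (Finsupp.single 2 p) ρ₁)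
    (h2 : IsMonicRel p h (Finsupp.single 3 p) ρ₂) (q : MvPolynomial (Fin 5) K)
    (hq : X 2 ∣ aeval h q) :
    ∃ q' : MvPolynomial (Fin 5) K, aeval h q = X 2 * aeval h q' := by
  obtain ⟨r, -, he, hr⟩ := exists_normalForm h1 h2 q
  -- `r₀` collects the terms of the normal form that do not involve the variable of x.
  set r₀ := r.modMonomial (Finsupp.single 0 1) with hr₀
  have hs : ∀ I ∈ r₀.support, I ∈ r.support ∧ I 0 = 0 := by
    intro I hI
    rw [mem_support_iff] at hI ⊢
    by_cases h0 : Finsupp.single 0 1 ≤ I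
    · rw [hr₀, coeff_modMonomial_of_le _ h0] at hI
      exact absurd rfl hI
    · rw [hr₀, coeff_modMonomial_of_not_le _ h0] at hI
      rw [Finsupp.single_le_iff] at h0
      exact ⟨hI, by omega⟩
  have hdm : aeval h r = X 2 * aeval h (r.divMonomial (Finsupp.single 0 1)) + aeval h r₀ := by
    conv_lhs => rw [← divMonomial_add_modMonomial r (Finsupp.single 0 1)]
    rw [map_add, map_mul, aeval_monomial_eq_powProd, powProd_single, pow_one, H.eq_X, C_1, one_mul]
  refine ⟨r.divMonomial (Finsupp.single 0 1), ?_⟩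
  rw [← he, hdm, add_eq_left]
  by_cases hr0 : r₀ = 0
  · rw [hr0, map_zero]
  obtain ⟨I, hI, hne, hd, -⟩ := exists_lead_of_normalForm hp hp2 H hr0
    fun I hI => hr I (hs I hI).1
  have hdvd : X 2 ∣ aeval h r₀ := by
    rw [← he, hdm] at hq
    exact (dvd_add_right (dvd_mul_right _ _)).1 hq
  refine absurd (coeff_eq_zero_of_X_dvd hdvd (d := grevLex.degree (aeval h r₀)) ?_)
    (grevLex.coeff_degree_ne_zero_iff.2 hne)
  rw [hd, (H.degree_powProd I).2.2, (hs I hI).2]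

/-- The two lead monomials are powers of different variables, hence coprime, so `ρ₂` is a
nonzerodivisor modulo `ρ₁`. The quotient is nonzero because 1 is not a relation. -/
theorem isRegular_pair (hp : p.Prime) (hp2 : 2 < p) (H : HasLeads p h)
    (h1 : IsMonicRel p h (Finsupp.single 2 p) ρ₁)
    (h2 : IsMonicRel p h (Finsupp.single 3 p) ρ₂) :
    RingTheory.Sequence.IsRegular (MvPolynomial (Fin 5) K) [ρ₁, ρ₂] := by
  set m := tOrder p
  have hne1 : ρ₁ ≠ 0 := m.leadingCoeff_ne_zero_iff.1 (by rw [h1.2.2]; exact one_ne_zero)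
  have hne2 : ρ₂ ≠ 0 := m.leadingCoeff_ne_zero_iff.1 (by rw [h2.2.2]; exact one_ne_zero)
  have key : ∀ g, ρ₂ * g ∈ Ideal.span {ρ₁} → g ∈ Ideal.span {ρ₁} := by
    intro g hg
    obtain ⟨s, r, e, -, hr⟩ := m.div_single (b := ρ₁) (by rw [h1.2.2]; exact isUnit_one) g
    rw [Ideal.mem_span_singleton] at hg ⊢
    by_cases hr0 : r = 0
    · rw [e, hr0, add_zero]; exact dvd_mul_left _ _
    exfalso
    have hd : ρ₁ ∣ ρ₂ * r := by
      rw [e, mul_add] at hg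
      exact (dvd_add_right (dvd_mul_of_dvd_right (dvd_mul_left _ _) _)).1 hg
    obtain ⟨t, ht⟩ := hd
    have ht0 : t ≠ 0 := by
      rintro rfl
      rw [mul_zero] at ht
      exact mul_ne_zero hne2 hr0 ht
    have hdeg := congrArg (fun f => (m.degree f) 2) ht
    simp only [m.degree_mul hne2 hr0, m.degree_mul hne1 ht0, h1.2.1, h2.2.1, m] at hdeg
    have := hr _ (m.degree_mem_support hr0)
    rw [h1.2.1, Finsupp.single_le_iff] at this
    simp [m] at hdeg this
    omega
  rw [RingTheory.Sequence.isRegular_iff]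
  constructor
  · rw [RingTheory.Sequence.isWeaklyRegular_cons_iff, RingTheory.Sequence.isWeaklyRegular_singleton_iff]
    refine ⟨fun a b hab => mul_left_cancel₀ hne1 hab, ?_⟩
    rw [isSMulRegular_iff_right_eq_zero_of_smul]
    intro g hg
    obtain ⟨g, rfl⟩ := Submodule.Quotient.mk_surjective _ g
    rw [← Submodule.Quotient.mk_smul, Submodule.Quotient.mk_eq_zero] at hg
    rw [Submodule.Quotient.mk_eq_zero]
    rw [← Submodule.ideal_span_singleton_smul, smul_eq_mul, Ideal.mul_top] at hg ⊢
    exact key g hg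
  · rw [smul_eq_mul, Ideal.mul_top]
    intro htop
    have h3 : (1 : MvPolynomial (Fin 5) K) ∈ Ideal.span {ρ₁, ρ₂} := by
      rw [Ideal.ofList_cons, Ideal.ofList_singleton, ← Ideal.span_union] at htop
      have : (1 : MvPolynomial (Fin 5) K) ∈ (⊤ : Ideal _) := Submodule.mem_top
      rw [htop] at this
      rwa [Set.singleton_union] at this
    rw [← ker_aeval_eq hp hp2 H h1 h2, RingHom.mem_ker, map_one] at h3
    exact one_ne_zero h3

/-- The subduction starts from a difference whose lead terms have cancelled, so all its terms lie
strictly below the tête-à-tête; the tie between the two sides is broken by `hIJ`. Therefore any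
subduction to zero supplies an admissible relation. -/
theorem IsTatRelation.isMonicRel (H : HasLeads p h) {I J : Fin 5 →₀ ℕ}
    (hI : I ≠ 0) (hIJ : J 3 < I 3 ∨ (J 3 = I 3 ∧ J 2 < I 2))
    {ρ : MvPolynomial (Fin 5) K} (hρ : IsTatRelation h I J ρ) : IsMonicRel p h I ρ := by
  classical
  obtain ⟨ht, q, hq, e⟩ := hρ
  refine isMonicRel_of_lt (q := - monomial J (tatScalar h I J) - q) ?_ hI (by rw [e]; ring) ?_
  · have := hq.eq_add
    rw [tatDiff, add_zero] at this
    rw [e, map_sub, map_sub, aeval_monomial_eq_powProd, aeval_monomial_eq_powProd, ← this, C_1,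
      one_mul, sub_self]
  · intro L hL
    rw [H.tOrder_lt_iff]
    rcases Finset.mem_union.1 (support_sub _ _ _ hL) with hL | hL
    · rw [support_neg] at hL
      have := Finset.mem_singleton.1 (support_monomial_subset hL)
      subst this
      exact Or.inr ⟨ht.symm, hIJ⟩
    · left
      rcases tatDiff_degree_lt H.ne_zero ht with h0 | h0
      · rw [h0] at hq
        rw [hq.of_zero] at hL
        simp at hL
      · exact (hq.degree_le.1 L hL).trans_lt h0

end

end Lead

/-! ### Minors and Plücker relations -/

section Minors

variable {K : Type*} [Field K] {p : ℕ} {M : Matrix (Fin 2) (Fin 4) K}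

theorem gam_eq_zero {J : Fin 4 → ℕ} {i j : Fin 4} (hij : i ≠ j) (h : J i = J j) :
    gam p M J = 0 :=
  Matrix.det_zero_of_row_eq hij (by ext k; simp [h])

theorem gam_swap (i j k l : ℕ) : gam p M ![i, j, l, k] = - gam p M ![i, j, k, l] := by
  have := Matrix.det_permute (Equiv.swap (2 : Fin 4) 3)
    (Matrix.of fun r c => Gam p M (![i, j, k, l] r) c)
  rw [Equiv.Perm.sign_swap (by decide)] at this
  simp only [gam]
  rw [show (Matrix.of fun r c => Gam p M (![i, j, l, k] r) c) =
    (Matrix.of fun r c => Gam p M (![i, j, k, l] r) c).submatrix (Equiv.swap (2 : Fin 4) 3) id from ?_,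
    this]
  · simp
  · ext r c
    fin_cases r <;> rfl

theorem Gam_add_two [Fact p.Prime] {r : ℕ} (hr : 0 < r) (j : Fin 4) :
    Gam p M (r + 2) j = Gam p M r j ^ p := by
  have e : (r + 2 - 1) / 2 = (r - 1) / 2 + 1 := by omega
  simp only [Gam, Nat.odd_add, e, pow_succ, pow_mul, even_two, iff_true]
  split_ifs <;> rfl

theorem gam_add_two [Fact p.Prime] [CharP K p] {i j k l : ℕ} (hi : 0 < i) (hj : 0 < j) (hk : 0 < k)
    (hl : 0 < l) : gam p M ![i + 2, j + 2, k + 2, l + 2] = gam p M ![i, j, k, l] ^ p := by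
  rw [gam, gam, ← frobenius_def, RingHom.map_det]
  congr 1
  ext r c
  fin_cases r <;> simp [frobenius_def, Gam_add_two, *]

/-- Expansion along the last column of a `5 × 5` matrix whose first columns are those of `Γ`. -/
theorem det_snoc_column {S : Type*} [CommRing S] (κ : K →+* S) (J : Fin 5 → ℕ) (w : Fin 5 → S) :
    (Matrix.of fun i : Fin 5 =>
      (Fin.snoc (fun j : Fin 4 => κ (Gam p M (J i) j)) (w i) : Fin 5 → S)).det =
    ∑ i : Fin 5, (-1) ^ (i : ℕ) * κ (gam p M (J ∘ i.succAbove)) * w i := by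
  rw [Matrix.det_succ_column _ (Fin.last 4)]
  refine Finset.sum_congr rfl fun i _ => ?_
  have e : (Matrix.of fun i : Fin 5 =>
      (Fin.snoc (fun j : Fin 4 => κ (Gam p M (J i) j)) (w i) : Fin 5 → S)).submatrix
      i.succAbove (Fin.last 4).succAbove =
      κ.mapMatrix (Matrix.of fun r c => Gam p M ((J ∘ i.succAbove) r) c) := by
    ext r c
    simp only [Matrix.submatrix_apply, Matrix.of_apply, Fin.succAbove_last, Fin.snoc_castSucc]
    rfl
  rw [e, ← RingHom.map_det, Matrix.of_apply, Fin.snoc_last, pow_add]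
  simp only [gam, Fin.val_last, Even.neg_pow (show Even 4 by decide), one_pow, mul_one]
  ring

/-- Cramer's rule: repeating one of the four columns as a fifth makes the 5 × 5 determinant vanish.
-/
theorem sum_gam_mul_Gam (J : Fin 5 → ℕ) (j : Fin 4) :
    ∑ i : Fin 5, (-1) ^ (i : ℕ) * gam p M (J ∘ i.succAbove) * Gam p M (J i) j = 0 := by
  have := det_snoc_column (p := p) (M := M) (RingHom.id K) J fun i => Gam p M (J i) j
  simp only [RingHom.id_apply] at this
  rw [← this]
  refine Matrix.det_zero_of_column_eq (i := j.castSucc) (j := Fin.last 4)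
    (Fin.castSucc_lt_last j).ne fun k => ?_
  simp only [Matrix.of_apply, Fin.snoc_castSucc, Fin.snoc_last]

theorem gam_snoc (i j k l : ℕ) : gam p M ![i, j, k, l] =
    ∑ c : Fin 4, Gam p M l c *
      ((-1) ^ (3 + (c : ℕ)) * ((Matrix.of fun r c => Gam p M (![i, j, k] r) c).submatrix id
        c.succAbove).det) := by
  rw [gam, Matrix.det_succ_row _ (Fin.last 3)]
  refine Finset.sum_congr rfl fun c _ => ?_
  have e : (Matrix.of fun r c => Gam p M (![i, j, k, l] r) c).submatrix (Fin.last 3).succAbove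
      c.succAbove = (Matrix.of fun r c => Gam p M (![i, j, k] r) c).submatrix id c.succAbove := by
    ext r d
    fin_cases r <;> rfl
  rw [e, Matrix.of_apply, show ![i, j, k, l] (Fin.last 3) = l from rfl, Fin.val_last]
  ring

/-- Each minor in the second factor is linear in its last row, so the identity reduces column by
column to `sum_gam_mul_Gam`. -/
theorem plucker (J : Fin 5 → ℕ) (i j k : ℕ) :
    ∑ s : Fin 5, (-1) ^ (s : ℕ) * gam p M (J ∘ s.succAbove) * gam p M ![i, j, k, J s] = 0 := by
  simp only [gam_snoc i j k, Finset.mul_sum]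
  rw [Finset.sum_comm]
  refine Finset.sum_eq_zero fun c _ => ?_
  have h := sum_gam_mul_Gam (p := p) (M := M) J c
  rw [← zero_mul ((-1) ^ (3 + (c : ℕ)) * ((Matrix.of fun r c => Gam p M (![i, j, k] r) c).submatrix
    id c.succAbove).det), ← h, Finset.sum_mul]
  exact Finset.sum_congr rfl fun _ _ => by ring

theorem comp_succAbove (j₁ j₂ j₃ j₄ j₅ : ℕ) :
    ![j₁, j₂, j₃, j₄, j₅] ∘ (0 : Fin 5).succAbove = ![j₂, j₃, j₄, j₅] ∧
    ![j₁, j₂, j₃, j₄, j₅] ∘ (1 : Fin 5).succAbove = ![j₁, j₃, j₄, j₅] ∧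
    ![j₁, j₂, j₃, j₄, j₅] ∘ (2 : Fin 5).succAbove = ![j₁, j₂, j₄, j₅] ∧
    ![j₁, j₂, j₃, j₄, j₅] ∘ (3 : Fin 5).succAbove = ![j₁, j₂, j₃, j₅] ∧
    ![j₁, j₂, j₃, j₄, j₅] ∘ (4 : Fin 5).succAbove = ![j₁, j₂, j₃, j₄] := by
  refine ⟨?_, ?_, ?_, ?_, ?_⟩ <;> (ext r; fin_cases r <;> rfl)

theorem plucker' (j₁ j₂ j₃ j₄ j₅ i j k : ℕ) :
    gam p M ![j₂, j₃, j₄, j₅] * gam p M ![i, j, k, j₁]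
      - gam p M ![j₁, j₃, j₄, j₅] * gam p M ![i, j, k, j₂]
      + gam p M ![j₁, j₂, j₄, j₅] * gam p M ![i, j, k, j₃]
      - gam p M ![j₁, j₂, j₃, j₅] * gam p M ![i, j, k, j₄]
      + gam p M ![j₁, j₂, j₃, j₄] * gam p M ![i, j, k, j₅] = 0 := by
  obtain ⟨h0, h1, h2, h3, h4⟩ := comp_succAbove j₁ j₂ j₃ j₄ j₅
  have h := plucker (p := p) (M := M) ![j₁, j₂, j₃, j₄, j₅] i j k
  rw [Fin.sum_univ_five, h0, h1, h2, h3, h4] at h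
  rw [← h]
  simp
  ring

theorem gam_repeat_fst (i j k : ℕ) : gam p M ![i, j, k, i] = 0 :=
  gam_eq_zero (i := 0) (j := 3) (by decide) rfl

theorem gam_repeat_snd (i j k : ℕ) : gam p M ![i, j, k, j] = 0 :=
  gam_eq_zero (i := 1) (j := 3) (by decide) rfl

theorem gam_repeat_trd (i j k : ℕ) : gam p M ![i, j, k, k] = 0 :=
  gam_eq_zero (i := 2) (j := 3) (by decide) rfl

theorem plucker_1257 : gam p M ![1, 2, 3, 7] * gam p M ![1, 2, 4, 5]
    - gam p M ![1, 2, 4, 7] * gam p M ![1, 2, 3, 5] =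
      - (gam p M ![1, 2, 3, 4] * gam p M ![1, 2, 5, 7]) := by
  have h := plucker' (p := p) (M := M) 1 2 4 5 7 1 2 3
  simp only [gam_repeat_fst, gam_repeat_snd] at h
  linear_combination h

theorem plucker_1357 : gam p M ![1, 2, 3, 7] * gam p M ![1, 3, 4, 5]
    - gam p M ![1, 3, 4, 7] * gam p M ![1, 2, 3, 5] =
      - (gam p M ![1, 2, 3, 4] * gam p M ![1, 3, 5, 7]) := by
  have h := plucker' (p := p) (M := M) 1 3 4 5 7 1 2 3
  simp only [gam_repeat_fst, gam_repeat_trd] at h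
  linear_combination h

section Frob

variable [Fact p.Prime] [CharP K p]

/-- Raising the entries to the p-th power moves rows down by two, so minors of rows 3, …, 7 are p-th
powers of minors of rows 1, …, 5. This converts a Plücker relation into one that mixes minors and
p-th powers. -/
theorem frob_plucker (i j k : ℕ) :
    gam p M ![2, 3, 4, 5] ^ p * gam p M ![i, j, k, 3]
      - gam p M ![1, 3, 4, 5] ^ p * gam p M ![i, j, k, 4]
      + gam p M ![1, 2, 4, 5] ^ p * gam p M ![i, j, k, 5]
      - gam p M ![1, 2, 3, 5] ^ p * gam p M ![i, j, k, 6]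
      + gam p M ![1, 2, 3, 4] ^ p * gam p M ![i, j, k, 7] = 0 := by
  have h := plucker' (p := p) (M := M) 3 4 5 6 7 i j k
  rw [← gam_add_two, ← gam_add_two, ← gam_add_two, ← gam_add_two, ← gam_add_two]
  · exact h
  all_goals norm_num

theorem frob_plucker_1237 : gam p M ![1, 2, 3, 4] ^ p * gam p M ![1, 2, 3, 7] =
    gam p M ![1, 2, 3, 5] ^ p * gam p M ![1, 2, 3, 6]
      - gam p M ![1, 2, 4, 5] ^ p * gam p M ![1, 2, 3, 5]
      + gam p M ![1, 3, 4, 5] ^ p * gam p M ![1, 2, 3, 4] := by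
  have h := frob_plucker (p := p) (M := M) 1 2 3
  simp only [gam_repeat_trd] at h
  linear_combination h

theorem frob_plucker_1247 : gam p M ![1, 2, 3, 4] ^ p * gam p M ![1, 2, 4, 7] =
    gam p M ![1, 2, 3, 5] ^ p * gam p M ![1, 2, 4, 6]
      - gam p M ![1, 2, 4, 5] ^ p * gam p M ![1, 2, 4, 5]
      + gam p M ![2, 3, 4, 5] ^ p * gam p M ![1, 2, 3, 4] := by
  have h := frob_plucker (p := p) (M := M) 1 2 4
  simp only [gam_repeat_trd] at h
  rw [gam_swap 1 2 3 4] at h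
  linear_combination h

theorem frob_plucker_1347 : gam p M ![1, 2, 3, 4] ^ p * gam p M ![1, 3, 4, 7] =
    gam p M ![1, 2, 3, 5] ^ p * gam p M ![1, 3, 4, 6]
      - gam p M ![1, 2, 4, 5] ^ p * gam p M ![1, 3, 4, 5] := by
  have h := frob_plucker (p := p) (M := M) 1 3 4
  simp only [gam_repeat_trd, gam_repeat_snd] at h
  linear_combination h

theorem frob_plucker_2347 : gam p M ![1, 2, 3, 4] ^ p * gam p M ![2, 3, 4, 7] =
    gam p M ![1, 2, 3, 5] ^ p * gam p M ![2, 3, 4, 6]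
      - gam p M ![1, 2, 4, 5] ^ p * gam p M ![2, 3, 4, 5] := by
  have h := frob_plucker (p := p) (M := M) 2 3 4
  simp only [gam_repeat_trd, gam_repeat_snd] at h
  linear_combination h

end Frob

theorem algebraMap_C (c : K) :
    algebraMap (MvPolynomial (Fin 3) K) (FractionRing (MvPolynomial (Fin 3) K)) (C c) =
      algebraMap K _ c :=
  (IsScalarTower.algebraMap_apply K (MvPolynomial (Fin 3) K) _ c).symm

theorem fTilde_eq (j₁ j₂ j₃ j₄ j₅ : ℕ) :
    fTilde p M ![j₁, j₂, j₃, j₄, j₅] =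
      algebraMap K _ ((gam p M ![j₂, j₃, j₄, j₅])) * extraCol p j₁
      - algebraMap K _ ((gam p M ![j₁, j₃, j₄, j₅])) * extraCol p j₂
      + algebraMap K _ ((gam p M ![j₁, j₂, j₄, j₅])) * extraCol p j₃
      - algebraMap K _ ((gam p M ![j₁, j₂, j₃, j₅])) * extraCol p j₄
      + algebraMap K _ ((gam p M ![j₁, j₂, j₃, j₄])) * extraCol p j₅ := by
  obtain ⟨h0, h1, h2, h3, h4⟩ := comp_succAbove j₁ j₂ j₃ j₄ j₅
  have h := det_snoc_column (p := p) (M := M)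
    ((algebraMap (MvPolynomial (Fin 3) K) (FractionRing (MvPolynomial (Fin 3) K))).comp C)
    ![j₁, j₂, j₃, j₄, j₅] fun i => extraCol p (![j₁, j₂, j₃, j₄, j₅] i)
  rw [Fin.sum_univ_five, h0, h1, h2, h3, h4] at h
  refine Eq.trans h ?_
  simp [algebraMap_C]
  ring

end Minors

/-! ### Filtered fields -/

section Fil

variable {F : Type*} [Field F] {D : ℤ → AddSubgroup F}

/-- `D` is a multiplicative filtration, increasing in the degree. -/
structure IsMulFiltration (D : ℤ → AddSubgroup F) : Prop where
  mono : Monotone D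
  one : (1 : F) ∈ D 0
  mul : ∀ {f g : F} {m n : ℤ}, f ∈ D m → g ∈ D n → f * g ∈ D (m + n)

namespace IsMulFiltration

variable (H : IsMulFiltration D) {f g A B : F} {m n j : ℤ}

include H

theorem mem_of_le (hf : f ∈ D m) (h : m ≤ n) : f ∈ D n := H.mono h hf

theorem add (hf : f ∈ D m) (hg : g ∈ D n) : f + g ∈ D (max m n) :=
  add_mem (H.mono (le_max_left _ _) hf) (H.mono (le_max_right _ _) hg)

theorem sub (hf : f ∈ D m) (hg : g ∈ D n) : f - g ∈ D (max m n) :=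
  sub_mem (H.mono (le_max_left _ _) hf) (H.mono (le_max_right _ _) hg)

theorem pow (hf : f ∈ D m) (k : ℕ) : f ^ k ∈ D (k * m) := by
  induction k with
  | zero => simpa using H.one
  | succ k ih =>
    rw [pow_succ]
    refine H.mem_of_le (H.mul ih hf) (le_of_eq ?_)
    push_cast
    ring

/-- An approximation whose error is j below the leading degree keeps the same gap j under powers
and, by `mul_sub_mul`, under products. -/
theorem pow_sub_pow (hA : A ∈ D m) (hj : 0 ≤ j) (hf : f - A ∈ D (m - j)) (k : ℕ) :
    f ^ k - A ^ k ∈ D (k * m - j) := by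
  have hf' : f ∈ D m := by
    have := add_mem (H.mono (by omega : m - j ≤ m) hf) hA
    rwa [sub_add_cancel] at this
  induction k with
  | zero => simp
  | succ k ih =>
    have e : f ^ (k + 1) - A ^ (k + 1) = (f ^ k - A ^ k) * f + A ^ k * (f - A) := by ring
    rw [e]
    refine add_mem (H.mem_of_le (H.mul ih hf') (le_of_eq ?_))
      (H.mem_of_le (H.mul (H.pow hA k) hf) (le_of_eq ?_)) <;> push_cast <;> ring

theorem mul_sub_mul (hA : A ∈ D m) (hB : B ∈ D n) (hj : 0 ≤ j) (hf : f - A ∈ D (m - j))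
    (hg : g - B ∈ D (n - j)) : f * g - A * B ∈ D (m + n - j) := by
  have e : f * g - A * B = (f - A) * ((g - B) + B) + A * (g - B) := by ring
  have hg' : g - B + B ∈ D n := add_mem (H.mono (by omega) hg) hB
  rw [e]
  exact add_mem (H.mem_of_le (H.mul hf hg') (le_of_eq (by ring)))
      (H.mem_of_le (H.mul hA hg) (le_of_eq (by ring)))

end IsMulFiltration

/-! ### The lead term of the third invariant -/

/-- The minors of `Γ` that enter the third invariant, with the relations between them, in a filtered
field with elements `u`, `w` of degree one. -/
structure MinorData (p : ℕ) (D : ℤ → AddSubgroup F) where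
  (a b c d e b' c' d' e' g₁ g₂ g₃ g₄ g₅ g₆ u w : F)
  fil : IsMulFiltration D
  mem : ∀ t ∈ ({a, b, c, d, e, b', c', d', e', g₁, g₂, g₃, g₄, g₅, g₆, a⁻¹, b⁻¹, 2⁻¹} : Set F),
    t ∈ D 0
  hu : u ∈ D 1
  hw : w ∈ D 1
  ha : a ≠ 0
  hb : b ≠ 0
  rel₁ : a ^ p * g₁ = b ^ p * b' - c ^ p * b + d ^ p * a
  rel₂ : a ^ p * g₂ = b ^ p * c' - c ^ p * c + e ^ p * a
  rel₃ : a ^ p * g₃ = b ^ p * d' - c ^ p * d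
  rel₄ : a ^ p * g₄ = b ^ p * e' - c ^ p * e
  rel₅ : g₁ * c - g₂ * b = -(a * g₅)
  rel₆ : g₁ * d - g₃ * b = -(a * g₆)

namespace MinorData

variable {p : ℕ} (S : MinorData p D)

/-- The lower order part of `F₁`. -/
def s : F := S.b * ((S.u ^ p) ^ 2 - S.w ^ p) + S.c * S.u ^ p + S.d * (S.u ^ 2 - S.w) + S.e * S.u

/-- The lower order part of `G`. -/
def s' : F :=
  S.b' * ((S.u ^ p) ^ 2 - S.w ^ p) + S.c' * S.u ^ p + S.d' * (S.u ^ 2 - S.w) + S.e' * S.u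

/-- The first invariant in `u, w`. -/
def F₁ : F := S.a * S.u ^ p ^ 2 + S.s

/-- The invariant with rows `1, 2, 3, 4, 6` in `u, w`. -/
def G : F := S.a * (S.w ^ p ^ 2 - (S.u ^ p ^ 2) ^ 2) + S.s'

/-- The second invariant in `u, w`. -/
def F₂ : F := 2⁻¹ * (S.F₁ ^ 2 + S.a * S.G)

/-- The first four terms of the third invariant in `u, w`. -/
def T : F := S.b ^ p * S.F₁ ^ (p + 2) - S.a ^ 2 * S.F₂ ^ p - 2 * S.b ^ p * S.F₁ ^ p * S.F₂ +
  S.a * S.c ^ p * S.F₁ ^ (p + 1)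

/-- Eliminating `F₂` through its definition leaves F₁^p times a(c^p F₁ - b^p G), and the relations
`rel₁` to `rel₄` rewrite the bracket as a s^p plus a^p times an expression in the minors g₁, …, g₄.
The Frobenius makes `F₂ ^ p` explicit, and its top terms cancel against those of F₁^p s^p. -/
theorem T_eq [hp : Fact p.Prime] [CharP F p] (h2 : 2 < p) :
    S.T = S.a ^ (p + 1) * S.F₁ ^ p * (S.g₁ * (S.w ^ p - (S.u ^ p) ^ 2) - S.g₂ * S.u ^ p
      + S.g₃ * (S.w - S.u ^ 2) - S.g₄ * S.u)
      + S.a ^ 2 * 2⁻¹ * ((S.s ^ p) ^ 2 - S.a ^ (2 * p) * (S.w ^ p ^ 2) ^ p - S.a ^ p * S.s' ^ p) := by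
  have two : (2 : F) ≠ 0 := by
    have := (CharP.cast_eq_zero_iff F p 2).not.2 (Nat.not_dvd_of_pos_of_lt (by norm_num) h2)
    exact_mod_cast this
  -- Two lies in the prime field and is fixed by the Frobenius.
  have two' : (2 : F)⁻¹ ^ p = 2⁻¹ := by
    have h := map_natCast (frobenius F p) 2
    rw [frobenius_def] at h
    rw [inv_pow, show (2 : F) ^ p = 2 by exact_mod_cast h]
  have hs : S.s ^ p = S.b ^ p * ((S.u ^ p ^ 2) ^ 2 - S.w ^ p ^ 2) + S.c ^ p * S.u ^ p ^ 2
      + S.d ^ p * ((S.u ^ p) ^ 2 - S.w ^ p) + S.e ^ p * S.u ^ p := by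
    rw [s, add_pow_char, add_pow_char, add_pow_char, mul_pow, mul_pow, mul_pow, mul_pow,
      sub_pow_char, sub_pow_char, sq p, pow_mul, pow_mul, pow_right_comm _ 2 p,
      pow_right_comm _ 2 p]
  have hF1 : S.F₁ ^ p = S.a ^ p * (S.u ^ p ^ 2) ^ p + S.s ^ p := by
    rw [F₁, add_pow_char, mul_pow]
  have hG : S.G ^ p = S.a ^ p * ((S.w ^ p ^ 2) ^ p - ((S.u ^ p ^ 2) ^ p) ^ 2) + S.s' ^ p := by
    rw [G, add_pow_char, mul_pow, sub_pow_char, pow_right_comm _ 2 p]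
  have hF2 : S.F₂ ^ p = 2⁻¹ * ((S.F₁ ^ p) ^ 2 + S.a ^ p * S.G ^ p) := by
    rw [F₂, mul_pow, two', add_pow_char, mul_pow, pow_right_comm _ 2 p]
  rw [T, hF2, hG, pow_add, pow_add, pow_one, pow_succ S.a p, mul_comm 2 p, pow_mul S.a p 2]
  have hF2' : S.F₂ = 2⁻¹ * (S.F₁ ^ 2 + S.a * S.G) := rfl
  have hGd : S.G = S.a * (S.w ^ p ^ 2 - (S.u ^ p ^ 2) ^ 2) + S.s' := rfl
  have hFd : S.F₁ = S.a * S.u ^ p ^ 2 + S.s := rfl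
  have e1 : S.b ^ p * S.F₁ ^ 2 - 2 * S.b ^ p * S.F₂ + S.a * S.c ^ p * S.F₁ =
      S.a * (S.a * S.s ^ p + S.a ^ p * (S.g₁ * (S.w ^ p - (S.u ^ p) ^ 2) - S.g₂ * S.u ^ p
      + S.g₃ * (S.w - S.u ^ 2) - S.g₄ * S.u)) := by
    have : 2 * S.F₂ = S.F₁ ^ 2 + S.a * S.G := by rw [hF2', mul_inv_cancel_left₀ two]
    have h3 : S.b ^ p * S.F₁ ^ 2 - 2 * S.b ^ p * S.F₂ + S.a * S.c ^ p * S.F₁ =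
        S.a * (- S.b ^ p * S.G + S.c ^ p * S.F₁) := by linear_combination (- S.b ^ p) * this
    rw [h3, hGd, hFd, hs, s, s']
    linear_combination S.a * (-(S.w ^ p - (S.u ^ p) ^ 2) * S.rel₁ + S.u ^ p * S.rel₂
      - (S.w - S.u ^ 2) * S.rel₃ + S.u * S.rel₄)
  have h22 : (2 : F)⁻¹ * 2 = 1 := inv_mul_cancel₀ two
  linear_combination (S.F₁ ^ p) * e1 + (- S.a ^ 2 * 2⁻¹ * (S.F₁ ^ p - S.s ^ p
    + S.a ^ p * (S.u ^ p ^ 2) ^ p)) * hF1 + (- S.a ^ 2 * S.F₁ ^ p * S.s ^ p) * h22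

end MinorData

end Fil

/-! ### Leading parts of the first two invariants and of the first approximation to the third -/

namespace MinorData

variable {F : Type*} [Field F] {D : ℤ → AddSubgroup F} {p : ℕ} (S : MinorData p D)

theorem two_le (h2 : 2 < p) : (3 : ℤ) * p ≤ p ^ 2 ∧ (3 : ℤ) * p ^ 2 ≤ p ^ 3 ∧ (3 : ℤ) ≤ p := by
  have : (3 : ℤ) ≤ p := by exact_mod_cast h2
  exact ⟨by nlinarith, by nlinarith [sq_nonneg (p : ℤ)], this⟩

theorem mem_coeff : S.a ∈ D 0 ∧ S.b ∈ D 0 ∧ S.c ∈ D 0 ∧ S.d ∈ D 0 ∧ S.e ∈ D 0 ∧ S.b' ∈ D 0 ∧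
    S.c' ∈ D 0 ∧ S.d' ∈ D 0 ∧ S.e' ∈ D 0 ∧ S.g₁ ∈ D 0 ∧ S.g₂ ∈ D 0 ∧ S.g₃ ∈ D 0 ∧ S.g₄ ∈ D 0 ∧
    S.g₅ ∈ D 0 ∧ S.g₆ ∈ D 0 ∧ S.a⁻¹ ∈ D 0 ∧ S.b⁻¹ ∈ D 0 ∧ (2⁻¹ : F) ∈ D 0 := by
  refine ⟨?_, ?_, ?_, ?_, ?_, ?_, ?_, ?_, ?_, ?_, ?_, ?_, ?_, ?_, ?_, ?_, ?_, ?_⟩ <;>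
    exact S.mem _ (by simp)

theorem s_sub_mem (h2 : 2 < p) : S.s - S.b * (S.u ^ p) ^ 2 ∈ D p := by
  obtain ⟨ha, hb, hc, hd, he, -⟩ := S.mem_coeff
  obtain ⟨h3, h4, h5⟩ := two_le h2
  have e : S.s - S.b * (S.u ^ p) ^ 2 =
      S.c * S.u ^ p + S.d * (S.u ^ 2 - S.w) + S.e * S.u - S.b * S.w ^ p := by
    rw [s]; ring
  rw [e]
  apply S.fil.mem_of_le
  · apply_rules [S.fil.add, S.fil.sub, S.fil.mul, S.fil.pow, S.hu, S.hw]
  · simp; omega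

theorem s_mem (h2 : 2 < p) : S.s ∈ D (2 * p) := by
  obtain ⟨ha, hb, hc, hd, he, -⟩ := S.mem_coeff
  obtain ⟨h3, h4, h5⟩ := two_le h2
  rw [s]
  apply S.fil.mem_of_le
  · apply_rules [S.fil.add, S.fil.sub, S.fil.mul, S.fil.pow, S.hu, S.hw]
  · simp; omega

theorem s'_mem (h2 : 2 < p) : S.s' ∈ D (2 * p) := by
  obtain ⟨-, -, -, -, -, hb, hc, hd, he, -⟩ := S.mem_coeff
  obtain ⟨h3, h4, h5⟩ := two_le h2
  rw [s']
  apply S.fil.mem_of_le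
  · apply_rules [S.fil.add, S.fil.sub, S.fil.mul, S.fil.pow, S.hu, S.hw]
  · simp; omega

theorem U_mem (k : ℕ) : S.u ^ k ∈ D k := by simpa using S.fil.pow S.hu k

theorem F₁_sub_mem (h2 : 2 < p) : S.F₁ - S.a * S.u ^ p ^ 2 ∈ D (2 * p) := by
  rw [F₁, add_sub_cancel_left]; exact S.s_mem h2

theorem lead_F₁_mem : S.a * S.u ^ p ^ 2 ∈ D (p ^ 2) := by
  refine S.fil.mem_of_le (S.fil.mul S.mem_coeff.1 (S.U_mem (p ^ 2))) (le_of_eq ?_)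
  push_cast
  ring

/-- The squares of the top term a u^(p²) cancel between `F₁ ^ 2` and `a * G`, so the cross term a
u^(p²) s takes the lead. -/
theorem F₂_eq (h2 : (2 : F) ≠ 0) : S.F₂ = S.a * S.u ^ p ^ 2 * S.s +
    (2⁻¹ * S.a ^ 2 * S.w ^ p ^ 2 + 2⁻¹ * S.s ^ 2 + 2⁻¹ * S.a * S.s') := by
  rw [F₂, F₁, G]
  field_simp
  ring

theorem F₂_sub_mem (h2 : 2 < p) (h20 : (2 : F) ≠ 0) :
    S.F₂ - S.a * S.b * S.u ^ (p ^ 2 + 2 * p) ∈ D (p ^ 2 + p) := by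
  obtain ⟨ha, hb, hc, hd, he, -⟩ := S.mem_coeff
  have h2i := S.mem_coeff.2.2.2.2.2.2.2.2.2.2.2.2.2.2.2.2.2
  obtain ⟨h3, h4, h5⟩ := two_le h2
  have hs := S.s_mem h2
  have hs' := S.s'_mem h2
  have hss := S.s_sub_mem h2
  have e : S.F₂ - S.a * S.b * S.u ^ (p ^ 2 + 2 * p) =
      S.a * S.u ^ p ^ 2 * (S.s - S.b * (S.u ^ p) ^ 2) +
    (2⁻¹ * S.a ^ 2 * S.w ^ p ^ 2 + 2⁻¹ * S.s ^ 2 + 2⁻¹ * S.a * S.s') := by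
    rw [F₂_eq S h20]; ring
  rw [e]
  apply S.fil.mem_of_le
  · apply_rules [S.fil.add, S.fil.sub, S.fil.mul, S.fil.pow, S.hu, S.hw]
  · simp; omega

theorem lead_F₂_mem : S.a * S.b * S.u ^ (p ^ 2 + 2 * p) ∈ D (p ^ 2 + 2 * p) := by
  refine S.fil.mem_of_le (S.fil.mul (S.fil.mul S.mem_coeff.1 S.mem_coeff.2.1)
    (S.U_mem (p ^ 2 + 2 * p))) (le_of_eq ?_)
  push_cast
  ring

theorem F₁_pow_mul_F₂_pow (h2 : 2 < p) (h20 : (2 : F) ≠ 0) (k l : ℕ) :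
    S.F₁ ^ k * S.F₂ ^ l - (S.a * S.u ^ p ^ 2) ^ k * (S.a * S.b * S.u ^ (p ^ 2 + 2 * p)) ^ l ∈
      D (k * p ^ 2 + l * (p ^ 2 + 2 * p) - p) := by
  obtain ⟨h3, h4, h5⟩ := two_le h2
  refine S.fil.mul_sub_mul ?_ ?_ (by omega) (S.fil.pow_sub_pow S.lead_F₁_mem (by omega) ?_ k)
    (S.fil.pow_sub_pow S.lead_F₂_mem (by omega) ?_ l)
  · simpa using S.fil.pow S.lead_F₁_mem k
  · simpa using S.fil.pow S.lead_F₂_mem l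
  · exact S.fil.mem_of_le (S.F₁_sub_mem h2) (by omega)
  · exact S.fil.mem_of_le (S.F₂_sub_mem h2 h20) (by omega)

/-- The target degree is p³ + 2, so everything in filtration degree p³ + 1 is discarded. The term in
(u^(p²))⁴ is kept: its degree 4p² falls below the target only for p ≥ 5. -/
theorem T_sub_mem [hp : Fact p.Prime] [CharP F p] (h2 : 2 < p) :
    S.T - (S.a ^ (2 * p + 1) * S.u ^ p ^ 3 * (S.g₁ * (S.w ^ p - (S.u ^ p) ^ 2) - S.g₂ * S.u ^ p
      + S.g₃ * (S.w - S.u ^ 2))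
      + S.a ^ 2 * 2⁻¹ * (S.b ^ p * (S.u ^ p ^ 2) ^ 2) ^ 2) ∈ D (p ^ 3 + 1) := by
  obtain ⟨ha, hb, hc, hd, he, -, -, -, -, hg1, hg2, hg3, hg4, -, -, -, -, h2i⟩ := S.mem_coeff
  obtain ⟨h3, h4, h5⟩ := two_le h2
  have hs := S.s_mem h2
  have hs' := S.s'_mem h2
  have hss := S.s_sub_mem h2
  have hF1 : S.F₁ ^ p = S.a ^ p * S.u ^ p ^ 3 + S.s ^ p := by
    rw [F₁, add_pow_char, mul_pow, ← pow_mul, ← pow_succ]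
  have hs2 : S.s ^ p = S.b ^ p * (S.u ^ p ^ 2) ^ 2 + (S.s - S.b * (S.u ^ p) ^ 2) ^ p := by
    rw [sub_pow_char, mul_pow, pow_right_comm _ 2 p, ← pow_mul S.u p p, ← sq]
    ring
  have e : S.T - (S.a ^ (2 * p + 1) * S.u ^ p ^ 3 *
      (S.g₁ * (S.w ^ p - (S.u ^ p) ^ 2) - S.g₂ * S.u ^ p + S.g₃ * (S.w - S.u ^ 2))
      + S.a ^ 2 * 2⁻¹ * (S.b ^ p * (S.u ^ p ^ 2) ^ 2) ^ 2) =
      S.a ^ (p + 1) * S.s ^ p * (S.g₁ * (S.w ^ p - (S.u ^ p) ^ 2) - S.g₂ * S.u ^ p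
      + S.g₃ * (S.w - S.u ^ 2) - S.g₄ * S.u) - S.a ^ (2 * p + 1) * S.u ^ p ^ 3 * (S.g₄ * S.u)
      + S.a ^ 2 * 2⁻¹ * ((S.s - S.b * (S.u ^ p) ^ 2) ^ p * (2 * (S.b ^ p * (S.u ^ p ^ 2) ^ 2) +
        (S.s - S.b * (S.u ^ p) ^ 2) ^ p)
        - S.a ^ (2 * p) * (S.w ^ p ^ 2) ^ p - S.a ^ p * S.s' ^ p) := by
    rw [T_eq S h2, hF1]
    generalize (S.s - S.b * (S.u ^ p) ^ 2) ^ p = t at hs2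
    rw [hs2]
    ring
  have htwo : (2 : F) ∈ D 0 := by
    have := add_mem S.fil.one S.fil.one
    rwa [one_add_one_eq_two] at this
  generalize S.s - S.b * (S.u ^ p) ^ 2 = t at hss e
  rw [e]
  have m1 : S.g₁ * (S.w ^ p - (S.u ^ p) ^ 2) - S.g₂ * S.u ^ p
      + S.g₃ * (S.w - S.u ^ 2) - S.g₄ * S.u ∈ D (2 * p) := by
    apply S.fil.mem_of_le
    · apply_rules [S.fil.add, S.fil.sub, S.fil.mul, S.fil.pow, S.hu, S.hw]
    · simp; omega
  have m2 : t ^ p * (2 * (S.b ^ p * (S.u ^ p ^ 2) ^ 2) + t ^ p) ∈ D (3 * p ^ 2) := by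
    apply S.fil.mem_of_le
    · apply_rules [S.fil.add, S.fil.mul, S.fil.pow, S.hu]
    · simp only [max_def]; split_ifs <;> push_cast <;> nlinarith
  have m3 : S.a ^ (2 * p) * (S.w ^ p ^ 2) ^ p ∈ D (p ^ 3) := by
    apply S.fil.mem_of_le
    · apply_rules [S.fil.mul, S.fil.pow, S.hw]
    · push_cast; apply le_of_eq; ring
  have m4 : S.a ^ p * S.s' ^ p ∈ D (2 * p ^ 2) := by
    apply S.fil.mem_of_le
    · apply_rules [S.fil.mul, S.fil.pow]
    · apply le_of_eq; ring
  apply S.fil.mem_of_le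
  · apply_rules [S.fil.add, S.fil.sub, S.fil.mul, S.fil.pow, S.hu]
  · push_cast
    simp only [mul_zero, zero_add, max_le_iff]
    refine ⟨⟨?_, ?_⟩, ⟨?_, ?_⟩, ?_⟩ <;> nlinarith

end MinorData

/-! ### The correction terms, for p ≥ 5 and for p = 3 -/

namespace MinorData

variable {F : Type*} [Field F] {D : ℤ → AddSubgroup F}

/-- The errors have degree about (p-1)p² + 4p. This is at most p³ because p ≥ 5; for p = 3 they are
still visible, which is one reason for a separate treatment. -/
theorem F₁_pow_mul_F₂ {p : ℕ} (S : MinorData p D) (h5 : 5 ≤ p) (h20 : (2 : F) ≠ 0) :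
    S.F₁ ^ (p - 1) * S.F₂ - S.a ^ p * S.u ^ p ^ 3 * S.s ∈ D (p ^ 3) := by
  obtain ⟨ha, hb, hc, hd, he, -, -, -, -, hg1, hg2, hg3, hg4, -, -, -, -, h2i⟩ := S.mem_coeff
  have h2 : 2 < p := by omega
  obtain ⟨q, rfl⟩ : ∃ q, p = q + 1 := ⟨p - 1, by omega⟩
  rw [Nat.add_sub_cancel]
  obtain ⟨h3, h4, -⟩ := two_le h2
  have h5' : (5 : ℤ) ≤ (q + 1 : ℕ) := by exact_mod_cast h5
  have hs := S.s_mem h2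
  have hs' := S.s'_mem h2
  set P : ℤ := ((q + 1 : ℕ) : ℤ)
  have hq : (q : ℤ) = P - 1 := by simp [P]
  have e : S.F₁ ^ q * S.F₂ - S.a ^ (q + 1) * S.u ^ (q + 1) ^ 3 * S.s =
      (S.F₁ ^ q - (S.a * S.u ^ (q + 1) ^ 2) ^ q) * S.F₂ + (S.a * S.u ^ (q + 1) ^ 2) ^ q *
      (2⁻¹ * S.a ^ 2 * S.w ^ (q + 1) ^ 2 + 2⁻¹ * S.s ^ 2 + 2⁻¹ * S.a * S.s') := by
    have e2 : S.a ^ (q + 1) * S.u ^ (q + 1) ^ 3 = (S.a * S.u ^ (q + 1) ^ 2) ^ (q + 1) := by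
      rw [mul_pow, ← pow_mul, ← pow_succ]
    have e3 := F₂_eq S h20
    rw [e2, pow_succ (S.a * S.u ^ (q + 1) ^ 2)]
    generalize S.a * S.u ^ (q + 1) ^ 2 = A at *
    rw [e3]
    ring
  have m1 : S.F₁ ^ q - (S.a * S.u ^ (q + 1) ^ 2) ^ q ∈ D (q * P ^ 2 - (P ^ 2 - 2 * P)) :=
    S.fil.pow_sub_pow (m := P ^ 2) (j := P ^ 2 - 2 * P) S.lead_F₁_mem (by omega)
      (S.fil.mem_of_le (S.F₁_sub_mem h2) (by omega)) q
  have m2 : S.F₂ ∈ D (P ^ 2 + 2 * P) := by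
    have := add_mem (S.fil.mem_of_le (S.F₂_sub_mem h2 h20) (by omega)) S.lead_F₂_mem
    rwa [sub_add_cancel] at this
  have m3 : 2⁻¹ * S.a ^ 2 * S.w ^ (q + 1) ^ 2 + 2⁻¹ * S.s ^ 2 + 2⁻¹ * S.a * S.s' ∈ D (P ^ 2) := by
    apply S.fil.mem_of_le
    · apply_rules [S.fil.add, S.fil.sub, S.fil.mul, S.fil.pow, S.hw]
    · have : ((((q + 1) ^ 2 : ℕ)) : ℤ) = P ^ 2 := by simp [P]
      rw [this]
      push_cast
      simp only [zero_add, max_le_iff]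
      refine ⟨⟨?_, ?_⟩, ?_⟩ <;> nlinarith
  rw [e]
  refine add_mem (S.fil.mem_of_le (S.fil.mul m1 m2) ?_)
    (S.fil.mem_of_le (S.fil.mul (S.fil.pow S.lead_F₁_mem q) m3) ?_)
  · rw [hq]; nlinarith
  · rw [hq]; apply le_of_eq; ring

/-- The product F₁^(p-1) F₂ removes the part of `T` in degree p³ + 2p. By `rel₅` what is left in
degree p³ + p is a multiple of a g₅, which the product of F₁^((p-3)/2) and F₂^((p+1)/2) removes. By
`rel₆` the remaining top term has degree p³ + 2 and coefficient a multiple of g₆ = γ₁₃₅₇. -/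
theorem lead_five {p : ℕ} (S : MinorData p D) [Fact p.Prime] [CharP F p] (h5 : 5 ≤ p) :
    S.T + S.a ^ (p + 1) * S.g₁ / S.b * (S.F₁ ^ (p - 1) * S.F₂) +
      S.a ^ (p + 3) * S.g₅ / S.b ^ ((p + 3) / 2) *
        (S.F₁ ^ ((p - 3) / 2) * S.F₂ ^ ((p + 1) / 2)) +
      S.a ^ (2 * p + 2) / S.b * S.g₆ * S.u ^ (p ^ 3 + 2) ∈ D (p ^ 3 + 1) := by
  obtain ⟨ha, hb, hc, hd, he, -, -, -, -, hg1, hg2, hg3, hg4, hg5, hg6, -, hbi, h2i⟩ := S.mem_coeff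
  have h2 : 2 < p := by omega
  have h20 : (2 : F) ≠ 0 := by
    have := (CharP.cast_eq_zero_iff F p 2).not.2 (Nat.not_dvd_of_pos_of_lt (by norm_num) h2)
    exact_mod_cast this
  obtain ⟨h3, h4, -⟩ := two_le h2
  have h5' : (5 : ℤ) ≤ p := by exact_mod_cast h5
  have mT := S.T_sub_mem h2
  have mB := S.F₁_pow_mul_F₂ h5 h20
  have hodd : Odd p := (Fact.out : p.Prime).odd_of_ne_two (by omega)
  -- Writing p = 2k + 3 turns the halved exponents into k and k + 2.
  obtain ⟨k, hk⟩ : ∃ k, p = 2 * k + 3 := by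
    obtain ⟨r, hr⟩ := hodd
    exact ⟨r - 1, by omega⟩
  have k1 : (p - 3) / 2 = k := by omega
  have k2 : (p + 1) / 2 = k + 2 := by omega
  have k3 : (p + 3) / 2 = k + 3 := by omega
  have mC := S.F₁_pow_mul_F₂_pow h2 h20 k (k + 2)
  have mC' := S.fil.mem_of_le mC (n := p ^ 3 + 1) (by
    have : (k : ℤ) = (p - 3) / 2 := by omega
    have e : (p : ℤ) = 2 * k + 3 := by exact_mod_cast hk
    push_cast
    rw [e]
    apply le_of_lt
    ring_nf
    omega)
  rw [k1, k2, k3]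
  have eC : (S.a * S.u ^ p ^ 2) ^ k * (S.a * S.b * S.u ^ (p ^ 2 + 2 * p)) ^ (k + 2) =
      S.a ^ (2 * k + 2) * S.b ^ (k + 2) * (S.u ^ p ^ 3 * S.u ^ p) := by
    have : p ^ 2 * k + (p ^ 2 + 2 * p) * (k + 2) = p ^ 3 + p := by rw [hk]; ring
    rw [← pow_add, ← this]
    ring
  rw [eC] at mC'
  -- An exact regrouping: every summand but the last is an approximation error or the term of degree
  -- 4p², and the last retains only u and w times u^(p³), of degree p³ + 1.
  have e : S.T + S.a ^ (p + 1) * S.g₁ / S.b * (S.F₁ ^ (p - 1) * S.F₂) +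
      S.a ^ (p + 3) * S.g₅ / S.b ^ (k + 3) * (S.F₁ ^ k * S.F₂ ^ (k + 2)) +
      S.a ^ (2 * p + 2) / S.b * S.g₆ * S.u ^ (p ^ 3 + 2) =
    (S.T - (S.a ^ (2 * p + 1) * S.u ^ p ^ 3 * (S.g₁ * (S.w ^ p - (S.u ^ p) ^ 2) - S.g₂ * S.u ^ p
      + S.g₃ * (S.w - S.u ^ 2))
      + S.a ^ 2 * 2⁻¹ * (S.b ^ p * (S.u ^ p ^ 2) ^ 2) ^ 2)) +
    S.a ^ 2 * 2⁻¹ * (S.b ^ p * (S.u ^ p ^ 2) ^ 2) ^ 2 +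
    S.a ^ (p + 1) * S.g₁ * S.b⁻¹ * (S.F₁ ^ (p - 1) * S.F₂ - S.a ^ p * S.u ^ p ^ 3 * S.s) +
    S.a ^ (p + 3) * S.g₅ * S.b⁻¹ ^ (k + 3) * (S.F₁ ^ k * S.F₂ ^ (k + 2) -
      S.a ^ (2 * k + 2) * S.b ^ (k + 2) * (S.u ^ p ^ 3 * S.u ^ p)) +
    S.a ^ (2 * p + 1) * S.b⁻¹ * S.u ^ p ^ 3 * (S.g₁ * S.e * S.u + S.a * S.g₆ * S.w) := by
    have hg2 : S.g₂ = (S.g₁ * S.c + S.a * S.g₅) * S.b⁻¹ := by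
      rw [eq_mul_inv_iff_mul_eq₀ S.hb]; linear_combination -S.rel₅
    have hg3 : S.g₃ = (S.g₁ * S.d + S.a * S.g₆) * S.b⁻¹ := by
      rw [eq_mul_inv_iff_mul_eq₀ S.hb]; linear_combination -S.rel₆
    have e1 : S.b⁻¹ ^ (k + 3) * S.b ^ (k + 2) = S.b⁻¹ := by
      rw [pow_succ, mul_right_comm, ← mul_pow, inv_mul_cancel₀ S.hb, one_pow, one_mul]
    have e2 : S.a ^ (p + 3) * S.a ^ (2 * k + 2) = S.a ^ (2 * p + 2) := by
      rw [← pow_add]; congr 1; omega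
    have e3 : S.b⁻¹ * S.b = 1 := inv_mul_cancel₀ S.hb
    rw [hg2, hg3, div_eq_mul_inv, div_eq_mul_inv, div_eq_mul_inv, ← inv_pow, s, pow_add S.u (p ^ 3)]
    linear_combination (S.g₅ * (S.u ^ p ^ 3 * S.u ^ p) * S.b⁻¹) * e2 +
      (S.g₅ * (S.u ^ p ^ 3 * S.u ^ p) * S.a ^ (p + 3) * S.a ^ (2 * k + 2)) * e1 -
      (S.a ^ (2 * p + 1) * S.g₁ * S.u ^ p ^ 3 * (S.w ^ p - (S.u ^ p) ^ 2)) * e3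
  rw [e]
  refine add_mem (add_mem (add_mem (add_mem mT ?_) ?_) ?_) ?_
  · apply S.fil.mem_of_le
    · apply_rules [S.fil.add, S.fil.sub, S.fil.mul, S.fil.pow, S.hu]
    · push_cast
      nlinarith
  · refine S.fil.mem_of_le (S.fil.mul (m := 0) ?_ mB) (by omega)
    apply S.fil.mem_of_le
    · apply_rules [S.fil.mul, S.fil.pow]
    · simp
  · refine S.fil.mem_of_le (S.fil.mul (m := 0) ?_ mC') (by omega)
    apply S.fil.mem_of_le
    · apply_rules [S.fil.mul, S.fil.pow]
    · simp
  · apply S.fil.mem_of_le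
    · apply_rules [S.fil.add, S.fil.sub, S.fil.mul, S.fil.pow, S.hu, S.hw]
    · simp

/-- For p = 3 the term of degree 4p² = 36 exceeds 29. Subtracting a multiple of F₁⁴ removes it but
creates a term A³s of degree 33, which an additional multiple of F₁²F₂ cancels. That product
contributes degree 30, which F₂² absorbs. -/
theorem lead_three (S : MinorData 3 D) [CharP F 3] :
    S.T - S.b ^ 6 / S.a ^ 2 * 2⁻¹ * S.F₁ ^ 4 +
      (S.a ^ 4 * S.g₁ / S.b + S.b ^ 6 / S.a ^ 2 * 2⁻¹) * (S.F₁ ^ 2 * S.F₂) +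
      (S.a ^ 6 * S.g₅ / S.b ^ 3 - (S.a ^ 4 * S.g₁ / S.b + S.b ^ 6 / S.a ^ 2 * 2⁻¹)) * S.F₂ ^ 2 +
      S.a ^ 8 / S.b * S.g₆ * S.u ^ 29 ∈ D 28 := by
  have : Fact (Nat.Prime 3) := ⟨Nat.prime_three⟩
  obtain ⟨ha, hb, hc, hd, he, -, -, -, -, hg1, hg2, hg3, hg4, hg5, hg6, hai, hbi, h2i⟩ :=
    S.mem_coeff
  have h3 : (3 : F) = 0 := by exact_mod_cast CharP.cast_eq_zero F 3
  have h20 : (2 : F) ≠ 0 := by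
    intro h
    exact one_ne_zero (by linear_combination h3 - h : (1 : F) = 0)
  have h2inv : (2 : F)⁻¹ = 2 := by
    refine inv_eq_of_mul_eq_one_right ?_
    linear_combination h3
  have mT := S.T_sub_mem (by norm_num)
  have hs := S.s_mem (by norm_num)
  have hs' := S.s'_mem (by norm_num)
  have hss := S.s_sub_mem (by norm_num)
  have mC := S.F₁_pow_mul_F₂_pow (by norm_num) h20 0 2
  norm_num at mT hs hs' hss mC
  set A := S.a * S.u ^ 9 with hA
  set r := 2⁻¹ * S.a ^ 2 * S.w ^ 9 + 2⁻¹ * S.a * S.s' with hr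
  have mA : A ∈ D 9 := by simpa using S.fil.mul ha (S.U_mem 9)
  have mr : r ∈ D 9 := by
    apply S.fil.mem_of_le
    · apply_rules [S.fil.add, S.fil.sub, S.fil.mul, S.fil.pow, S.hu, S.hw]
    · norm_num
  have hF1 : S.F₁ = A + S.s := by rw [F₁]; norm_num; rfl
  have hF2 : S.F₂ = A * S.s + 2⁻¹ * S.s ^ 2 + r := by
    rw [F₂_eq S h20, hr]; norm_num; ring
  have m2 : (2 : F) ∈ D 0 := by
    have := add_mem S.fil.one S.fil.one
    rwa [one_add_one_eq_two] at this
  -- In characteristic 3 the middle binomial coefficient 6 vanishes and 4 = 1, so only A⁴ and A³s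
  -- survive above degree 28.
  have mF1 : S.F₁ ^ 4 - (A ^ 4 + A ^ 3 * S.s) ∈ D 28 := by
    have e : S.F₁ ^ 4 - (A ^ 4 + A ^ 3 * S.s) = A * S.s ^ 3 + S.s ^ 4 := by
      rw [hF1]
      linear_combination (A ^ 3 * S.s + 2 * A ^ 2 * S.s ^ 2 + A * S.s ^ 3) * h3
    rw [e]
    apply S.fil.mem_of_le
    · apply_rules [S.fil.add, S.fil.sub, S.fil.mul, S.fil.pow, S.hu, S.hw]
    · norm_num
  have mF2 : S.F₁ ^ 2 * S.F₂ - (A ^ 3 * S.s + A ^ 2 * (S.b * S.u ^ 6) ^ 2) ∈ D 28 := by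
    have e : S.F₁ ^ 2 * S.F₂ - (A ^ 3 * S.s + A ^ 2 * (S.b * S.u ^ 6) ^ 2) =
        A ^ 2 * ((S.s - S.b * (S.u ^ 3) ^ 2) * (S.s + S.b * (S.u ^ 3) ^ 2)) + A ^ 2 * r +
        2 * A * S.s ^ 3 + 2 * A * S.s * r + 2⁻¹ * S.s ^ 4 + S.s ^ 2 * r := by
      rw [hF1, hF2, h2inv]
      linear_combination (A ^ 2 * S.s ^ 2 + A * S.s ^ 3) * h3
    rw [e]
    apply S.fil.mem_of_le
    · apply_rules [S.fil.add, S.fil.sub, S.fil.mul, S.fil.pow, S.hu, S.hw]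
    · norm_num
  have e : S.T - S.b ^ 6 / S.a ^ 2 * 2⁻¹ * S.F₁ ^ 4 +
      (S.a ^ 4 * S.g₁ / S.b + S.b ^ 6 / S.a ^ 2 * 2⁻¹) * (S.F₁ ^ 2 * S.F₂) +
      (S.a ^ 6 * S.g₅ / S.b ^ 3 - (S.a ^ 4 * S.g₁ / S.b + S.b ^ 6 / S.a ^ 2 * 2⁻¹)) * S.F₂ ^ 2 +
      S.a ^ 8 / S.b * S.g₆ * S.u ^ 29 =
    (S.T - (S.a ^ 7 * S.u ^ 27 * (S.g₁ * (S.w ^ 3 - (S.u ^ 3) ^ 2) - S.g₂ * S.u ^ 3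
      + S.g₃ * (S.w - S.u ^ 2)) + S.a ^ 2 * 2⁻¹ * (S.b ^ 3 * (S.u ^ 9) ^ 2) ^ 2))
    - S.b ^ 6 * S.a⁻¹ ^ 2 * 2⁻¹ * (S.F₁ ^ 4 - (A ^ 4 + A ^ 3 * S.s)) +
    (S.a ^ 4 * S.g₁ * S.b⁻¹ + S.b ^ 6 * S.a⁻¹ ^ 2 * 2⁻¹) *
      (S.F₁ ^ 2 * S.F₂ - (A ^ 3 * S.s + A ^ 2 * (S.b * S.u ^ 6) ^ 2)) +
    (S.a ^ 6 * S.g₅ * S.b⁻¹ ^ 3 - (S.a ^ 4 * S.g₁ * S.b⁻¹ + S.b ^ 6 * S.a⁻¹ ^ 2 * 2⁻¹)) *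
      (S.F₂ ^ 2 - (S.a * S.b * S.u ^ 15) ^ 2) +
    S.a ^ 7 * S.b⁻¹ * S.u ^ 27 * (S.g₁ * S.e * S.u + S.a * S.g₆ * S.w) := by
    have hg2 : S.g₂ = (S.g₁ * S.c + S.a * S.g₅) * S.b⁻¹ := by
      rw [eq_mul_inv_iff_mul_eq₀ S.hb]; linear_combination -S.rel₅
    have hg3 : S.g₃ = (S.g₁ * S.d + S.a * S.g₆) * S.b⁻¹ := by
      rw [eq_mul_inv_iff_mul_eq₀ S.hb]; linear_combination -S.rel₆
    have ha0 := S.ha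
    have hb0 := S.hb
    rw [hg2, hg3, hA, s]
    generalize S.F₁ = F1
    generalize S.F₂ = F2
    generalize S.T = T
    field_simp
    ring
  rw [e]
  refine add_mem (add_mem (add_mem (sub_mem mT ?_) ?_) ?_) ?_
  · refine S.fil.mem_of_le (S.fil.mul (m := 0) ?_ mF1) (by norm_num)
    apply S.fil.mem_of_le
    · apply_rules [S.fil.mul, S.fil.pow]
    · simp
  · refine S.fil.mem_of_le (S.fil.mul (m := 0) ?_ mF2) (by norm_num)
    apply S.fil.mem_of_le
    · apply_rules [S.fil.add, S.fil.mul, S.fil.pow]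
    · simp
  · refine S.fil.mem_of_le (S.fil.mul (m := 0) ?_ mC) (by norm_num)
    apply S.fil.mem_of_le
    · apply_rules [S.fil.add, S.fil.sub, S.fil.mul, S.fil.pow]
    · simp
  · apply S.fil.mem_of_le
    · apply_rules [S.fil.add, S.fil.sub, S.fil.mul, S.fil.pow, S.hu, S.hw]
    · simp

end MinorData

/-! ### The invariants in the fraction field -/

section Frac

variable (K : Type*) [Field K]

/-- The field of fractions of `K[x, y, z]`. -/
abbrev Frac : Type _ := FractionRing (MvPolynomial (Fin 3) K)

variable {K}

/-- The inclusion of polynomials in the field of fractions. -/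
abbrev toFrac : MvPolynomial (Fin 3) K →+* Frac K := algebraMap _ _

theorem toFrac_injective : Function.Injective (toFrac (K := K)) := IsFractionRing.injective _ _

theorem toFrac_X_ne_zero : toFrac (X 2 : MvPolynomial (Fin 3) K) ≠ 0 := by
  rw [Ne, map_eq_zero_iff _ toFrac_injective]
  exact X_ne_zero 2

/-- All monomials of `r` have total degree `n`. -/
def HasDegree (r : MvPolynomial (Fin 3) K) (n : ℤ) : Prop :=
  ∀ d, coeff d r ≠ 0 → ((Finsupp.degree d : ℕ) : ℤ) = n

theorem hasDegree_natCast {r : MvPolynomial (Fin 3) K} {n : ℕ} :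
    HasDegree r n ↔ r.IsHomogeneous n := by
  refine forall_congr' fun d => imp_congr_right fun _ => ?_
  rw [Nat.cast_inj, DFunLike.congr_fun Finsupp.degree_eq_weight_one d]
  rfl

theorem HasDegree.mul {r s : MvPolynomial (Fin 3) K} {m n : ℤ} (hr : HasDegree r m)
    (hs : HasDegree s n) : HasDegree (r * s) (m + n) := by
  classical
  intro d hd
  obtain ⟨a, ha, b, hb, rfl⟩ := Finset.mem_add.1 (support_mul _ _ (mem_support_iff.2 hd))
  rw [map_add, Nat.cast_add, hr a (mem_support_iff.1 ha), hs b (mem_support_iff.1 hb)]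

/-- The elements `g` of the field of fractions for which `xⁿ g` is a form of degree `n`. -/
def xFil (n : ℤ) : AddSubgroup (Frac K) where
  carrier := {g | ∃ r, HasDegree r n ∧ toFrac r = toFrac (X 2) ^ n * g}
  zero_mem' := ⟨0, by simp [HasDegree], by simp⟩
  add_mem' := by
    rintro f g ⟨r, hr, er⟩ ⟨s, hs, es⟩
    refine ⟨r + s, fun d hd => ?_, by rw [map_add, er, es, mul_add]⟩
    by_cases h : coeff d r = 0
    · rw [coeff_add, h, zero_add] at hd; exact hs d hd
    · exact hr d h
  neg_mem' := by
    rintro f ⟨r, hr, er⟩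
    exact ⟨-r, fun d hd => hr d (by simpa using hd), by rw [map_neg, er, mul_neg]⟩

theorem isMulFiltration_xFil : IsMulFiltration (xFil (K := K)) where
  mono m n hmn := by
    rintro g ⟨r, hr, er⟩
    obtain ⟨k, rfl⟩ := Int.le.dest hmn
    refine ⟨X 2 ^ k * r, ?_, ?_⟩
    · rw [add_comm]
      exact (hasDegree_natCast.2 (by simpa using (isHomogeneous_X K (2 : Fin 3)).pow k)).mul hr
    · rw [map_mul, map_pow, er, zpow_add₀ toFrac_X_ne_zero, zpow_natCast]
      ring
  one := ⟨1, hasDegree_natCast.2 (isHomogeneous_one _ _), by simp⟩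
  mul := by
    rintro f g m n ⟨r, hr, er⟩ ⟨s, hs, es⟩
    refine ⟨r * s, hr.mul hs, ?_⟩
    rw [map_mul, er, es, zpow_add₀ toFrac_X_ne_zero]
    ring

theorem algebraMap_mem_xFil (c : K) : algebraMap K (Frac K) c ∈ xFil 0 :=
  ⟨C c, hasDegree_natCast.2 (isHomogeneous_C _ _), by simp [toFrac, algebraMap_C]⟩

/-- The quotient `y / x`. -/
def fracU : Frac K := toFrac (X 1) / toFrac (X 2)

/-- The quotient `z / x`. -/
def fracW : Frac K := toFrac (X 0) / toFrac (X 2)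

theorem X_mul_fracU : toFrac (X 2) * fracU = toFrac (X 1 : MvPolynomial (Fin 3) K) :=
  mul_div_cancel₀ _ toFrac_X_ne_zero

theorem X_mul_fracW : toFrac (X 2) * fracW = toFrac (X 0 : MvPolynomial (Fin 3) K) :=
  mul_div_cancel₀ _ toFrac_X_ne_zero

theorem fracU_mem : (fracU : Frac K) ∈ xFil 1 :=
  ⟨X 1, hasDegree_natCast.2 (isHomogeneous_X _ _), by rw [zpow_one, X_mul_fracU]⟩

theorem fracW_mem : (fracW : Frac K) ∈ xFil 1 :=
  ⟨X 0, hasDegree_natCast.2 (isHomogeneous_X _ _), by rw [zpow_one, X_mul_fracW]⟩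

/-- The bridge from the filtration to lead terms: an error one filtration step lower becomes a
multiple of x once x^n clears the denominators. -/
theorem exists_form_of_lead {g : Frac K} {n : ℕ} {c : K}
    (h : g - algebraMap K _ c * fracU ^ n ∈ xFil ((n : ℤ) - 1)) :
    ∃ r s : MvPolynomial (Fin 3) K, r.IsHomogeneous n ∧ toFrac r = toFrac (X 2) ^ n * g ∧
      r = C c * X 1 ^ n + X 2 * s := by
  obtain ⟨s, hs, es⟩ := h
  refine ⟨C c * X 1 ^ n + X 2 * s, s, ?_, ?_, rfl⟩
  · have h1 := (isHomogeneous_C (Fin 3) c).mul ((isHomogeneous_X K (1 : Fin 3)).pow n)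
    rw [zero_add, one_mul] at h1
    refine h1.add ?_
    rw [← hasDegree_natCast]
    have := (hasDegree_natCast.2 (isHomogeneous_X K (2 : Fin 3))).mul hs
    rwa [Nat.cast_one, add_sub_cancel] at this
  · have e : toFrac (X 2 : MvPolynomial (Fin 3) K) ^ n =
        toFrac (X 2) * toFrac (X 2) ^ ((n : ℤ) - 1) := by
      rw [← zpow_natCast, ← zpow_one_add₀ toFrac_X_ne_zero, add_sub_cancel]
    rw [map_add, map_mul, map_mul, es, map_pow, ← X_mul_fracU, mul_pow, toFrac, algebraMap_C,
      ← toFrac, ← mul_assoc (toFrac (X 2)), ← e]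
    ring

theorem not_X_dvd_of_lead {r s : MvPolynomial (Fin 3) K} {n : ℕ} {c : K} (hc : c ≠ 0)
    (h : r = C c * X 1 ^ n + X 2 * s) : ¬ X 2 ∣ r := by
  intro hd
  have h1 := coeff_eq_zero_of_X_dvd hd (d := Finsupp.single 1 n) (by simp)
  rw [h, coeff_add, coeff_eq_zero_of_X_dvd (dvd_mul_right (X 2) s) (by simp), add_zero,
    coeff_C_mul, coeff_X_pow, if_pos rfl, mul_one] at h1
  exact hc h1

/-- Any other clearing of denominators differs by a power of x, and a result not divisible by x
comes from the least exponent. -/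
theorem clearDenom_eq {g : Frac K} {f : MvPolynomial (Fin 3) K} {d : ℕ}
    (h : toFrac f = toFrac (X 2) ^ d * g) (hf : ¬ X 2 ∣ f) : clearDenom g = f := by
  classical
  have hg : ∃ d : ℕ, ∃ f : MvPolynomial (Fin 3) K,
      toFrac f = toFrac (X 2) ^ d * g := ⟨d, f, h⟩
  have hs := (Nat.find_spec hg).choose_spec
  have hle : Nat.find hg ≤ d := Nat.find_min' hg ⟨f, h⟩
  obtain ⟨k, hk⟩ := Nat.exists_eq_add_of_le hle
  have e : f = X 2 ^ k * (Nat.find_spec hg).choose := by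
    apply toFrac_injective
    rw [map_mul, hs, h, map_pow, ← mul_assoc, ← pow_add, hk, add_comm]
  rw [clearDenom, dif_pos hg]
  rcases Nat.eq_zero_or_pos k with hk0 | hk0
  · rw [hk0, pow_zero, one_mul] at e
    exact e.symm
  · exact absurd (e ▸ dvd_mul_of_dvd_left (dvd_pow_self _ hk0.ne') _) hf

end Frac

/-! ### Transfer of the estimates to the polynomials f₁, f_{12346} and f₂ -/

section Invariants

variable {K : Type*} [Field K] {p : ℕ} [Fact p.Prime] [CharP K p]
  {M : Matrix (Fin 2) (Fin 4) K}

instance : CharP (Frac K) p := charP_of_injective_algebraMap (algebraMap K (Frac K)).injective p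

/-- The minors of `Γ` in the field of fractions. -/
def minorData (p : ℕ) [Fact p.Prime] [CharP K p] (M : Matrix (Fin 2) (Fin 4) K)
    (ha : gam p M ![1, 2, 3, 4] ≠ 0) (hb : gam p M ![1, 2, 3, 5] ≠ 0) :
    MinorData p (xFil (K := K)) where
  a := algebraMap K _ (gam p M ![1, 2, 3, 4])
  b := algebraMap K _ (gam p M ![1, 2, 3, 5])
  c := algebraMap K _ (gam p M ![1, 2, 4, 5])
  d := algebraMap K _ (gam p M ![1, 3, 4, 5])
  e := algebraMap K _ (gam p M ![2, 3, 4, 5])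
  b' := algebraMap K _ (gam p M ![1, 2, 3, 6])
  c' := algebraMap K _ (gam p M ![1, 2, 4, 6])
  d' := algebraMap K _ (gam p M ![1, 3, 4, 6])
  e' := algebraMap K _ (gam p M ![2, 3, 4, 6])
  g₁ := algebraMap K _ (gam p M ![1, 2, 3, 7])
  g₂ := algebraMap K _ (gam p M ![1, 2, 4, 7])
  g₃ := algebraMap K _ (gam p M ![1, 3, 4, 7])
  g₄ := algebraMap K _ (gam p M ![2, 3, 4, 7])
  g₅ := algebraMap K _ (gam p M ![1, 2, 5, 7])
  g₆ := algebraMap K _ (gam p M ![1, 3, 5, 7])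
  u := fracU
  w := fracW
  fil := isMulFiltration_xFil
  mem := by
    have h2 : (2⁻¹ : Frac K) = algebraMap K _ 2⁻¹ := by rw [map_inv₀, map_ofNat]
    simp only [← map_inv₀, h2, Set.mem_insert_iff, Set.mem_singleton_iff]
    rintro t (rfl | rfl | rfl | rfl | rfl | rfl | rfl | rfl | rfl | rfl | rfl | rfl | rfl | rfl |
      rfl | rfl | rfl | rfl) <;> exact algebraMap_mem_xFil _
  hu := fracU_mem
  hw := fracW_mem
  ha := by simpa using ha
  hb := by simpa using hb
  rel₁ := by simp only [← map_pow, ← map_mul, ← map_sub, ← map_add, frob_plucker_1237]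
  rel₂ := by simp only [← map_pow, ← map_mul, ← map_sub, ← map_add, ← frob_plucker_1247]
  rel₃ := by simp only [← map_pow, ← map_mul, ← map_sub, frob_plucker_1347]
  rel₄ := by simp only [← map_pow, ← map_mul, ← map_sub, frob_plucker_2347]
  rel₅ := by simp only [← map_mul, ← map_sub, ← map_neg, plucker_1257]
  rel₆ := by simp only [← map_mul, ← map_sub, ← map_neg, plucker_1357]

variable (ha : gam p M ![1, 2, 3, 4] ≠ 0) (hb : gam p M ![1, 2, 3, 5] ≠ 0)

theorem neg_delta_div : -(toFrac (delta : MvPolynomial (Fin 3) K) / toFrac (X 2) ^ 2) =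
    fracW - fracU ^ 2 := by
  rw [delta, map_sub, map_mul, map_pow, ← X_mul_fracU, ← X_mul_fracW]
  have := toFrac_X_ne_zero (K := K)
  field_simp
  ring

omit [Fact p.Prime] [CharP K p] in
theorem extraCol_odd (k : ℕ) : extraCol (K := K) p (2 * k + 1) = fracU ^ p ^ k := by
  rw [extraCol, if_pos (by simp)]
  simp [fracU, toFrac]

omit [Fact p.Prime] [CharP K p] in
theorem extraCol_even (k : ℕ) :
    extraCol (K := K) p (2 * k + 2) = (fracW - fracU ^ 2) ^ p ^ k := by
  rw [extraCol, if_neg (by simp [parity_simps]), neg_delta_div]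
  congr 2
  omega

theorem fTilde_12345 : fTilde p M ![1, 2, 3, 4, 5] = (minorData p M ha hb).F₁ := by
  rw [fTilde_eq, extraCol_odd 0, extraCol_odd 1, extraCol_odd 2, extraCol_even 0, extraCol_even 1,
    pow_zero, pow_one, pow_one, pow_one, sub_pow_char, MinorData.F₁, MinorData.s]
  simp only [minorData]
  ring

theorem fTilde_12346 : fTilde p M ![1, 2, 3, 4, 6] = (minorData p M ha hb).G := by
  rw [fTilde_eq, extraCol_odd 0, extraCol_odd 1, extraCol_even 2, extraCol_even 0, extraCol_even 1,
    pow_zero, pow_one, pow_one, pow_one, sub_pow_char, sub_pow_char_pow, MinorData.G, MinorData.s']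
  simp only [minorData]
  ring

include ha hb

theorem f₁_spec (h2 : 2 < p) : (f₁ p M).IsHomogeneous (p ^ 2) ∧
    toFrac (f₁ p M) = toFrac (X 2) ^ p ^ 2 * (minorData p M ha hb).F₁ ∧
    ∃ s, f₁ p M = C (gam p M ![1, 2, 3, 4]) * X 1 ^ p ^ 2 + X 2 * s := by
  obtain ⟨h3, h4, h5⟩ := MinorData.two_le h2
  have := (minorData p M ha hb).F₁_sub_mem h2
  obtain ⟨r, s, hr, er, ers⟩ := exists_form_of_lead (n := p ^ 2)
    (isMulFiltration_xFil.mem_of_le this (by push_cast; omega))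
  have e : f₁ p M = r := clearDenom_eq (d := p ^ 2) (by rw [er, fTilde_12345])
    (not_X_dvd_of_lead ha ers)
  rw [e]
  exact ⟨hr, er, s, ers⟩

theorem fJ_12346_spec (h2 : 2 < p) : (fJ p M ![1, 2, 3, 4, 6]).IsHomogeneous (2 * p ^ 2) ∧
    toFrac (fJ p M ![1, 2, 3, 4, 6]) =
      toFrac (X 2) ^ (2 * p ^ 2) * (minorData p M ha hb).G := by
  obtain ⟨h3, h4, h5⟩ := MinorData.two_le h2
  set S := minorData p M ha hb
  -- The lead term of `G` is -a u^(2p²), because w^(p²) has only half that degree.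
  have hm : S.G - algebraMap K _ (-gam p M ![1, 2, 3, 4]) * fracU ^ (2 * p ^ 2) ∈
      xFil (((2 * p ^ 2 : ℕ) : ℤ) - 1) := by
    have e : S.G - algebraMap K _ (-gam p M ![1, 2, 3, 4]) * fracU ^ (2 * p ^ 2) =
        S.a * S.w ^ p ^ 2 + S.s' := by
      rw [MinorData.G, map_neg]
      simp only [S, minorData]
      ring
    rw [e]
    refine add_mem (S.fil.mem_of_le (S.fil.mul S.mem_coeff.1 (S.fil.pow S.hw _)) ?_)
      (S.fil.mem_of_le (S.s'_mem h2) ?_) <;> push_cast <;> nlinarith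
  obtain ⟨r, s, hr, er, ers⟩ := exists_form_of_lead hm
  have e : fJ p M ![1, 2, 3, 4, 6] = r := clearDenom_eq (by rw [er, fTilde_12346 ha hb])
    (not_X_dvd_of_lead (neg_ne_zero.2 ha) ers)
  rw [e]
  exact ⟨hr, er⟩

omit ha hb [Fact p.Prime] in
theorem two_ne_zero_of_lt (h2 : 2 < p) (F : Type*) [Field F] [CharP F p] : (2 : F) ≠ 0 := by
  have := (CharP.cast_eq_zero_iff F p 2).not.2 (Nat.not_dvd_of_pos_of_lt (by norm_num) h2)
  exact_mod_cast this

theorem f₂_spec (h2 : 2 < p) : (f₂ p M).IsHomogeneous (p ^ 2 + 2 * p) ∧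
    toFrac (f₂ p M) = toFrac (X 2) ^ (p ^ 2 + 2 * p) * (minorData p M ha hb).F₂ ∧
    (∃ s, f₂ p M = C (gam p M ![1, 2, 3, 4] * gam p M ![1, 2, 3, 5]) * X 1 ^ (p ^ 2 + 2 * p) +
      X 2 * s) ∧
    2 * X 2 ^ (p ^ 2 - 2 * p) * f₂ p M =
      f₁ p M ^ 2 + C (gam p M ![1, 2, 3, 4]) * fJ p M ![1, 2, 3, 4, 6] := by
  obtain ⟨h3, h4, h5⟩ := MinorData.two_le h2
  set S := minorData p M ha hb
  have h20 := two_ne_zero_of_lt h2 (Frac K)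
  have h20' := two_ne_zero_of_lt h2 K
  have hm : S.F₂ - algebraMap K _ (gam p M ![1, 2, 3, 4] * gam p M ![1, 2, 3, 5]) *
      fracU ^ (p ^ 2 + 2 * p) ∈ xFil (((p ^ 2 + 2 * p : ℕ) : ℤ) - 1) := by
    rw [map_mul]
    exact S.fil.mem_of_le (S.F₂_sub_mem h2 h20) (by push_cast; omega)
  obtain ⟨r, s, hr, er, ers⟩ := exists_form_of_lead hm
  have key : 2 * X 2 ^ (p ^ 2 - 2 * p) * r =
      f₁ p M ^ 2 + C (gam p M ![1, 2, 3, 4]) * fJ p M ![1, 2, 3, 4, 6] := by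
    apply toFrac_injective
    have hle : 2 * p ≤ p ^ 2 := by nlinarith
    have e : (2 * p ^ 2) = (p ^ 2 - 2 * p) + (p ^ 2 + 2 * p) := by omega
    simp only [map_mul, map_add, map_pow, map_ofNat]
    rw [er, (f₁_spec ha hb h2).2.1, (fJ_12346_spec ha hb h2).2, toFrac, algebraMap_C,
      MinorData.F₂]
    change _ = (_ * S.F₁) ^ 2 + S.a * (_ * S.G)
    rw [mul_pow, ← pow_mul, mul_comm (p ^ 2) 2, e, pow_add]
    field_simp
    ring
  have e2 : f₂ p M = r := by
    rw [f₂, ← key, X_pow_eq_monomial,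
      show (2 : MvPolynomial (Fin 3) K) * monomial (Finsupp.single 2 (p ^ 2 - 2 * p)) 1 * r =
        monomial (Finsupp.single 2 (p ^ 2 - 2 * p)) 1 * (2 * r) by ring,
      divMonomial_monomial_mul, ← mul_assoc, show (2 : MvPolynomial (Fin 3) K) = C 2 from (map_ofNat C 2).symm,
      ← C_mul, inv_mul_cancel₀ h20', C_1, one_mul]
  rw [e2]
  exact ⟨hr, er, ⟨s, ers⟩, key⟩

end Invariants

/-! ### The group action -/

section Action

variable {K : Type*} [Field K] {p : ℕ} [Algebra (ZMod p) K] {M : Matrix (Fin 2) (Fin 4) K}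

/-- The translation of `y / x` under a group element. -/
def shift₁ (M : Matrix (Fin 2) (Fin 4) K) (a : Multiplicative (Fin 4 → ZMod p)) : K :=
  ∑ j, Multiplicative.toAdd a j • M 0 j

/-- The translation of `-δ / x²` under a group element. -/
def shift₂ (M : Matrix (Fin 2) (Fin 4) K) (a : Multiplicative (Fin 4 → ZMod p)) : K :=
  ∑ j, Multiplicative.toAdd a j • M 1 j

theorem shift₁_mul (a b : Multiplicative (Fin 4 → ZMod p)) :
    shift₁ M (a * b) = shift₁ M a + shift₁ M b := by
  simp [shift₁, add_smul, Finset.sum_add_distrib]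

theorem shift₂_mul (a b : Multiplicative (Fin 4 → ZMod p)) :
    shift₂ M (a * b) = shift₂ M a + shift₂ M b := by
  simp [shift₂, add_smul, Finset.sum_add_distrib]

theorem act_z (a : Multiplicative (Fin 4 → ZMod p)) :
    act p M a (X 0) = X 0 + C (2 * shift₁ M a) * X 1 + C (shift₁ M a ^ 2 + shift₂ M a) * X 2 := by
  simp [act, rep, sigma, Fin.sum_univ_three, shift₁, shift₂]

theorem act_y (a : Multiplicative (Fin 4 → ZMod p)) :
    act p M a (X 1) = X 1 + C (shift₁ M a) * X 2 := by
  simp [act, rep, sigma, Fin.sum_univ_three, shift₁]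

theorem act_x (a : Multiplicative (Fin 4 → ZMod p)) : act p M a (X 2) = X 2 := by
  simp [act, rep, sigma, Fin.sum_univ_three]

theorem act_C (a : Multiplicative (Fin 4 → ZMod p)) (c : K) : act p M a (C c) = C c :=
  (act p M a).commutes c

theorem act_act (a b : Multiplicative (Fin 4 → ZMod p)) (f : MvPolynomial (Fin 3) K) :
    act p M a (act p M b f) = act p M (a * b) f := by
  suffices h : (act p M a).comp (act p M b) = act p M (a * b) from DFunLike.congr_fun h f
  apply MvPolynomial.algHom_ext
  intro i
  rw [AlgHom.comp_apply]
  fin_cases i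
  · simp only [Fin.zero_eta, act_z, act_y, act_x, act_C, map_add, map_mul, shift₁_mul, shift₂_mul,
      map_pow, show (C 2 : MvPolynomial (Fin 3) K) = 2 from map_ofNat C 2, map_ofNat]
    ring
  · simp only [Fin.mk_one, act_y, act_x, act_C, map_add, map_mul, shift₁_mul]
    ring
  · simp only [Fin.reduceFinMk, act_x]

theorem act_one (f : MvPolynomial (Fin 3) K) : act p M 1 f = f := by
  have : act p M 1 = AlgHom.id K _ := by
    apply MvPolynomial.algHom_ext
    intro i
    fin_cases i <;> simp [act_z, act_y, act_x, shift₁, shift₂]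
  rw [this]; rfl

theorem act_injective (a : Multiplicative (Fin 4 → ZMod p)) : Function.Injective (act p M a) :=
  Function.LeftInverse.injective (g := act p M a⁻¹) fun f => by
    rw [act_act, inv_mul_cancel, act_one]

/-- The action on the field of fractions. -/
def actFrac (p : ℕ) [Algebra (ZMod p) K] (M : Matrix (Fin 2) (Fin 4) K)
    (a : Multiplicative (Fin 4 → ZMod p)) : Frac K →+* Frac K :=
  IsFractionRing.lift (A := MvPolynomial (Fin 3) K) (g := toFrac.comp (act p M a).toRingHom)
    (toFrac_injective.comp (act_injective a))

theorem actFrac_toFrac (a : Multiplicative (Fin 4 → ZMod p)) (f : MvPolynomial (Fin 3) K) :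
    actFrac p M a (toFrac f) = toFrac (act p M a f) :=
  IsFractionRing.lift_algebraMap _ _

theorem actFrac_algebraMap (a : Multiplicative (Fin 4 → ZMod p)) (c : K) :
    actFrac p M a (algebraMap K _ c) = algebraMap K _ c := by
  rw [← algebraMap_C, actFrac_toFrac, act_C]

theorem actFrac_u (a : Multiplicative (Fin 4 → ZMod p)) :
    actFrac p M a fracU = fracU + algebraMap K _ (shift₁ M a) := by
  have := toFrac_X_ne_zero (K := K)
  rw [fracU, map_div₀, actFrac_toFrac, actFrac_toFrac, act_x, act_y, map_add, map_mul, toFrac,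
    algebraMap_C]
  field_simp

theorem actFrac_w (a : Multiplicative (Fin 4 → ZMod p)) :
    actFrac p M a (fracW - fracU ^ 2) = fracW - fracU ^ 2 + algebraMap K _ (shift₂ M a) := by
  have := toFrac_X_ne_zero (K := K)
  rw [map_sub, map_pow, actFrac_u, fracW, fracU, map_div₀, actFrac_toFrac, actFrac_toFrac, act_x,
    act_z]
  simp only [toFrac, map_mul, map_add, map_pow, algebraMap_C, map_ofNat]
  field_simp
  ring

section Char

variable [Fact p.Prime] [CharP K p]

/-- The translation of the entry in row `r` of the extra column. -/
theorem sum_smul_Gam (a : Multiplicative (Fin 4 → ZMod p)) (r : ℕ) :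
    ∑ j, Multiplicative.toAdd a j • Gam p M r j =
      if Odd r then shift₁ M a ^ p ^ ((r - 1) / 2) else shift₂ M a ^ p ^ ((r - 1) / 2) := by
  -- The coefficients lie in 𝔽_p, so the Frobenius acts only on the matrix entries.
  have e : ∀ (k : ℕ) (i : Fin 2), (∑ j, Multiplicative.toAdd a j • M i j) ^ p ^ k =
      ∑ j, Multiplicative.toAdd a j • M i j ^ p ^ k := by
    intro k i
    rw [sum_pow_char_pow]
    refine Finset.sum_congr rfl fun j _ => ?_
    rw [Algebra.smul_def, mul_pow, ← map_pow, ZMod.pow_card_pow, Algebra.smul_def]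
  simp only [Gam, shift₁, shift₂, e]
  split_ifs <;> rfl

theorem actFrac_extraCol (a : Multiplicative (Fin 4 → ZMod p)) (r : ℕ) :
    actFrac p M a (extraCol p r) = extraCol p r +
      algebraMap K _ (∑ j, Multiplicative.toAdd a j • Gam p M r j) := by
  rw [sum_smul_Gam, extraCol, neg_delta_div]
  split_ifs
  · change actFrac p M a (fracU ^ _) = fracU ^ _ + _
    rw [map_pow, actFrac_u, add_pow_char_pow, map_pow]
  · rw [map_pow, actFrac_w, add_pow_char_pow, map_pow]

/-- The group element adds to the last column an 𝔽_p-combination of the columns of Γ, and such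
columns contribute zero to the determinant by `sum_gam_mul_Gam`. -/
theorem actFrac_fTilde (a : Multiplicative (Fin 4 → ZMod p)) (J : Fin 5 → ℕ) :
    actFrac p M a (fTilde p M J) = fTilde p M J := by
  have h := fun w => det_snoc_column (p := p) (M := M)
    ((algebraMap (MvPolynomial (Fin 3) K) (Frac K)).comp C) J w
  have h1 : fTilde p M J = _ := h fun i => extraCol p (J i)
  rw [h1, map_sum]
  have h2 : ∑ i : Fin 5, (-1) ^ (i : ℕ) * gam p M (J ∘ i.succAbove) *
      (∑ j, Multiplicative.toAdd a j • Gam p M (J i) j) = 0 := by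
    simp only [Finset.mul_sum]
    rw [Finset.sum_comm]
    refine Finset.sum_eq_zero fun j _ => ?_
    rw [← smul_zero (Multiplicative.toAdd a j), ← sum_gam_mul_Gam (p := p) (M := M) J j,
      Finset.smul_sum]
    exact Finset.sum_congr rfl fun i _ => mul_smul_comm _ _ _
  rw [← sub_eq_zero, ← Finset.sum_sub_distrib, ← map_zero (algebraMap K (Frac K)), ← h2, map_sum]
  refine Finset.sum_congr rfl fun i _ => ?_
  simp only [RingHom.comp_apply, algebraMap_C, map_mul, map_pow, map_neg, map_one,
    actFrac_algebraMap, actFrac_extraCol]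
  ring

omit [Fact p.Prime] [CharP K p] in
theorem mem_invariants_of_actFrac {f : MvPolynomial (Fin 3) K} {n : ℕ} {g : Frac K}
    (h : toFrac f = toFrac (X 2) ^ n * g) (hg : ∀ a, actFrac p M a g = g) :
    f ∈ invariants p M := by
  intro a
  apply toFrac_injective
  rw [← actFrac_toFrac, h, map_mul, map_pow, actFrac_toFrac, act_x, hg]

variable (ha : gam p M ![1, 2, 3, 4] ≠ 0) (hb : gam p M ![1, 2, 3, 5] ≠ 0)

theorem actFrac_F₁ (a : Multiplicative (Fin 4 → ZMod p)) :
    actFrac p M a (minorData p M ha hb).F₁ = (minorData p M ha hb).F₁ := by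
  rw [← fTilde_12345, actFrac_fTilde]

theorem actFrac_G (a : Multiplicative (Fin 4 → ZMod p)) :
    actFrac p M a (minorData p M ha hb).G = (minorData p M ha hb).G := by
  rw [← fTilde_12346, actFrac_fTilde]

theorem actFrac_F₂ (a : Multiplicative (Fin 4 → ZMod p)) :
    actFrac p M a (minorData p M ha hb).F₂ = (minorData p M ha hb).F₂ := by
  rw [MinorData.F₂, map_mul, map_add, map_mul, map_pow, actFrac_F₁, actFrac_G, map_inv₀,
    map_ofNat]
  congr 3
  exact actFrac_algebraMap _ _

include ha hb in
theorem f₁_mem (h2 : 2 < p) : f₁ p M ∈ invariants p M :=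
  mem_invariants_of_actFrac (f₁_spec ha hb h2).2.1 (actFrac_F₁ ha hb)

include ha hb in
theorem fJ_12346_mem (h2 : 2 < p) : fJ p M ![1, 2, 3, 4, 6] ∈ invariants p M :=
  mem_invariants_of_actFrac (fJ_12346_spec ha hb h2).2 (actFrac_G ha hb)

include ha hb in
theorem f₂_mem (h2 : 2 < p) : f₂ p M ∈ invariants p M :=
  mem_invariants_of_actFrac (f₂_spec ha hb h2).2.1 (actFrac_F₂ ha hb)

omit [Fact p.Prime] [CharP K p] in
theorem X_mem : (X 2 : MvPolynomial (Fin 3) K) ∈ invariants p M := fun a => act_x a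

-- Equal shifts give equal combinations of all rows of Γ; the rows 1, 2, 3, 4 already form an
-- invertible matrix.
include ha in
theorem shift_injective {a b : Multiplicative (Fin 4 → ZMod p)} (h1 : shift₁ M a = shift₁ M b)
    (h2 : shift₂ M a = shift₂ M b) : a = b := by
  have hc : ∀ r, ∑ j, Multiplicative.toAdd a j • Gam p M r j =
      ∑ j, Multiplicative.toAdd b j • Gam p M r j := by
    intro r
    rw [sum_smul_Gam, sum_smul_Gam, h1, h2]
  have h0 := Matrix.eq_zero_of_mulVec_eq_zero ha
    (v := fun j => algebraMap (ZMod p) K (Multiplicative.toAdd a j - Multiplicative.toAdd b j)) (by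
      ext i
      have := hc (![1, 2, 3, 4] i)
      simp only [Algebra.smul_def] at this
      simp only [Matrix.mulVec, dotProduct, Matrix.of_apply, Pi.zero_apply, map_sub, mul_sub,
        Finset.sum_sub_distrib]
      rw [sub_eq_zero]
      simpa only [mul_comm] using this)
  apply Multiplicative.toAdd.injective
  ext j
  have := congrFun h0 j
  simp only [Pi.zero_apply, map_eq_zero, sub_eq_zero] at this
  exact this

/-! ### The orbit product of `z` -/

-- Stated for any order in which z is the largest variable, since the orbit product is needed both
-- for `grevLex` and for `wOrder`.
omit [Fact p.Prime] [CharP K p] in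
theorem degree_act_z (m : MonomialOrder (Fin 3))
    (h1 : m.toSyn (Finsupp.single 1 1) < m.toSyn (Finsupp.single 0 1))
    (h2 : m.toSyn (Finsupp.single 2 1) < m.toSyn (Finsupp.single 0 1))
    (a : Multiplicative (Fin 4 → ZMod p)) :
    m.degree (act p M a (X 0)) = Finsupp.single 0 1 ∧
      m.leadingCoeff (act p M a (X 0)) = 1 := by
  classical
  have hX : m.degree (X 0 : MvPolynomial (Fin 3) K) = Finsupp.single 0 1 := m.degree_X
  have hc : ∀ (c : K) (i : Fin 3), m.toSyn (Finsupp.single i 1) < m.toSyn (Finsupp.single 0 1) →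
      m.toSyn (m.degree (C c * X i)) < m.toSyn (Finsupp.single 0 1) := by
    intro c i hi
    by_cases hc : c = 0
    · rw [hc, C_0, zero_mul, m.degree_zero, map_zero]
      exact m.toSyn_lt_iff_ne_zero.2 (by simp)
    · rwa [degree_C_mul m hc, m.degree_X]
  have hlt : m.toSyn (m.degree (C (2 * shift₁ M a) * X 1 +
      C (shift₁ M a ^ 2 + shift₂ M a) * X 2)) < m.toSyn (m.degree (X 0 : MvPolynomial (Fin 3) K)) := by
    rw [hX]
    exact m.degree_add_le.trans_lt (max_lt (hc _ 1 h1) (hc _ 2 h2))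
  rw [act_z, add_assoc, m.degree_add_of_lt hlt, m.leadingCoeff_add_of_lt hlt]
  exact ⟨hX, m.leadingCoeff_X⟩

-- The stabilizer of z is trivial: the coefficient of y recovers the first shift because 2 ≠ 0, and
-- that of x then recovers the second. The orbit product is therefore a product over the whole
-- group.
include ha in
theorem orbitNorm_eq (h2 : 2 < p) : orbitNorm p M (X 0) =
    ∏ a : Multiplicative (Fin 4 → ZMod p), act p M a (X 0) := by
  classical
  refine Finset.prod_image (f := fun g => g) fun a _ b _ hab => ?_
  simp only [act_z] at hab
  have h20 := two_ne_zero_of_lt h2 K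
  have e1 := congrArg (coeff (Finsupp.single 1 1)) hab
  have e2 := congrArg (coeff (Finsupp.single 2 1)) hab
  simp only [coeff_add, coeff_C_mul, coeff_X, Finsupp.single_left_inj one_ne_zero] at e1 e2
  simp [h20] at e1 e2
  rw [e1] at e2
  exact shift_injective ha e1 (add_left_cancel e2)

include ha in
theorem degree_orbitNorm (h2 : 2 < p) (m : MonomialOrder (Fin 3))
    (hm1 : m.toSyn (Finsupp.single 1 1) < m.toSyn (Finsupp.single 0 1))
    (hm2 : m.toSyn (Finsupp.single 2 1) < m.toSyn (Finsupp.single 0 1)) :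
    orbitNorm p M (X 0) ≠ 0 ∧ m.degree (orbitNorm p M (X 0)) = Finsupp.single 0 (p ^ 4) := by
  have hne : ∀ a ∈ (Finset.univ : Finset (Multiplicative (Fin 4 → ZMod p))),
      act p M a (X 0) ≠ 0 := fun a _ => by
    rw [← m.leadingCoeff_ne_zero_iff, (degree_act_z m hm1 hm2 a).2]
    exact one_ne_zero
  rw [orbitNorm_eq ha h2, m.degree_prod hne]
  refine ⟨Finset.prod_ne_zero_iff.2 hne, ?_⟩
  rw [Finset.sum_congr rfl fun a _ => (degree_act_z m hm1 hm2 a).1]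
  simp [ZMod.card]

include ha in
theorem orbitNorm_mem (h2 : 2 < p) : orbitNorm p M (X 0) ∈ invariants p M := by
  intro b
  rw [orbitNorm_eq ha h2, map_prod]
  simp only [act_act]
  exact Fintype.prod_equiv (Equiv.mulLeft b) _ _ fun _ => rfl

include ha in
theorem orbitNorm_isHomogeneous (h2 : 2 < p) : (orbitNorm p M (X 0)).IsHomogeneous (p ^ 4) := by
  rw [orbitNorm_eq ha h2]
  have := IsHomogeneous.prod (Finset.univ : Finset (Multiplicative (Fin 4 → ZMod p)))
    (fun a => act p M a (X 0)) (fun _ => 1) fun a _ => by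
      have hC : ∀ (c : K) (i : Fin 3), (C c * X i).IsHomogeneous 1 := fun c i => by
        simpa using (isHomogeneous_C (Fin 3) c).mul (isHomogeneous_X K i)
      rw [act_z]
      exact ((isHomogeneous_X K (0 : Fin 3)).add (hC _ 1)).add (hC _ 2)
  simpa [ZMod.card] using this

end Char

end Action

/-! ### The third invariant -/

section Third

variable {K : Type*} [Field K] {p : ℕ} [Fact p.Prime] [CharP K p]
  {M : Matrix (Fin 2) (Fin 4) K}

/-- A uniform shape for the cases p = 3 and p ≥ 5: the extra coefficient `k₂` at F₁^(p+1) is needed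
only for p = 3 and vanishes otherwise. -/
theorem exists_coeffs_third (h2 : 2 < p)
    (ha : gam p M ![1, 2, 3, 4] ≠ 0) (hb : gam p M ![1, 2, 3, 5] ≠ 0) :
    ∃ k₂ k₃ k₄ : K,
      (minorData p M ha hb).T + algebraMap K _ k₂ * (minorData p M ha hb).F₁ ^ (p + 1) +
        algebraMap K _ k₃ * ((minorData p M ha hb).F₁ ^ (p - 1) * (minorData p M ha hb).F₂) +
        algebraMap K _ k₄ * ((minorData p M ha hb).F₁ ^ ((p - 3) / 2) *
          (minorData p M ha hb).F₂ ^ ((p + 1) / 2)) +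
        algebraMap K _ (gam p M ![1, 2, 3, 4] ^ (2 * p + 2) / gam p M ![1, 2, 3, 5] *
          gam p M ![1, 3, 5, 7]) * fracU ^ (p ^ 3 + 2) ∈ xFil ((p : ℤ) ^ 3 + 1) ∧
      (5 ≤ p → k₂ = 0 ∧
        k₃ = gam p M ![1, 2, 3, 4] ^ (p + 1) * gam p M ![1, 2, 3, 7] / gam p M ![1, 2, 3, 5] ∧
        k₄ = gam p M ![1, 2, 3, 4] ^ (p + 3) * gam p M ![1, 2, 5, 7] /
          gam p M ![1, 2, 3, 5] ^ ((p + 3) / 2)) := by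
  by_cases h5 : 5 ≤ p
  · refine ⟨0, _, _, ?_, fun _ => ⟨rfl, rfl, rfl⟩⟩
    have h := (minorData p M ha hb).lead_five h5
    rw [map_zero, zero_mul, add_zero]
    simpa only [map_div₀, map_mul, map_pow, minorData] using h
  · have hp : p ≠ 4 := by
      rintro rfl
      exact absurd (Fact.out : Nat.Prime 4) (by norm_num)
    obtain rfl : p = 3 := by omega
    refine ⟨-(gam 3 M ![1, 2, 3, 5] ^ 6 / gam 3 M ![1, 2, 3, 4] ^ 2 * 2⁻¹),
      gam 3 M ![1, 2, 3, 4] ^ 4 * gam 3 M ![1, 2, 3, 7] / gam 3 M ![1, 2, 3, 5] +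
        gam 3 M ![1, 2, 3, 5] ^ 6 / gam 3 M ![1, 2, 3, 4] ^ 2 * 2⁻¹,
      gam 3 M ![1, 2, 3, 4] ^ 6 * gam 3 M ![1, 2, 5, 7] / gam 3 M ![1, 2, 3, 5] ^ 3 -
        (gam 3 M ![1, 2, 3, 4] ^ 4 * gam 3 M ![1, 2, 3, 7] / gam 3 M ![1, 2, 3, 5] +
        gam 3 M ![1, 2, 3, 5] ^ 6 / gam 3 M ![1, 2, 3, 4] ^ 2 * 2⁻¹), ?_, fun h => absurd h h5⟩
    have h := (minorData 3 M ha hb).lead_three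
    have e : ((3 : ℕ) : ℤ) ^ 3 + 1 = 28 := by norm_num
    rw [e]
    simpa only [map_div₀, map_mul, map_pow, map_add, map_sub, map_neg, map_inv₀, map_ofNat,
      minorData, neg_mul, ← sub_eq_add_neg, Nat.reduceAdd, Nat.reduceMul, Nat.reduceSub,
      Nat.reduceDiv, Nat.reducePow, pow_zero, one_mul] using h

/-- The combination of powers of `x, f₁, f₂` that is divisible by a high power of `x`. -/
def thirdSum (p : ℕ) (M : Matrix (Fin 2) (Fin 4) K) (k₂ k₃ k₄ : K) : MvPolynomial (Fin 3) K :=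
  C (gam p M ![1, 2, 3, 5] ^ p) * f₁ p M ^ (p + 2)
    - C (gam p M ![1, 2, 3, 4] ^ 2) * f₂ p M ^ p
    + C (-2 * gam p M ![1, 2, 3, 5] ^ p) * X 2 ^ (p ^ 2 - 2 * p) * f₁ p M ^ p * f₂ p M
    + C (gam p M ![1, 2, 3, 4] * gam p M ![1, 2, 4, 5] ^ p + k₂) * X 2 ^ p ^ 2 * f₁ p M ^ (p + 1)
    + C k₃ * X 2 ^ (2 * p ^ 2 - 2 * p) * f₁ p M ^ (p - 1) * f₂ p M
    + C k₄ * X 2 ^ (2 * p ^ 2 - p) * f₁ p M ^ ((p - 3) / 2) * f₂ p M ^ ((p + 1) / 2)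

/-- The explicit powers of x are those that bring every term to the common degree p³ + 2p². -/
theorem toFrac_thirdSum (h2 : 2 < p)
    (ha : gam p M ![1, 2, 3, 4] ≠ 0) (hb : gam p M ![1, 2, 3, 5] ≠ 0) (k₂ k₃ k₄ : K) :
    toFrac (thirdSum p M k₂ k₃ k₄) = toFrac (X 2) ^ (p ^ 3 + 2 * p ^ 2) *
      ((minorData p M ha hb).T + algebraMap K _ k₂ * (minorData p M ha hb).F₁ ^ (p + 1) +
        algebraMap K _ k₃ * ((minorData p M ha hb).F₁ ^ (p - 1) * (minorData p M ha hb).F₂) +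
        algebraMap K _ k₄ * ((minorData p M ha hb).F₁ ^ ((p - 3) / 2) *
          (minorData p M ha hb).F₂ ^ ((p + 1) / 2))) := by
  have hodd : Odd p := (Fact.out : p.Prime).odd_of_ne_two (by omega)
  obtain ⟨k, hk⟩ : ∃ k, p = 2 * k + 3 := by
    obtain ⟨r, hr⟩ := hodd
    exact ⟨r - 1, by omega⟩
  have k1 : (p - 3) / 2 = k := by omega
  have k2 : (p + 1) / 2 = k + 2 := by omega
  have s1 : p ^ 2 - 2 * p = (2 * k + 3) * (2 * k + 1) := by
    rw [hk]; apply Nat.sub_eq_of_eq_add; ring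
  have s2 : 2 * p ^ 2 - 2 * p = (2 * k + 3) * (4 * k + 4) := by
    rw [hk]; apply Nat.sub_eq_of_eq_add; ring
  have s3 : 2 * p ^ 2 - p = (2 * k + 3) * (4 * k + 5) := by
    rw [hk]; apply Nat.sub_eq_of_eq_add; ring
  have s4 : p - 1 = 2 * k + 2 := by omega
  rw [thirdSum, MinorData.T, k1, k2, s1, s2, s3, s4]
  simp only [map_add, map_sub, map_mul, map_pow, (f₁_spec ha hb h2).2.1, (f₂_spec ha hb h2).2.1,
    toFrac, algebraMap_C, map_neg, map_ofNat]
  generalize algebraMap (MvPolynomial (Fin 3) K) (Frac K) (X 2) = x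
  have ea : (minorData p M ha hb).a = algebraMap K _ (gam p M ![1, 2, 3, 4]) := rfl
  have eb : (minorData p M ha hb).b = algebraMap K _ (gam p M ![1, 2, 3, 5]) := rfl
  have ec : (minorData p M ha hb).c = algebraMap K _ (gam p M ![1, 2, 4, 5]) := rfl
  rw [← ea, ← eb, ← ec]
  generalize (minorData p M ha hb).F₁ = F
  generalize (minorData p M ha hb).F₂ = G
  generalize (minorData p M ha hb).a = a
  generalize (minorData p M ha hb).b ^ p = b
  generalize (minorData p M ha hb).c ^ p = c
  have t0 : (x ^ p ^ 2) ^ (p + 2) = x ^ (p ^ 3 + 2 * p ^ 2) := by rw [← pow_mul]; congr 1; ring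
  have t1 : (x ^ (p ^ 2 + 2 * p)) ^ p = x ^ (p ^ 3 + 2 * p ^ 2) := by
    rw [← pow_mul]; congr 1; ring
  have t2 : x ^ ((2 * k + 3) * (2 * k + 1)) * (x ^ p ^ 2) ^ p * x ^ (p ^ 2 + 2 * p) =
      x ^ (p ^ 3 + 2 * p ^ 2) := by
    rw [← pow_mul, ← pow_add, ← pow_add]; congr 1; rw [hk]; ring
  have t3 : x ^ p ^ 2 * (x ^ p ^ 2) ^ (p + 1) = x ^ (p ^ 3 + 2 * p ^ 2) := by
    rw [← pow_mul, ← pow_add]; congr 1; ring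
  have t4 : x ^ ((2 * k + 3) * (4 * k + 4)) * (x ^ p ^ 2) ^ (2 * k + 2) * x ^ (p ^ 2 + 2 * p) =
      x ^ (p ^ 3 + 2 * p ^ 2) := by
    rw [← pow_mul, ← pow_add, ← pow_add]; congr 1; rw [hk]; ring
  have t5 : x ^ ((2 * k + 3) * (4 * k + 5)) * (x ^ p ^ 2) ^ k *
      (x ^ (p ^ 2 + 2 * p)) ^ (k + 2) = x ^ (p ^ 3 + 2 * p ^ 2) := by
    rw [← pow_mul, ← pow_mul, ← pow_add, ← pow_add]; congr 1; rw [hk]; ring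
  simp only [mul_pow, neg_mul]
  linear_combination (b * F ^ (p + 2)) * t0 - (a ^ 2 * G ^ p) * t1 - (2 * b * F ^ p * G) * t2 +
    ((a * c + algebraMap K _ k₂) * F ^ (p + 1)) * t3 +
    (algebraMap K _ k₃ * F ^ (2 * k + 2) * G) * t4 +
    (algebraMap K _ k₄ * F ^ k * G ^ (k + 2)) * t5

theorem exists_third_form (h2 : 2 < p)
    (ha : gam p M ![1, 2, 3, 4] ≠ 0) (hb : gam p M ![1, 2, 3, 5] ≠ 0) :
    ∃ (k₂ k₃ k₄ : K) (f s : MvPolynomial (Fin 3) K), f.IsHomogeneous (p ^ 3 + 2) ∧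
      f = C (gam p M ![1, 3, 5, 7]) * X 1 ^ (p ^ 3 + 2) + X 2 * s ∧
      C (-(gam p M ![1, 2, 3, 4] ^ (2 * p + 2) / gam p M ![1, 2, 3, 5])) *
        X 2 ^ (2 * p ^ 2 - 2) * f = thirdSum p M k₂ k₃ k₄ ∧
      (5 ≤ p → k₂ = 0 ∧
        k₃ = gam p M ![1, 2, 3, 4] ^ (p + 1) * gam p M ![1, 2, 3, 7] / gam p M ![1, 2, 3, 5] ∧
        k₄ = gam p M ![1, 2, 3, 4] ^ (p + 3) * gam p M ![1, 2, 5, 7] /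
          gam p M ![1, 2, 3, 5] ^ ((p + 3) / 2)) := by
  obtain ⟨k₂, k₃, k₄, hm, h5⟩ := exists_coeffs_third h2 ha hb
  have hs := toFrac_thirdSum h2 ha hb k₂ k₃ k₄
  set g := (minorData p M ha hb).T + algebraMap K _ k₂ * (minorData p M ha hb).F₁ ^ (p + 1) +
        algebraMap K _ k₃ * ((minorData p M ha hb).F₁ ^ (p - 1) * (minorData p M ha hb).F₂) +
        algebraMap K _ k₄ * ((minorData p M ha hb).F₁ ^ ((p - 3) / 2) *
          (minorData p M ha hb).F₂ ^ ((p + 1) / 2))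
  set t := gam p M ![1, 2, 3, 4] ^ (2 * p + 2) / gam p M ![1, 2, 3, 5] with ht
  have ht0 : t ≠ 0 := div_ne_zero (pow_ne_zero _ ha) hb
  have ht0' : algebraMap K (Frac K) t ≠ 0 := by simpa using ht0
  -- Dividing by -t normalizes the lead coefficient to γ₁₃₅₇.
  have hm' : -(algebraMap K _ t⁻¹) * g - algebraMap K _ (gam p M ![1, 3, 5, 7]) *
      fracU ^ (p ^ 3 + 2) ∈ xFil (((p ^ 3 + 2 : ℕ) : ℤ) - 1) := by
    have h := isMulFiltration_xFil.mul (algebraMap_mem_xFil (-t⁻¹)) hm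
    have e : -(algebraMap K _ t⁻¹) * g - algebraMap K _ (gam p M ![1, 3, 5, 7]) *
        fracU ^ (p ^ 3 + 2) = algebraMap K (Frac K) (-t⁻¹) *
        (g + algebraMap K _ (t * gam p M ![1, 3, 5, 7]) * fracU ^ (p ^ 3 + 2)) := by
      rw [map_neg, map_mul, map_inv₀]
      field_simp
      ring
    rw [e]
    exact isMulFiltration_xFil.mem_of_le h (by push_cast; omega)
  obtain ⟨f, s, hf, ef, efs⟩ := exists_form_of_lead hm'
  refine ⟨k₂, k₃, k₄, f, s, hf, efs, ?_, h5⟩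
  apply toFrac_injective
  have hx := toFrac_X_ne_zero (K := K)
  have hp2 : 2 ≤ 2 * p ^ 2 := by nlinarith
  rw [hs, map_mul, map_mul, map_pow, ef, toFrac, algebraMap_C, map_neg, map_inv₀,
    show p ^ 3 + 2 * p ^ 2 = (2 * p ^ 2 - 2) + (p ^ 3 + 2) by omega, pow_add (algebraMap _ _ (X 2))
      (2 * p ^ 2 - 2)]
  field_simp

variable [Algebra (ZMod p) K]

/-- The lead monomials of the starting set. -/
theorem startSet_spec (h2 : 2 < p)
    (ha : gam p M ![1, 2, 3, 4] ≠ 0) (hb : gam p M ![1, 2, 3, 5] ≠ 0) :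
    (∀ j, startSet p M j ≠ 0) ∧
    (∀ j, (startSet p M j).IsHomogeneous (![1, p ^ 2, p ^ 2 + 2 * p, p ^ 4] j)) ∧
    grevLex.degree (f₁ p M) = Finsupp.single 1 (p ^ 2) ∧
    grevLex.leadingCoeff (f₁ p M) = gam p M ![1, 2, 3, 4] ∧
    grevLex.degree (f₂ p M) = Finsupp.single 1 (p ^ 2 + 2 * p) ∧
    grevLex.leadingCoeff (f₂ p M) = gam p M ![1, 2, 3, 4] * gam p M ![1, 2, 3, 5] ∧
    grevLex.degree (orbitNorm p M (X 0)) = Finsupp.single 0 (p ^ 4) := by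
  obtain ⟨hf1, -, s1, e1⟩ := f₁_spec ha hb h2
  obtain ⟨hf2, -, ⟨s2, e2⟩, -⟩ := f₂_spec ha hb h2
  obtain ⟨d1, c1⟩ := degree_of_sub_mem_X ha hf1 e1
  obtain ⟨d2, c2⟩ := degree_of_sub_mem_X (mul_ne_zero ha hb) hf2 e2
  obtain ⟨n3, d3⟩ := degree_orbitNorm ha h2 grevLex (by rw [grevLex_lt_iff]; simp)
    (by rw [grevLex_lt_iff]; simp)
  have n1 : f₁ p M ≠ 0 := grevLex.leadingCoeff_ne_zero_iff.1 (by rw [c1]; exact ha)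
  have n2 : f₂ p M ≠ 0 := grevLex.leadingCoeff_ne_zero_iff.1 (by rw [c2]; exact mul_ne_zero ha hb)
  refine ⟨fun j => ?_, fun j => ?_, d1, c1, d2, c2, d3⟩
  · fin_cases j
    exacts [X_ne_zero 2, n1, n2, n3]
  · fin_cases j
    exacts [isHomogeneous_X _ _, hf1, hf2, orbitNorm_isHomogeneous ha h2]

theorem degree_powProd_startSet (h2 : 2 < p)
    (ha : gam p M ![1, 2, 3, 4] ≠ 0) (hb : gam p M ![1, 2, 3, 5] ≠ 0) (I : Fin 4 →₀ ℕ) :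
    (grevLex.degree (powProd (startSet p M) I)) 0 = p ^ 4 * I 3 ∧
    (grevLex.degree (powProd (startSet p M) I)) 1 = p ^ 2 * I 1 + (p ^ 2 + 2 * p) * I 2 ∧
    (grevLex.degree (powProd (startSet p M) I)) 2 = I 0 := by
  obtain ⟨h0, -, d1, -, d2, -, d3⟩ := startSet_spec h2 ha hb
  rw [RankFour.degree_powProd _ h0, Fin.sum_univ_four]
  simp only [startSet, Matrix.cons_val_zero, Matrix.cons_val_one, Matrix.cons_val, d1, d2, d3,
    grevLex.degree_X]
  refine ⟨?_, ?_, ?_⟩ <;> simp <;> ring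

theorem isTat_startSet (h2 : 2 < p)
    (ha : gam p M ![1, 2, 3, 4] ≠ 0) (hb : gam p M ![1, 2, 3, 5] ≠ 0) :
    IsTat (startSet p M) (Finsupp.single 2 p) (Finsupp.single 1 (p + 2)) := by
  obtain ⟨a0, a1, a2⟩ := degree_powProd_startSet h2 ha hb (Finsupp.single 2 p)
  obtain ⟨b0, b1, b2⟩ := degree_powProd_startSet h2 ha hb (Finsupp.single 1 (p + 2))
  rw [IsTat]
  ext i
  fin_cases i
  · exact a0.trans (Eq.trans (by
      rw [Finsupp.single_eq_of_ne (by decide), Finsupp.single_eq_of_ne (by decide)]) b0.symm)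
  · refine a1.trans (Eq.trans ?_ b1.symm)
    rw [Finsupp.single_eq_same, Finsupp.single_eq_same, Finsupp.single_eq_of_ne (by decide),
      Finsupp.single_eq_of_ne (by decide)]
    ring
  · exact a2.trans (Eq.trans (by
      rw [Finsupp.single_eq_of_ne (by decide), Finsupp.single_eq_of_ne (by decide)]) b2.symm)

theorem tatDiff_startSet (h2 : 2 < p)
    (ha : gam p M ![1, 2, 3, 4] ≠ 0) (hb : gam p M ![1, 2, 3, 5] ≠ 0) :
    tatDiff (startSet p M) (Finsupp.single 2 p) (Finsupp.single 1 (p + 2)) =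
      f₂ p M ^ p - C (gam p M ![1, 2, 3, 5] ^ p / gam p M ![1, 2, 3, 4] ^ 2) *
        f₁ p M ^ (p + 2) := by
  obtain ⟨h0, -, -, c1, -, c2, -⟩ := startSet_spec h2 ha hb
  rw [tatDiff, tatScalar, powProd_single, powProd_single]
  change f₂ p M ^ p - C (grevLex.leadingCoeff (f₂ p M ^ p) /
    grevLex.leadingCoeff (f₁ p M ^ (p + 2))) * f₁ p M ^ (p + 2) = _
  rw [grevLex.leadingCoeff_pow, grevLex.leadingCoeff_pow, c1, c2, mul_pow, pow_add,
    mul_div_mul_left _ _ (pow_ne_zero _ ha)]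

end Third

/-! ### Subduction of the first tête-à-tête to a multiple of f₃ -/

section Third

variable {K : Type*} [Field K] {p : ℕ} [Fact p.Prime] [CharP K p]
  {M : Matrix (Fin 2) (Fin 4) K} [Algebra (ZMod p) K]

/-- The exponent vector of `x^i f₁^j f₂^k`. -/
def expo (i j k : ℕ) : Fin 4 →₀ ℕ :=
  Finsupp.single 0 i + Finsupp.single 1 j + Finsupp.single 2 k

omit [CharP K p] in
theorem powProd_expo (i j k : ℕ) :
    powProd (startSet p M) (expo i j k) = X 2 ^ i * f₁ p M ^ j * f₂ p M ^ k := by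
  simp only [expo, powProd_add, powProd_single]; rfl

theorem degree_powProd_expo (h2 : 2 < p)
    (ha : gam p M ![1, 2, 3, 4] ≠ 0) (hb : gam p M ![1, 2, 3, 5] ≠ 0) (i j k : ℕ) :
    (grevLex.degree (powProd (startSet p M) (expo i j k))) 0 = 0 ∧
    (grevLex.degree (powProd (startSet p M) (expo i j k))) 1 =
      p ^ 2 * j + (p ^ 2 + 2 * p) * k ∧
    (grevLex.degree (powProd (startSet p M) (expo i j k))) 2 = i := by
  obtain ⟨a0, a1, a2⟩ := degree_powProd_startSet h2 ha hb (expo i j k)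
  refine ⟨a0.trans ?_, a1.trans ?_, a2.trans ?_⟩ <;> simp [expo]

theorem degree_C_mul_le (c : K) (g : MvPolynomial (Fin 3) K) :
    grevLex.toSyn (grevLex.degree (C c * g)) ≤ grevLex.toSyn (grevLex.degree g) := by
  by_cases hc : c = 0
  · rw [hc, C_0, zero_mul, grevLex.degree_zero, map_zero]; exact grevLex.zero_le _
  · rw [degree_C_mul _ hc]

theorem degree_C_mul_add_lt {f g : MvPolynomial (Fin 3) K} {c : K} {d : grevLex.syn}
    (h1 : grevLex.toSyn (grevLex.degree f) < d) (h2 : grevLex.toSyn (grevLex.degree g) < d) :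
    grevLex.toSyn (grevLex.degree (C c * f + g)) < d :=
  grevLex.degree_add_le.trans_lt (max_lt ((degree_C_mul_le _ _).trans_lt h1) h2)

/-- A combination of products with decreasing lead monomials subducts to its tail. -/
theorem exists_subduction_of_chain {n : ℕ} {h : Fin n → MvPolynomial (Fin 3) K}
    (h0 : ∀ j, h j ≠ 0) {I₁ I₂ I₃ I₄ : Fin n →₀ ℕ} {E : MvPolynomial (Fin 3) K} {c₁ c₂ c₃ c₄ : K}
    (l21 : grevLex.toSyn (grevLex.degree (powProd h I₂)) <
      grevLex.toSyn (grevLex.degree (powProd h I₁)))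
    (l32 : grevLex.toSyn (grevLex.degree (powProd h I₃)) <
      grevLex.toSyn (grevLex.degree (powProd h I₂)))
    (l43 : grevLex.toSyn (grevLex.degree (powProd h I₄)) <
      grevLex.toSyn (grevLex.degree (powProd h I₃)))
    (lE4 : grevLex.toSyn (grevLex.degree E) < grevLex.toSyn (grevLex.degree (powProd h I₄))) :
    ∃ q, Subduction h (C c₁ * powProd h I₁ + (C c₂ * powProd h I₂ +
      (C c₃ * powProd h I₃ + (C c₄ * powProd h I₄ + E)))) q E := by
  refine Subduction.exists_cons h0 rfl (degree_C_mul_add_lt l21 (degree_C_mul_add_lt (l32.trans l21)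
    (degree_C_mul_add_lt (l43.trans (l32.trans l21)) (lE4.trans (l43.trans (l32.trans l21)))))) ?_
  refine Subduction.exists_cons h0 rfl (degree_C_mul_add_lt l32 (degree_C_mul_add_lt (l43.trans l32)
    (lE4.trans (l43.trans l32)))) ?_
  refine Subduction.exists_cons h0 rfl (degree_C_mul_add_lt l43 (lE4.trans l43)) ?_
  exact Subduction.exists_cons h0 rfl lE4 ⟨0, .refl _⟩

theorem tatDiff_eq_of_third (h2 : 2 < p)
    (ha : gam p M ![1, 2, 3, 4] ≠ 0) (hb : gam p M ![1, 2, 3, 5] ≠ 0) {k₂ k₃ k₄ : K}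
    {f : MvPolynomial (Fin 3) K}
    (e : C (-(gam p M ![1, 2, 3, 4] ^ (2 * p + 2) / gam p M ![1, 2, 3, 5])) *
        X 2 ^ (2 * p ^ 2 - 2) * f = thirdSum p M k₂ k₃ k₄) :
    ∃ c₁ c₂ c₃ c₄ : K,
      tatDiff (startSet p M) (Finsupp.single 2 p) (Finsupp.single 1 (p + 2)) =
        C c₁ * powProd (startSet p M) (expo (p ^ 2 - 2 * p) p 1) +
        (C c₂ * powProd (startSet p M) (expo (p ^ 2) (p + 1) 0) +
        (C c₃ * powProd (startSet p M) (expo (2 * p ^ 2 - 2 * p) (p - 1) 1) +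
        (C c₄ * powProd (startSet p M) (expo (2 * p ^ 2 - p) ((p - 3) / 2) ((p + 1) / 2)) +
        C (gam p M ![1, 2, 3, 4] ^ (2 * p) / gam p M ![1, 2, 3, 5]) *
        X 2 ^ (2 * p ^ 2 - 2) * f))) := by
  set a := gam p M ![1, 2, 3, 4] with hadef
  set b := gam p M ![1, 2, 3, 5] with hbdef
  refine ⟨(a ^ 2)⁻¹ * (-2 * b ^ p), (a ^ 2)⁻¹ * (a * gam p M ![1, 2, 4, 5] ^ p + k₂),
    (a ^ 2)⁻¹ * k₃, (a ^ 2)⁻¹ * k₄, ?_⟩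
  have hE : C (a ^ (2 * p) / b) * X 2 ^ (2 * p ^ 2 - 2) * f =
      C (-(a ^ 2)⁻¹) * thirdSum p M k₂ k₃ k₄ := by
    rw [← e, ← mul_assoc, ← mul_assoc, ← C_mul]
    congr 3
    rw [pow_add]
    field_simp
  have h1 : (C ((a ^ 2)⁻¹) * C (a ^ 2) : MvPolynomial (Fin 3) K) = 1 := by
    rw [← C_mul, inv_mul_cancel₀ (pow_ne_zero _ ha), C_1]
  have h3 : (C (b ^ p / a ^ 2) : MvPolynomial (Fin 3) K) = C ((a ^ 2)⁻¹) * C (b ^ p) := by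
    rw [← C_mul]; congr 1; ring
  rw [hE, tatDiff_startSet h2 ha hb, ← hadef, ← hbdef]
  simp only [powProd_expo]
  rw [thirdSum, ← hadef, ← hbdef, h3, C_neg, C_mul (a := (a ^ 2)⁻¹) (a' := k₄), C_mul, C_mul, C_mul, C_mul, pow_zero, mul_one,
    pow_one]
  generalize (X 2 : MvPolynomial (Fin 3) K) ^ (p ^ 2 - 2 * p) = x₁
  generalize (X 2 : MvPolynomial (Fin 3) K) ^ (p ^ 2) = x₂
  generalize (X 2 : MvPolynomial (Fin 3) K) ^ (2 * p ^ 2 - 2 * p) = x₃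
  generalize (X 2 : MvPolynomial (Fin 3) K) ^ (2 * p ^ 2 - p) = x₄
  generalize f₁ p M ^ p = y₁
  generalize f₁ p M ^ (p + 1) = y₂
  generalize f₁ p M ^ (p + 2) = y₅
  generalize f₁ p M ^ (p - 1) = y₃
  generalize f₁ p M ^ ((p - 3) / 2) = y₄
  generalize f₂ p M ^ ((p + 1) / 2) = z₄
  linear_combination (- f₂ p M ^ p) * h1

/-- The subduction of the first tête-à-tête to a multiple of `f`. -/
theorem exists_subduction_third (h2 : 2 < p)
    (ha : gam p M ![1, 2, 3, 4] ≠ 0) (hb : gam p M ![1, 2, 3, 5] ≠ 0) {k₂ k₃ k₄ : K}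
    {f : MvPolynomial (Fin 3) K} (hf : grevLex.degree f = Finsupp.single 1 (p ^ 3 + 2))
    (e : C (-(gam p M ![1, 2, 3, 4] ^ (2 * p + 2) / gam p M ![1, 2, 3, 5])) *
        X 2 ^ (2 * p ^ 2 - 2) * f = thirdSum p M k₂ k₃ k₄) :
    ∃ q, Subduction (startSet p M)
      (tatDiff (startSet p M) (Finsupp.single 2 p) (Finsupp.single 1 (p + 2))) q
      (C (gam p M ![1, 2, 3, 4] ^ (2 * p) / gam p M ![1, 2, 3, 5]) *
        X 2 ^ (2 * p ^ 2 - 2) * f) := by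
  obtain ⟨h0, -⟩ := startSet_spec h2 ha hb
  obtain ⟨c₁, c₂, c₃, c₄, et⟩ := tatDiff_eq_of_third h2 ha hb e
  rw [et]
  have hodd : Odd p := (Fact.out : p.Prime).odd_of_ne_two (by omega)
  obtain ⟨k, hk⟩ : ∃ k, p = 2 * k + 3 := by
    obtain ⟨r, hr⟩ := hodd
    exact ⟨r - 1, by omega⟩
  have k1 : (p - 3) / 2 = k := by omega
  have k2 : (p + 1) / 2 = k + 2 := by omega
  have s1 : p ^ 2 - 2 * p = (2 * k + 3) * (2 * k + 1) := by
    rw [hk]; apply Nat.sub_eq_of_eq_add; ring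
  have s2 : 2 * p ^ 2 - 2 * p = (2 * k + 3) * (4 * k + 4) := by
    rw [hk]; apply Nat.sub_eq_of_eq_add; ring
  have s3 : 2 * p ^ 2 - p = (2 * k + 3) * (4 * k + 5) := by
    rw [hk]; apply Nat.sub_eq_of_eq_add; ring
  have s4 : p - 1 = 2 * k + 2 := by omega
  have s5 : 2 * p ^ 2 - 2 = (2 * k + 3) * (4 * k + 5) + (2 * k + 1) := by
    rw [hk]; apply Nat.sub_eq_of_eq_add; ring
  clear et e
  -- All terms have the same total degree and are free of z, so the one with more factors x is
  -- smaller; each inequality of the chain reduces to comparing exponents of x.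
  have lt {i j k i' j' k' : ℕ}
      (h : i + (p ^ 2 * j + (p ^ 2 + 2 * p) * k) = i' + (p ^ 2 * j' + (p ^ 2 + 2 * p) * k'))
      (h' : i' < i) : grevLex.toSyn (grevLex.degree (powProd (startSet p M) (expo i j k))) <
      grevLex.toSyn (grevLex.degree (powProd (startSet p M) (expo i' j' k'))) := by
    obtain ⟨a0, a1, a2⟩ := degree_powProd_expo (M := M) h2 ha hb i j k
    obtain ⟨b0, b1, b2⟩ := degree_powProd_expo (M := M) h2 ha hb i' j' k'
    rw [grevLex_lt_iff, a0, a1, a2, b0, b1, b2]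
    exact Or.inr ⟨by omega, Or.inl h'⟩
  refine exists_subduction_of_chain h0 (lt ?_ ?_) (lt ?_ ?_) (lt ?_ ?_) ?_
  · rw [s1, hk]; ring
  · rw [s1, hk]; nlinarith
  · rw [s2, s4, hk]; ring
  · rw [s2, hk]; nlinarith
  · rw [s2, s3, s4, k1, k2, hk]; ring
  · rw [s2, s3]; nlinarith
  · obtain ⟨a0, a1, a2⟩ := degree_powProd_expo (M := M) h2 ha hb (2 * p ^ 2 - p) ((p - 3) / 2)
      ((p + 1) / 2)
    rw [mul_assoc]
    refine (degree_C_mul_le _ _).trans_lt ?_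
    have hf0 : f ≠ 0 := by
      rintro rfl
      rw [grevLex.degree_zero] at hf
      have := congrArg (· 1) hf
      simp at this
    rw [grevLex.degree_mul (pow_ne_zero _ (X_ne_zero _)) hf0, grevLex.degree_pow,
        grevLex.degree_X, hf, grevLex_lt_iff, a0, a1, a2]
    simp only [Finsupp.add_apply, Finsupp.smul_apply, Finsupp.single_apply]
    simp only [Fin.isValue, Fin.reduceEq, if_true, if_false, smul_eq_mul, mul_zero, mul_one,
      zero_add, add_zero]
    rw [s5, s3, k1, k2, hk]
    exact Or.inr ⟨by ring, Or.inl (by omega)⟩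

end Third

/-! ### Properties common to all admissible choices of f₃ -/

section Third

variable {K : Type*} [Field K]

theorem isHomogeneous_of_C_mul_X_pow_mul {f : MvPolynomial (Fin 3) K} {c : K} (hc : c ≠ 0)
    {k N : ℕ} (hf : f ≠ 0) (h : (C c * X 2 ^ k * f).IsHomogeneous N) :
    ∃ n, n + k = N ∧ f.IsHomogeneous n := by
  have key : ∀ d : Fin 3 →₀ ℕ, coeff d f ≠ 0 → d 0 + d 1 + d 2 + k = N := by
    intro d hd
    have h1 : coeff (Finsupp.single 2 k + d) (C c * X 2 ^ k * f) = c * coeff d f := by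
      rw [C_mul_X_pow_eq_monomial, coeff_monomial_mul]
    have := isHomogeneous_sum_eq h (d := Finsupp.single 2 k + d)
      (by rw [h1]; exact mul_ne_zero hc hd)
    simp at this
    omega
  obtain ⟨d, hd⟩ := ne_zero_iff.1 hf
  refine ⟨d 0 + d 1 + d 2, key d hd, fun e he => ?_⟩
  have h1 := key d hd
  have h2 := key e he
  rw [show Finsupp.weight (1 : Fin 3 → ℕ) e = Finsupp.degree e from
    (DFunLike.congr_fun Finsupp.degree_eq_weight_one e).symm, degree_fin_three]
  omega

theorem degree_C_mul_X_pow_mul {m : MonomialOrder (Fin 3)} {f : MvPolynomial (Fin 3) K} {c : K}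
    (hc : c ≠ 0) (hf : f ≠ 0) (k : ℕ) :
    m.degree (C c * X 2 ^ k * f) = Finsupp.single 2 k + m.degree f := by
  rw [mul_assoc, degree_C_mul _ hc, m.degree_mul (pow_ne_zero _ (X_ne_zero _)) hf,
    m.degree_pow, m.degree_X, Finsupp.smul_single_one]

variable {p : ℕ} {M : Matrix (Fin 2) (Fin 4) K} [Algebra (ZMod p) K]

theorem mem_invariants_of_C_mul_X_pow_mul {f : MvPolynomial (Fin 3) K} {c : K} (hc : c ≠ 0)
    {k : ℕ} (h : C c * X 2 ^ k * f ∈ invariants p M) : f ∈ invariants p M := by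
  intro a
  have := h a
  rw [map_mul, map_mul, map_pow, act_x, act_C] at this
  exact mul_left_cancel₀ (mul_ne_zero (by simpa using hc) (pow_ne_zero _ (X_ne_zero _))) this

theorem aeval_mem_invariants {n : ℕ} {h : Fin n → MvPolynomial (Fin 3) K}
    (hh : ∀ j, h j ∈ invariants p M) (q : MvPolynomial (Fin n) K) :
    aeval h q ∈ invariants p M := by
  have : aeval h q ∈ Algebra.adjoin K (Set.range h) := by
    rw [Algebra.adjoin_range_eq_range_aeval]
    exact ⟨q, rfl⟩
  refine Algebra.adjoin_le ?_ this
  rintro _ ⟨j, rfl⟩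
  exact hh j

variable [Fact p.Prime] [CharP K p]

theorem startSet_mem (h2 : 2 < p)
    (ha : gam p M ![1, 2, 3, 4] ≠ 0) (hb : gam p M ![1, 2, 3, 5] ≠ 0) (j : Fin 4) :
    startSet p M j ∈ invariants p M := by
  fin_cases j
  exacts [X_mem, f₁_mem ha hb h2, f₂_mem ha hb h2, orbitNorm_mem ha h2]

/-- A monomial whose `y`-exponent is `p³ + 2` is not a product of lead monomials. -/
theorem degree_powProd_startSet_ne (h2 : 2 < p)
    (ha : gam p M ![1, 2, 3, 4] ≠ 0) (hb : gam p M ![1, 2, 3, 5] ≠ 0) {d : Fin 3 →₀ ℕ}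
    (hd : d 1 = p ^ 3 + 2) (I : Fin 4 →₀ ℕ) :
    grevLex.degree (powProd (startSet p M) I) ≠ d := by
  rintro rfl
  have h1 := (degree_powProd_startSet h2 ha hb I).2.1
  rw [hd] at h1
  have h3 : p ∣ p ^ 3 + 2 := by
    rw [h1]
    exact ⟨p * I 1 + (p + 2) * I 2, by ring⟩
  have h4 : p ∣ 2 := (Nat.dvd_add_right (dvd_pow_self p (by norm_num))).1 h3
  exact absurd (Nat.le_of_dvd (by norm_num) h4) (by omega)

/-- The remainder is irreducible because its y-exponent p³ + 2 is not divisible by p, whereas the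
y-exponents of all products of the starting set are. -/
theorem isThirdInvariant_of_eq (h2 : 2 < p)
    (ha : gam p M ![1, 2, 3, 4] ≠ 0) (hb : gam p M ![1, 2, 3, 5] ≠ 0)
    (hc : gam p M ![1, 3, 5, 7] ≠ 0) {k₂ k₃ k₄ : K} {f s : MvPolynomial (Fin 3) K}
    (hf : f.IsHomogeneous (p ^ 3 + 2))
    (hs : f = C (gam p M ![1, 3, 5, 7]) * X 1 ^ (p ^ 3 + 2) + X 2 * s)
    (e : C (-(gam p M ![1, 2, 3, 4] ^ (2 * p + 2) / gam p M ![1, 2, 3, 5])) *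
        X 2 ^ (2 * p ^ 2 - 2) * f = thirdSum p M k₂ k₃ k₄) : IsThirdInvariant p M f := by
  obtain ⟨hd, hl⟩ := degree_of_sub_mem_X hc hf hs
  obtain ⟨q, hq⟩ := exists_subduction_third h2 ha hb hd e
  have hc' := div_ne_zero (pow_ne_zero (2 * p) ha) hb
  have hf0 : f ≠ 0 := grevLex.leadingCoeff_ne_zero_iff.1 (by rw [hl]; exact hc)
  refine ⟨isTat_startSet h2 ha hb, ⟨q, _, hq, ?_, fun I => ?_, _, _, rfl⟩,
    not_X_dvd_of_lead hc hs, hl⟩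
  · exact mul_ne_zero (mul_ne_zero (by simpa using hc') (pow_ne_zero _ (X_ne_zero _))) hf0
  · apply degree_powProd_startSet_ne h2 ha hb
    rw [degree_C_mul_X_pow_mul hc' hf0, hd]
    simp

theorem isHomogeneous_tatDiff_startSet (h2 : 2 < p)
    (ha : gam p M ![1, 2, 3, 4] ≠ 0) (hb : gam p M ![1, 2, 3, 5] ≠ 0) :
    (tatDiff (startSet p M) (Finsupp.single 2 p) (Finsupp.single 1 (p + 2))).IsHomogeneous
      (p ^ 3 + 2 * p ^ 2) := by
  obtain ⟨-, hh, -⟩ := startSet_spec h2 ha hb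
  rw [tatDiff, powProd_single, powProd_single]
  refine IsHomogeneous.sub ?_ (IsHomogeneous.C_mul ?_ _)
  · have := (hh 2).pow p
    refine (congrArg (IsHomogeneous _) ?_).mp this
    simp only [Matrix.cons_val]
    ring
  · have := (hh 1).pow (p + 2)
    refine (congrArg (IsHomogeneous _) ?_).mp this
    simp only [Matrix.cons_val]
    ring

/-- The bound y^(p³+2p²) = LM(f₂^p) leaves no room for f₂^p itself, nor for N(z), whose degree p⁴ is
already larger. -/
theorem exponents_of_startSet_lt (h2 : 2 < p)
    (ha : gam p M ![1, 2, 3, 4] ≠ 0) (hb : gam p M ![1, 2, 3, 5] ≠ 0) {I : Fin 4 →₀ ℕ}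
    (hI : grevLex.toSyn (grevLex.degree (powProd (startSet p M) I)) <
      grevLex.toSyn (grevLex.degree (powProd (startSet p M) (Finsupp.single 2 p)))) :
    I 2 < p ∧ I 3 = 0 ∧ p ^ 2 * I 1 + (p ^ 2 + 2 * p) * I 2 ≤ p ^ 3 + 2 * p ^ 2 := by
  obtain ⟨a0, a1, a2⟩ := degree_powProd_startSet h2 ha hb I
  obtain ⟨b0, b1, b2⟩ := degree_powProd_startSet h2 ha hb (Finsupp.single 2 p)
  rw [grevLex_lt_iff, a0, a1, a2, b0, b1, b2, Finsupp.single_eq_same,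
    Finsupp.single_eq_of_ne (by decide), Finsupp.single_eq_of_ne (by decide),
    Finsupp.single_eq_of_ne (by decide)] at hI
  have e4 : p ^ 4 = p * p ^ 3 := by ring
  have e3 : p ^ 3 = p * p ^ 2 := by ring
  have h3 : 3 * p ^ 2 ≤ p ^ 3 := by rw [e3]; exact Nat.mul_le_mul_right _ h2
  have h4 : 3 * p ^ 3 ≤ p ^ 4 := by rw [e4]; exact Nat.mul_le_mul_right _ h2
  have h5 : 0 < p ^ 2 := by positivity
  have e5 : (p ^ 2 + 2 * p) * p = p ^ 3 + 2 * p ^ 2 := by ring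
  refine ⟨?_, ?_, ?_⟩
  · by_contra hlt
    have := Nat.mul_le_mul_left (p ^ 2 + 2 * p) (not_lt.1 hlt)
    omega
  · by_contra h0
    have := Nat.mul_le_mul_left (p ^ 4) (Nat.one_le_iff_ne_zero.2 h0)
    omega
  · omega

/-- Below the tête-à-tête the f₂-exponent is less than p, so `lead_exponent_injective` applies with
no factor f₃. -/
theorem startSet_injOn (h2 : 2 < p)
    (ha : gam p M ![1, 2, 3, 4] ≠ 0) (hb : gam p M ![1, 2, 3, 5] ≠ 0) :
    Set.InjOn (fun I => grevLex.degree (powProd (startSet p M) I))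
      {I | grevLex.toSyn (grevLex.degree (powProd (startSet p M) I)) <
        grevLex.toSyn (grevLex.degree (powProd (startSet p M) (Finsupp.single 2 p)))} := by
  intro I hI J hJ hIJ
  obtain ⟨a0, a1, a2⟩ := degree_powProd_startSet h2 ha hb I
  obtain ⟨b0, b1, b2⟩ := degree_powProd_startSet h2 ha hb J
  obtain ⟨hI2, hI3, -⟩ := exponents_of_startSet_lt h2 ha hb hI
  obtain ⟨hJ2, hJ3, -⟩ := exponents_of_startSet_lt h2 ha hb hJ
  have hIJ' : grevLex.degree (powProd (startSet p M) I) =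
    grevLex.degree (powProd (startSet p M) J) := hIJ
  rw [hIJ'] at a0 a1 a2
  obtain ⟨c1, c2, -⟩ := lead_exponent_injective (a := I 1) (a' := J 1) (c := 0) (c' := 0) Fact.out
    h2 hI2 hJ2 (by omega) (by omega) (by simpa using a1.symm.trans b1)
  have c0 := a2.symm.trans b2
  ext j
  fin_cases j
  exacts [c0, c1, c2, hI3.trans hJ3.symm]

theorem tatDiff_startSet_lt (h2 : 2 < p)
    (ha : gam p M ![1, 2, 3, 4] ≠ 0) (hb : gam p M ![1, 2, 3, 5] ≠ 0)
    {q : MvPolynomial (Fin 4) K} {r : MvPolynomial (Fin 3) K}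
    (hq : Subduction (startSet p M)
      (tatDiff (startSet p M) (Finsupp.single 2 p) (Finsupp.single 1 (p + 2))) q r) :
    ∀ J ∈ q.support, grevLex.toSyn (grevLex.degree (powProd (startSet p M) J)) <
      grevLex.toSyn (grevLex.degree (powProd (startSet p M) (Finsupp.single 2 p))) := by
  obtain ⟨h0, -⟩ := startSet_spec h2 ha hb
  rcases tatDiff_degree_lt h0 (isTat_startSet h2 ha hb) with h | h
  · rw [h] at hq
    rw [hq.of_zero]
    simp
  · exact fun J hJ => (hq.degree_le.1 J hJ).trans_lt h

/-- The properties of every third invariant. -/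
theorem IsThirdInvariant.spec (h2 : 2 < p)
    (ha : gam p M ![1, 2, 3, 4] ≠ 0) (hb : gam p M ![1, 2, 3, 5] ≠ 0)
    (hc : gam p M ![1, 3, 5, 7] ≠ 0) {f : MvPolynomial (Fin 3) K}
    (H : IsThirdInvariant p M f) :
    grevLex.degree f = Finsupp.single 1 (p ^ 3 + 2) ∧ f.IsHomogeneous (p ^ 3 + 2) ∧
    f ∈ invariants p M ∧
    ∃ (c : K) (q : MvPolynomial (Fin 4) K),
      tatDiff (startSet p M) (Finsupp.single 2 p) (Finsupp.single 1 (p + 2)) =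
        aeval (startSet p M) q + C c * X 2 ^ (2 * p ^ 2 - 2) * f ∧
      ∀ J ∈ q.support, grevLex.toSyn (grevLex.degree (powProd (startSet p M) J)) <
        grevLex.toSyn (grevLex.degree (powProd (startSet p M) (Finsupp.single 2 p))) := by
  classical
  obtain ⟨-, ⟨q, r, hq, hr0, hr, c, k, er⟩, hX, hl⟩ := H
  obtain ⟨h0, hh, -⟩ := startSet_spec h2 ha hb
  obtain ⟨k₂, k₃, k₄, f', s, hf', hs, e', -⟩ := exists_third_form h2 ha hb
  obtain ⟨hd', hl'⟩ := degree_of_sub_mem_X hc hf' hs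
  obtain ⟨q', hq'⟩ := exists_subduction_third h2 ha hb hd' e'
  have hc' := div_ne_zero (pow_ne_zero (2 * p) ha) hb
  have hf0' : f' ≠ 0 := grevLex.leadingCoeff_ne_zero_iff.1 (by rw [hl']; exact hc)
  have hf0 : f ≠ 0 := by rintro rfl; exact hX (dvd_zero _)
  set r' := C (gam p M ![1, 2, 3, 4] ^ (2 * p) / gam p M ![1, 2, 3, 5]) *
    X 2 ^ (2 * p ^ 2 - 2) * f' with hr'
  have dr' : grevLex.degree r' = Finsupp.single 2 (2 * p ^ 2 - 2) +
      Finsupp.single 1 (p ^ 3 + 2) := by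
    rw [hr', degree_C_mul_X_pow_mul hc' hf0', hd']
  have irr : ∀ I, grevLex.degree (powProd (startSet p M) I) ≠ grevLex.degree r' := fun I =>
    degree_powProd_startSet_ne h2 ha hb (by rw [dr']; simp) I
  have hc0 : c ≠ 0 := by
    rintro rfl
    rw [C_0, zero_mul, zero_mul] at er
    exact hr0 er
  -- The comparison of the given remainder `r` with the explicit remainder `r'`.
  have dr : grevLex.degree r = grevLex.degree r' := by
    have e1 : r - r' = aeval (startSet p M) (q' - q) := by
      have := hq.eq_add.symm.trans hq'.eq_add
      rw [map_sub]
      linear_combination this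
    by_cases h00 : q' - q = 0
    · rw [h00, map_zero, sub_eq_zero] at e1
      rw [e1]
    -- The difference of the remainders is a combination of products below the tête-à-tête, so its
    -- lead monomial is reducible. If the two lead monomials differed, the larger would equal it,
    -- although neither remainder can be reduced.
    obtain ⟨I, -, -, hI, -⟩ := exists_degree_aeval_eq grevLex h0 h00
      ((startSet_injOn h2 ha hb).mono fun J hJ => by
        rcases Finset.mem_union.1 (support_sub _ _ _ hJ) with h | h
        exacts [tatDiff_startSet_lt h2 ha hb hq' J h, tatDiff_startSet_lt h2 ha hb hq J h])
    rw [← e1] at hI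
    by_contra hne
    rcases lt_or_gt_of_ne (fun h => hne (grevLex.toSyn.injective h)) with hlt | hlt
    · rw [← neg_sub, grevLex.degree_neg, grevLex.degree_sub_of_lt hlt] at hI
      exact irr I hI.symm
    · rw [grevLex.degree_sub_of_lt hlt] at hI
      exact hr I hI.symm
  have hrh := hq.isHomogeneous hh (isHomogeneous_tatDiff_startSet h2 ha hb)
  rw [er] at hrh
  obtain ⟨n, hn, hfn⟩ := isHomogeneous_of_C_mul_X_pow_mul hc0 hf0 hrh
  rw [er, degree_C_mul_X_pow_mul hc0 hf0, dr'] at dr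
  -- As f is a form not divisible by x, comparing the x-exponents of the equal lead monomials fixes
  -- the power of x that was divided out.
  have d2 : (grevLex.degree f) 2 = 0 := by
    by_contra h
    exact hX (X_dvd_of_degree hfn h)
  have g2 := DFunLike.congr_fun dr 2
  simp only [Finsupp.add_apply, Finsupp.single_eq_same, d2, add_zero,
    Finsupp.single_eq_of_ne (show (2 : Fin 3) ≠ 1 by decide)] at g2
  subst g2
  have hp2 : 2 ≤ 2 * p ^ 2 := by nlinarith
  obtain rfl : n = p ^ 3 + 2 := by omega
  refine ⟨add_left_cancel dr, hfn, ?_, c, q, ?_, tatDiff_startSet_lt h2 ha hb hq⟩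
  · refine mem_invariants_of_C_mul_X_pow_mul hc0 (k := 2 * p ^ 2 - 2) ?_
    have e2 : C c * X 2 ^ (2 * p ^ 2 - 2) * f =
        tatDiff (startSet p M) (Finsupp.single 2 p) (Finsupp.single 1 (p + 2)) -
          aeval (startSet p M) q := by
      rw [← er]
      linear_combination - hq.eq_add
    rw [e2, tatDiff_startSet h2 ha hb]
    have hC : ∀ t : K, C t ∈ invariants p M := fun t => (invariants p M).algebraMap_mem t
    exact sub_mem (sub_mem (pow_mem (f₂_mem ha hb h2) _) (mul_mem (hC _)
      (pow_mem (f₁_mem ha hb h2) _))) (aeval_mem_invariants (startSet_mem h2 ha hb) q)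
  · rw [← er]
    exact hq.eq_add

end Third

/-! ### The first relation -/

section Relation

variable {K : Type*} [Field K] {p : ℕ} {M : Matrix (Fin 2) (Fin 4) K} [Algebra (ZMod p) K]
  [Fact p.Prime] [CharP K p] {f : MvPolynomial (Fin 3) K}

theorem hasLeads_gens (h2 : 2 < p)
    (ha : gam p M ![1, 2, 3, 4] ≠ 0) (hb : gam p M ![1, 2, 3, 5] ≠ 0)
    (hf : grevLex.degree f = Finsupp.single 1 (p ^ 3 + 2)) : HasLeads p (gens p M f) := by
  obtain ⟨h0, -, d1, -, d2, -, d3⟩ := startSet_spec h2 ha hb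
  refine ⟨fun j => ?_, rfl, d1, d2, hf, d3⟩
  fin_cases j
  · exact h0 0
  · exact h0 1
  · exact h0 2
  · change f ≠ 0
    rintro rfl
    rw [grevLex.degree_zero] at hf
    simpa using congrArg (· 1) hf
  · exact h0 3

theorem isHomogeneous_gens (h2 : 2 < p)
    (ha : gam p M ![1, 2, 3, 4] ≠ 0) (hb : gam p M ![1, 2, 3, 5] ≠ 0)
    (hf : f.IsHomogeneous (p ^ 3 + 2)) (j : Fin 5) :
    (gens p M f j).IsHomogeneous (![1, p ^ 2, p ^ 2 + 2 * p, p ^ 3 + 2, p ^ 4] j) := by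
  obtain ⟨-, hh, -⟩ := startSet_spec h2 ha hb
  fin_cases j
  exacts [hh 0, hh 1, hh 2, hf, hh 3]

theorem gens_mem (h2 : 2 < p)
    (ha : gam p M ![1, 2, 3, 4] ≠ 0) (hb : gam p M ![1, 2, 3, 5] ≠ 0)
    (hf : f ∈ invariants p M) (j : Fin 5) : gens p M f j ∈ invariants p M := by
  have hh := startSet_mem h2 ha hb
  fin_cases j
  exacts [hh 0, hh 1, hh 2, hf, hh 3]

/-- The position of the elements of the starting set among the generators. -/
def startIndex : Fin 4 → Fin 5 := ![0, 1, 2, 4]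

theorem startIndex_injective : Function.Injective startIndex := by
  unfold startIndex
  decide

omit [CharP K p] in
theorem gens_startIndex : gens p M f ∘ startIndex = startSet p M := by
  ext1 j
  fin_cases j <;> rfl

omit [CharP K p] in
theorem aeval_gens_rename (q : MvPolynomial (Fin 4) K) :
    aeval (gens p M f) (rename startIndex q) = aeval (startSet p M) q := by
  rw [aeval_rename, gens_startIndex]

omit [CharP K p] in
theorem powProd_gens_mapDomain (J : Fin 4 →₀ ℕ) :
    powProd (gens p M f) (J.mapDomain startIndex) = powProd (startSet p M) J := by
  have h1 := aeval_gens_rename (p := p) (M := M) (f := f) (monomial J 1)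
  rwa [rename_monomial, aeval_monomial_eq_powProd, aeval_monomial_eq_powProd, C_1, one_mul,
    one_mul] at h1

/-- The incomplete subduction becomes a relation once its remainder is written as c x^(2p²-2) f₃.
All terms other than f₂^p and f₁^(p+2) have smaller lead monomials. -/
theorem exists_first_relation (h2 : 2 < p)
    (ha : gam p M ![1, 2, 3, 4] ≠ 0) (hb : gam p M ![1, 2, 3, 5] ≠ 0)
    (hc : gam p M ![1, 3, 5, 7] ≠ 0) (H : IsThirdInvariant p M f) :
    ∃ ρ, IsMonicRel p (gens p M f) (Finsupp.single 2 p) ρ := by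
  classical
  obtain ⟨hd, -, -, c, q, e, hq⟩ := H.spec h2 ha hb hc
  have hL := hasLeads_gens h2 ha hb hd
  have hs2 : powProd (gens p M f) (Finsupp.single 2 p) =
      powProd (startSet p M) (Finsupp.single 2 p) := by
    rw [powProd_single, powProd_single]; rfl
  have hs1 : powProd (gens p M f) (Finsupp.single 1 (p + 2)) =
      powProd (startSet p M) (Finsupp.single 1 (p + 2)) := by
    rw [powProd_single, powProd_single]; rfl
  have hp0 : 0 < p := by omega
  refine ⟨_, isMonicRel_of_lt (q := -(monomial (Finsupp.single 1 (p + 2))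
    (tatScalar (startSet p M) (Finsupp.single 2 p) (Finsupp.single 1 (p + 2))) +
    rename startIndex q + monomial (Finsupp.single 0 (2 * p ^ 2 - 2) + Finsupp.single 3 1) c))
    ?_ ?_ rfl ?_⟩
  · rw [map_add, map_neg, map_add, map_add, aeval_gens_rename]
    simp only [aeval_monomial_eq_powProd, powProd_add, hs1, hs2]
    rw [powProd_single 0, powProd_single 3, C_1, one_mul, pow_one]
    change _ + -(_ + _ + C c * (X 2 ^ _ * f)) = 0
    rw [tatDiff] at e
    linear_combination e
  · simpa using hp0.ne'
  · intro J hJ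
    rw [hL.tOrder_lt_iff]
    rw [support_neg] at hJ
    rcases Finset.mem_union.1 (support_add hJ) with hJ | hJ
    · rcases Finset.mem_union.1 (support_add hJ) with hJ | hJ
      · obtain rfl := Finset.mem_singleton.1 (support_monomial_subset hJ)
        right
        rw [hs1, hs2]
        refine ⟨(isTat_startSet h2 ha hb).symm, Or.inr ?_⟩
        simpa using hp0
      · left
        rw [support_rename_of_injective startIndex_injective] at hJ
        obtain ⟨J', hJ', rfl⟩ := Finset.mem_image.1 hJ
        rw [powProd_gens_mapDomain, hs2]
        exact hq J' hJ'
    · obtain rfl := Finset.mem_singleton.1 (support_monomial_subset hJ)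
      -- The term x^(2p²-2) f₃ has the degree of f₂^p but a positive power of x, so it is smaller.
      left
      obtain ⟨a0, a1, a2⟩ := hL.degree_powProd
        (Finsupp.single 0 (2 * p ^ 2 - 2) + Finsupp.single 3 1)
      obtain ⟨b0, b1, b2⟩ := hL.degree_powProd (Finsupp.single 2 p)
      rw [grevLex_lt_iff, a0, a1, a2, b0, b1, b2]
      have hp2 : 2 < 2 * p ^ 2 := by nlinarith
      refine Or.inr ⟨?_, Or.inl ?_⟩
      · simp
        ring_nf
        ring_nf at hp2
        omega
      · simpa using hp2

end Relation

/-! ### Invariants up to powers of `x` -/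

section Reduction

variable {C B : Type*} [CommRing C] [CommRing B] [Algebra C B] {p q : ℕ} {y D : B}

/-- `t` is a combination of `D^p, y^p, D, y, 1` with coefficients in `C`. -/
def Reduces (C : Type*) {B : Type*} [CommRing C] [CommRing B] [Algebra C B] (p : ℕ)
    (y D t : B) : Prop :=
  ∃ α β γ δ ε : C, t = α • D ^ p + β • y ^ p + γ • D + δ • y + ε • 1

/-- Give y weight 1 and D weight 2. Replacing y^q or D^q, of weight at least q, by terms of weight
at most 2p < q lowers the weight, so the rewriting terminates. -/
theorem pow_mul_pow_mem_span (hp : 0 < p) (hpq : 2 * p < q)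
    (hy : Reduces C p y D (y ^ q))
    (hD : Reduces C p y D (D ^ q)) (i j : ℕ) :
    y ^ i * D ^ j ∈ Submodule.span C
      (Set.range fun k : Fin q × Fin q => y ^ (k.1 : ℕ) * D ^ (k.2 : ℕ)) := by
  obtain ⟨N, hN⟩ : ∃ N, i + 2 * j = N := ⟨_, rfl⟩
  induction N using Nat.strong_induction_on generalizing i j with
  | _ N ih =>
    have key : ∀ {α β γ δ ε : C} {i' j' : ℕ}, i' + 2 * j' + 2 * p < N →
        y ^ i' * D ^ j' * (α • D ^ p + β • y ^ p + γ • D + δ • y + ε • 1) ∈ Submodule.span C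
          (Set.range fun k : Fin q × Fin q => y ^ (k.1 : ℕ) * D ^ (k.2 : ℕ)) := by
      intro α β γ δ ε i' j' hlt
      have e : y ^ i' * D ^ j' * (α • D ^ p + β • y ^ p + γ • D + δ • y + ε • 1) =
          α • (y ^ i' * D ^ (j' + p)) + β • (y ^ (i' + p) * D ^ j') +
          γ • (y ^ i' * D ^ (j' + 1)) + δ • (y ^ (i' + 1) * D ^ j') + ε • (y ^ i' * D ^ j') := by
        simp only [Algebra.smul_def]
        ring
      rw [e]
      refine add_mem (add_mem (add_mem (add_mem ?_ ?_) ?_) ?_) ?_ <;>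
        refine Submodule.smul_mem _ _ (ih _ ?_ _ _ rfl) <;> omega
    by_cases hi : q ≤ i
    · obtain ⟨α, β, γ, δ, ε, e⟩ := hy
      obtain ⟨i', rfl⟩ := Nat.exists_eq_add_of_le' hi
      rw [pow_add, mul_right_comm, e]
      exact key (by omega)
    by_cases hj : q ≤ j
    · obtain ⟨α, β, γ, δ, ε, e⟩ := hD
      obtain ⟨j', rfl⟩ := Nat.exists_eq_add_of_le' hj
      rw [pow_add, ← mul_assoc, e]
      exact key (by omega)
    exact Submodule.subset_span ⟨(⟨i, not_le.1 hi⟩, ⟨j, not_le.1 hj⟩), rfl⟩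

theorem mem_span_of_mem_adjoin_pair (hp : 0 < p) (hpq : 2 * p < q)
    (hy : Reduces C p y D (y ^ q))
    (hD : Reduces C p y D (D ^ q))
    {f : B} (hf : f ∈ Algebra.adjoin C {y, D}) :
    f ∈ Submodule.span C
      (Set.range fun k : Fin q × Fin q => y ^ (k.1 : ℕ) * D ^ (k.2 : ℕ)) := by
  rw [← Subalgebra.mem_toSubmodule, Algebra.adjoin_eq_span] at hf
  refine Submodule.span_le.2 ?_ hf
  intro g hg
  obtain ⟨i, j, rfl⟩ := (Submonoid.mem_closure_pair _ _ _).1 hg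
  exact pow_mul_pow_mem_span hp hpq hy hD i j

theorem exists_sum_of_mem_adjoin_pair (hp : 0 < p) (hpq : 2 * p < q)
    (hy : Reduces C p y D (y ^ q))
    (hD : Reduces C p y D (D ^ q))
    {f : B} (hf : f ∈ Algebra.adjoin C {y, D}) :
    ∃ c : Fin q × Fin q → C, ∑ k, c k • (y ^ (k.1 : ℕ) * D ^ (k.2 : ℕ)) = f :=
  (Submodule.mem_span_range_iff_exists_fun _).1 (mem_span_of_mem_adjoin_pair hp hpq hy hD hf)

theorem exists_sum_of_mem_adjoin_pair_subalgebra {K : Type*} [Field K] [Algebra K B]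
    {A : Subalgebra K B} (hp : 0 < p) (hpq : 2 * p < q)
    (hy : Reduces A p y D (y ^ q)) (hD : Reduces A p y D (D ^ q))
    {f : B} (hf : f ∈ Algebra.adjoin A {y, D}) :
    ∃ c : Fin q × Fin q → B, (∀ k, c k ∈ A) ∧
      ∑ k, c k * (y ^ (k.1 : ℕ) * D ^ (k.2 : ℕ)) = f := by
  obtain ⟨c, hc⟩ := exists_sum_of_mem_adjoin_pair hp hpq hy hD hf
  exact ⟨fun k => c k, fun k => (c k).2, hc⟩

end Reduction

/-! ### Functions on a finite set that are separated by two coordinates -/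

section Functions

variable {F E : Type*} [Field F] [Fintype E] {U V : E → F}

/-- Lagrange interpolation: a subalgebra that separates points contains the indicator function of
every point. -/
theorem adjoin_pair_eq_top (h : ∀ a b, U a = U b → V a = V b → a = b) :
    Algebra.adjoin F {U, V} = ⊤ := by
  classical
  have hU : U ∈ Algebra.adjoin F {U, V} := Algebra.subset_adjoin (by simp)
  have hV : V ∈ Algebra.adjoin F {U, V} := Algebra.subset_adjoin (by simp)
  have hc : ∀ c : F, (fun _ => c : E → F) ∈ Algebra.adjoin F {U, V} := fun c =>
    (Algebra.adjoin F {U, V}).algebraMap_mem c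
  have sep : ∀ a b : E, ∃ g ∈ Algebra.adjoin F {U, V}, b ≠ a → g a = 1 ∧ g b = 0 := by
    intro a b
    by_cases hab : U a = U b
    · by_cases hab' : V a = V b
      · exact ⟨0, zero_mem _, fun hne => absurd (h a b hab hab').symm hne⟩
      · refine ⟨(V - fun _ => V b) * fun _ => (V a - V b)⁻¹,
          mul_mem (sub_mem hV (hc _)) (hc _), fun _ => ⟨?_, ?_⟩⟩
        · simp [mul_inv_cancel₀ (sub_ne_zero.2 hab')]
        · simp
    · refine ⟨(U - fun _ => U b) * fun _ => (U a - U b)⁻¹,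
        mul_mem (sub_mem hU (hc _)) (hc _), fun _ => ⟨?_, ?_⟩⟩
      · simp [mul_inv_cancel₀ (sub_ne_zero.2 hab)]
      · simp
  choose g hg hg' using sep
  have hs : ∀ a, (Pi.single a 1 : E → F) ∈ Algebra.adjoin F {U, V} := by
    intro a
    have : (Pi.single a 1 : E → F) = ∏ b ∈ Finset.univ.erase a, g a b := by
      ext b
      rw [Finset.prod_apply]
      by_cases hb : b = a
      · subst hb
        rw [Pi.single_eq_same, Finset.prod_eq_one]
        intro c hcc
        exact (hg' b c (Finset.ne_of_mem_erase hcc)).1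
      · rw [Pi.single_eq_of_ne hb, Finset.prod_eq_zero (i := b)]
        · simpa using hb
        · exact (hg' a b hb).2
    rw [this]
    exact prod_mem fun b _ => hg a b
  rw [eq_top_iff]
  intro f _
  have : f = ∑ a, f a • (Pi.single a 1 : E → F) := by
    ext b
    simp [Finset.sum_apply, Pi.single_apply]
  rw [this]
  exact sum_mem fun a _ => Subalgebra.smul_mem _ (hs a) _

/-- Functions on a set of `q²` points satisfying two equations of degree `q`. -/
theorem linearIndependent_pow_mul_pow {p q : ℕ} (hp : 0 < p) (hpq : 2 * p < q)
    (h : ∀ a b, U a = U b → V a = V b → a = b) (hE : Fintype.card E = q * q)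
    (hU : Reduces F p U V (U ^ q))
    (hV : Reduces F p U V (V ^ q)) :
    LinearIndependent F fun k : Fin q × Fin q => U ^ (k.1 : ℕ) * V ^ (k.2 : ℕ) := by
  -- The q² monomials span the q²-dimensional space of all functions, hence are independent.
  apply linearIndependent_of_top_le_span_of_card_eq_finrank
  · intro f _
    refine mem_span_of_mem_adjoin_pair hp hpq hU hV ?_
    rw [adjoin_pair_eq_top h]
    trivial
  · rw [Module.finrank_fintype_fun_eq_card, hE]
    simp

-- Applied below with g an invariant times a power of x, whose expansion at every group element has
-- the same value.
omit [Fintype E] in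
theorem coeff_eq_of_sum_smul_eq_const {ι : Type*} [Fintype ι] {v : ι → E → F}
    (hv : LinearIndependent F v) (o : ι) (ho : v o = 1) {d : ι → F} {g : F}
    (h : ∀ a, ∑ k, d k * v k a = g) : d o = g := by
  classical
  have := Fintype.linearIndependent_iff.1 hv (fun k => d k - if k = o then g else 0) ?_ o
  · simpa [sub_eq_zero] using this
  · ext a
    simp [sub_mul, Finset.sum_sub_distrib, h a, ho]

end Functions

/-! ### Generators of the invariants after inverting x -/

section Localization

variable {K : Type*} [Field K] {p : ℕ} {M : Matrix (Fin 2) (Fin 4) K} [Algebra (ZMod p) K]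
  [Fact p.Prime] [CharP K p]

omit [Algebra (ZMod p) K] in
theorem minorData_F₁_eq (ha : gam p M ![1, 2, 3, 4] ≠ 0) (hb : gam p M ![1, 2, 3, 5] ≠ 0) :
    (minorData p M ha hb).F₁ = algebraMap K _ (gam p M ![1, 2, 3, 4]) * fracU ^ p ^ 2 -
      algebraMap K _ (gam p M ![1, 2, 3, 5]) * (fracW - fracU ^ 2) ^ p +
      algebraMap K _ (gam p M ![1, 2, 4, 5]) * fracU ^ p -
      algebraMap K _ (gam p M ![1, 3, 4, 5]) * (fracW - fracU ^ 2) +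
      algebraMap K _ (gam p M ![2, 3, 4, 5]) * fracU := by
  rw [MinorData.F₁, MinorData.s, sub_pow_char, pow_right_comm _ 2 p]
  simp only [minorData]
  ring

omit [Algebra (ZMod p) K] in
theorem minorData_G_eq (ha : gam p M ![1, 2, 3, 4] ≠ 0) (hb : gam p M ![1, 2, 3, 5] ≠ 0) :
    (minorData p M ha hb).G =
      algebraMap K _ (gam p M ![1, 2, 3, 4]) * (fracW - fracU ^ 2) ^ p ^ 2 -
      algebraMap K _ (gam p M ![1, 2, 3, 6]) * (fracW - fracU ^ 2) ^ p +
      algebraMap K _ (gam p M ![1, 2, 4, 6]) * fracU ^ p -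
      algebraMap K _ (gam p M ![1, 3, 4, 6]) * (fracW - fracU ^ 2) +
      algebraMap K _ (gam p M ![2, 3, 4, 6]) * fracU := by
  rw [MinorData.G, MinorData.s', sub_pow_char (p := p), sub_pow_char_pow (p := p), pow_right_comm _ 2 p,
    pow_right_comm _ 2 (p ^ 2)]
  simp only [minorData]
  ring

/-- The values of u and v along the orbit satisfy equations of degree p² with constant lead
coefficients, since `F₁` and `G` take the same value at every group element. The group has p⁴
elements, which are separated by the two shifts. -/
theorem linearIndependent_shift (h2 : 2 < p)
    (ha : gam p M ![1, 2, 3, 4] ≠ 0) (hb : gam p M ![1, 2, 3, 5] ≠ 0) :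
    LinearIndependent (Frac K) fun k : Fin (p ^ 2) × Fin (p ^ 2) =>
      (fun a => fracU + algebraMap K (Frac K) (shift₁ M a) :
        Multiplicative (Fin 4 → ZMod p) → Frac K) ^ (k.1 : ℕ) *
      (fun a => fracW - fracU ^ 2 + algebraMap K (Frac K) (shift₂ M a)) ^ (k.2 : ℕ) := by
  have ha' : algebraMap K (Frac K) (gam p M ![1, 2, 3, 4]) ≠ 0 := by simpa using ha
  refine linearIndependent_pow_mul_pow (p := p) (by omega) (by nlinarith) ?_ ?_ ?_ ?_
  · intro a b h h'
    exact shift_injective ha ((algebraMap K (Frac K)).injective (add_left_cancel h))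
      ((algebraMap K (Frac K)).injective (add_left_cancel h'))
  · rw [Fintype.card_multiplicative, Fintype.card_fun, ZMod.card, Fintype.card_fin]
    ring
  · refine ⟨(algebraMap K (Frac K) (gam p M ![1, 2, 3, 4]))⁻¹ *
        algebraMap K _ (gam p M ![1, 2, 3, 5]),
      -(algebraMap K (Frac K) (gam p M ![1, 2, 3, 4]))⁻¹ * algebraMap K _ (gam p M ![1, 2, 4, 5]),
      (algebraMap K (Frac K) (gam p M ![1, 2, 3, 4]))⁻¹ * algebraMap K _ (gam p M ![1, 3, 4, 5]),
      -(algebraMap K (Frac K) (gam p M ![1, 2, 3, 4]))⁻¹ * algebraMap K _ (gam p M ![2, 3, 4, 5]),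
      (algebraMap K (Frac K) (gam p M ![1, 2, 3, 4]))⁻¹ * (minorData p M ha hb).F₁, ?_⟩
    ext a
    have h := actFrac_F₁ ha hb a
    conv_lhs at h => rw [minorData_F₁_eq]
    simp only [map_add, map_sub, map_mul, map_pow (actFrac p M a) fracU p,
      map_pow (actFrac p M a) fracU (p ^ 2), map_pow (actFrac p M a) _ p, actFrac_u,
      actFrac_algebraMap] at h
    rw [← map_sub, actFrac_w] at h
    simp only [Pi.add_apply, Pi.smul_apply, Pi.pow_apply, smul_eq_mul, Pi.one_apply, mul_one]
    field_simp
    linear_combination h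
  · refine ⟨(algebraMap K (Frac K) (gam p M ![1, 2, 3, 4]))⁻¹ *
        algebraMap K _ (gam p M ![1, 2, 3, 6]),
      -(algebraMap K (Frac K) (gam p M ![1, 2, 3, 4]))⁻¹ * algebraMap K _ (gam p M ![1, 2, 4, 6]),
      (algebraMap K (Frac K) (gam p M ![1, 2, 3, 4]))⁻¹ * algebraMap K _ (gam p M ![1, 3, 4, 6]),
      -(algebraMap K (Frac K) (gam p M ![1, 2, 3, 4]))⁻¹ * algebraMap K _ (gam p M ![2, 3, 4, 6]),
      (algebraMap K (Frac K) (gam p M ![1, 2, 3, 4]))⁻¹ * (minorData p M ha hb).G, ?_⟩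
    ext a
    have h := actFrac_G ha hb a
    conv_lhs at h => rw [minorData_G_eq]
    rw [map_add, map_sub, map_add, map_sub, map_mul, map_mul, map_mul, map_mul, map_mul, map_pow,
      map_pow, map_pow, actFrac_w, actFrac_u] at h
    simp only [actFrac_algebraMap] at h
    simp only [Pi.add_apply, Pi.smul_apply, Pi.pow_apply, smul_eq_mul, Pi.one_apply, mul_one]
    field_simp
    linear_combination h

/-- The polynomial `xz - y²`. -/
def discr : MvPolynomial (Fin 3) K := X 2 * X 0 - X 1 ^ 2

theorem toFrac_discr : toFrac (discr : MvPolynomial (Fin 3) K) =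
    toFrac (X 2) ^ 2 * (fracW - fracU ^ 2) := by
  rw [discr, map_sub, map_mul, map_pow, ← X_mul_fracU, ← X_mul_fracW]
  ring

/-- The subalgebra generated by `x, f₁, f_{12346}`. -/
def smallAlgebra (p : ℕ) (M : Matrix (Fin 2) (Fin 4) K) : Subalgebra K (MvPolynomial (Fin 3) K) :=
  Algebra.adjoin K {X 2, f₁ p M, fJ p M ![1, 2, 3, 4, 6]}

omit [Algebra (ZMod p) K] [Fact p.Prime] [CharP K p] in
theorem C_mul_X_pow_mem_smallAlgebra (c : K) (k : ℕ) :
    C c * X 2 ^ k ∈ smallAlgebra p M :=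
  mul_mem ((smallAlgebra p M).algebraMap_mem c) (pow_mem (Algebra.subset_adjoin (by simp)) _)

-- Solving the defining equation of f₁, or of f_{12346}, for its top term. The bound 2p ≤ N makes
-- all the powers of x in the coefficients nonnegative.
omit [Algebra (ZMod p) K] [CharP K p] in
theorem exists_reduction {N : ℕ} (hN : 2 * p ≤ N) {a b c d e : K} (ha : a ≠ 0)
    {t g : MvPolynomial (Fin 3) K} {τ : Frac K} (ht : toFrac t = toFrac (X 2) ^ N * τ)
    (hg : g ∈ smallAlgebra p M)
    (h : toFrac g = toFrac (X 2) ^ N * (algebraMap K _ a * τ -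
      algebraMap K _ b * (fracW - fracU ^ 2) ^ p + algebraMap K _ c * fracU ^ p -
      algebraMap K _ d * (fracW - fracU ^ 2) + algebraMap K _ e * fracU)) :
    Reduces (smallAlgebra p M) p (X 1) discr t := by
  have hC := C_mul_X_pow_mem_smallAlgebra (p := p) (M := M)
  have hp := (Fact.out : p.Prime).pos
  obtain ⟨k, hk⟩ := Nat.exists_eq_add_of_le hN
  obtain ⟨l, hl⟩ := Nat.exists_eq_add_of_le (show p ≤ N by omega)
  obtain ⟨m, hm⟩ := Nat.exists_eq_add_of_le (show 2 ≤ N by omega)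
  obtain ⟨n, hn⟩ := Nat.exists_eq_add_of_le (show 1 ≤ N by omega)
  refine ⟨⟨_, hC (a⁻¹ * b) k⟩, ⟨_, hC (-a⁻¹ * c) l⟩, ⟨_, hC (a⁻¹ * d) m⟩, ⟨_, hC (-a⁻¹ * e) n⟩,
    ⟨C a⁻¹ * g, mul_mem ((smallAlgebra p M).algebraMap_mem _) hg⟩, ?_⟩
  simp only [Subalgebra.smul_def, smul_eq_mul, mul_one]
  apply toFrac_injective
  have ha' : algebraMap K (Frac K) a ≠ 0 := by simpa using ha
  simp only [map_add, map_mul, map_pow, toFrac_discr, h, ht, ← X_mul_fracU]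
  simp only [toFrac, algebraMap_C, map_neg, map_inv₀]
  generalize algebraMap (MvPolynomial (Fin 3) K) (Frac K) (X 2) = x
  generalize (fracW : Frac K) - fracU ^ 2 = v
  generalize (fracU : Frac K) = u
  field_simp
  have e1 : x ^ k * x ^ (2 * p) = x ^ N := by rw [← pow_add, hk, add_comm]
  have e2 : x ^ l * x ^ p = x ^ N := by rw [← pow_add, hl, add_comm]
  have e3 : x ^ m * x ^ 2 = x ^ N := by rw [← pow_add, hm, add_comm]
  have e4 : x ^ n * x = x ^ N := by rw [← pow_succ, hn, add_comm]
  rw [mul_pow, mul_pow, ← pow_mul]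
  linear_combination (-(algebraMap K _ b * v ^ p)) * e1 + algebraMap K _ c * u ^ p * e2 -
    algebraMap K _ d * v * e3 + algebraMap K _ e * u * e4

omit [Algebra (ZMod p) K] in
theorem y_pow_reduction (h2 : 2 < p)
    (ha : gam p M ![1, 2, 3, 4] ≠ 0) (hb : gam p M ![1, 2, 3, 5] ≠ 0) :
    Reduces (smallAlgebra p M) p (X 1 : MvPolynomial (Fin 3) K) discr (X 1 ^ p ^ 2) := by
  refine exists_reduction (N := p ^ 2) (by nlinarith) ha (τ := fracU ^ p ^ 2) ?_
    (Algebra.subset_adjoin (by simp)) ((f₁_spec ha hb h2).2.1.trans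
      (congrArg _ (minorData_F₁_eq ha hb)))
  rw [map_pow, ← X_mul_fracU, mul_pow]

omit [Algebra (ZMod p) K] in
theorem discr_pow_reduction (h2 : 2 < p)
    (ha : gam p M ![1, 2, 3, 4] ≠ 0) (hb : gam p M ![1, 2, 3, 5] ≠ 0) :
    Reduces (smallAlgebra p M) p (X 1 : MvPolynomial (Fin 3) K) discr (discr ^ p ^ 2) := by
  refine exists_reduction (N := 2 * p ^ 2) (by nlinarith) ha
    (τ := (fracW - fracU ^ 2) ^ p ^ 2) ?_
    (Algebra.subset_adjoin (by simp)) ((fJ_12346_spec ha hb h2).2.trans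
      (congrArg _ (minorData_G_eq ha hb)))
  rw [map_pow, toFrac_discr, mul_pow, pow_mul]

omit [Algebra (ZMod p) K] [Fact p.Prime] [CharP K p] in
/-- Every polynomial is, up to a power of `x`, a combination of `y^i (xz - y²)^j`. -/
theorem exists_X_pow_mul_mem_adjoin_pair (f : MvPolynomial (Fin 3) K) :
    ∃ m, X 2 ^ m * f ∈ Algebra.adjoin (smallAlgebra p M) {X 1, discr} := by
  have hX : (X 2 : MvPolynomial (Fin 3) K) ∈ Algebra.adjoin (smallAlgebra p M) {X 1, discr} :=
    (Algebra.adjoin (smallAlgebra p M) _).algebraMap_mem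
      ⟨X 2, Algebra.subset_adjoin (by simp)⟩
  have h1 : (X 1 : MvPolynomial (Fin 3) K) ∈ Algebra.adjoin (smallAlgebra p M) {X 1, discr} :=
    Algebra.subset_adjoin (by simp)
  have hD : (discr : MvPolynomial (Fin 3) K) ∈ Algebra.adjoin (smallAlgebra p M) {X 1, discr} :=
    Algebra.subset_adjoin (by simp)
  induction f using MvPolynomial.induction_on with
  | C c =>
    exact ⟨0, by
      rw [pow_zero, one_mul]
      exact (Algebra.adjoin (smallAlgebra p M) _).algebraMap_mem
        ⟨C c, (smallAlgebra p M).algebraMap_mem c⟩⟩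
  | add f g hf hg =>
    obtain ⟨m, hm⟩ := hf
    obtain ⟨n, hn⟩ := hg
    refine ⟨m + n, ?_⟩
    have e : X 2 ^ (m + n) * (f + g) = X 2 ^ n * (X 2 ^ m * f) + X 2 ^ m * (X 2 ^ n * g) := by
      ring
    rw [e]
    exact add_mem (mul_mem (pow_mem hX _) hm) (mul_mem (pow_mem hX _) hn)
  | mul_X f i hf =>
    obtain ⟨m, hm⟩ := hf
    refine ⟨m + 1, ?_⟩
    have e : X 2 ^ (m + 1) * (f * X i) = X 2 ^ m * f * (X 2 * X i) := by ring
    rw [e]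
    refine mul_mem hm ?_
    fin_cases i
    · have : (X 2 * X 0 : MvPolynomial (Fin 3) K) = discr + X 1 ^ 2 := by rw [discr]; ring
      change X 2 * X 0 ∈ _
      rw [this]
      exact add_mem hD (pow_mem h1 _)
    · exact mul_mem hX h1
    · exact mul_mem hX hX

theorem smallAlgebra_le_invariants (h2 : 2 < p)
    (ha : gam p M ![1, 2, 3, 4] ≠ 0) (hb : gam p M ![1, 2, 3, 5] ≠ 0) :
    smallAlgebra p M ≤ invariants p M := by
  refine Algebra.adjoin_le ?_
  rintro f (rfl | rfl | rfl)
  exacts [X_mem, f₁_mem ha hb h2, fJ_12346_mem ha hb h2]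

omit [Fact p.Prime] [CharP K p] in
theorem toFrac_act_mul_pow {s : MvPolynomial (Fin 3) K} (hs : s ∈ invariants p M) (i j : ℕ)
    (a : Multiplicative (Fin 4 → ZMod p)) :
    toFrac (act p M a (s * (X 1 ^ i * discr ^ j))) = toFrac s * toFrac (X 2) ^ (i + 2 * j) *
      ((fracU + algebraMap K (Frac K) (shift₁ M a)) ^ i *
        (fracW - fracU ^ 2 + algebraMap K (Frac K) (shift₂ M a)) ^ j) := by
  have h1 : actFrac p M a (toFrac (X 1)) =
      toFrac (X 2) * (fracU + algebraMap K (Frac K) (shift₁ M a)) := by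
    rw [← X_mul_fracU, map_mul, actFrac_u, actFrac_toFrac, act_x]
  have h2 : actFrac p M a (toFrac discr) =
      toFrac (X 2) ^ 2 * (fracW - fracU ^ 2 + algebraMap K (Frac K) (shift₂ M a)) := by
    rw [toFrac_discr, map_mul, actFrac_w, map_pow, actFrac_toFrac, act_x]
  rw [map_mul, hs a, map_mul toFrac, map_mul (act p M a), map_pow, map_pow, map_mul toFrac,
    map_pow, map_pow, ← actFrac_toFrac, ← actFrac_toFrac, h1, h2, mul_pow, mul_pow, ← pow_mul]
  ring

omit [Fact p.Prime] [CharP K p] in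
theorem toFrac_act_sum {q : ℕ} {c : Fin q × Fin q → MvPolynomial (Fin 3) K}
    (hc : ∀ k, c k ∈ invariants p M) (a : Multiplicative (Fin 4 → ZMod p)) :
    toFrac (act p M a (∑ k, c k * (X 1 ^ (k.1 : ℕ) * discr ^ (k.2 : ℕ)))) =
      ∑ k, toFrac (c k) * toFrac (X 2) ^ ((k.1 : ℕ) + 2 * (k.2 : ℕ)) *
      ((fracU + algebraMap K (Frac K) (shift₁ M a)) ^ (k.1 : ℕ) *
        (fracW - fracU ^ 2 + algebraMap K (Frac K) (shift₂ M a)) ^ (k.2 : ℕ)) := by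
  rw [map_sum, map_sum]
  exact Finset.sum_congr rfl fun k _ => toFrac_act_mul_pow (hc k) _ _ a

/-- Expand x^m f in the products y^i (xz - y²)^j with i, j < p² and coefficients in the small
algebra. Group elements fix f and the coefficients and only translate u and v, so independence along
the orbit makes x^m f equal to the coefficient at i = j = 0. -/
theorem exists_X_pow_mul_mem_smallAlgebra (h2 : 2 < p)
    (ha : gam p M ![1, 2, 3, 4] ≠ 0) (hb : gam p M ![1, 2, 3, 5] ≠ 0)
    {f : MvPolynomial (Fin 3) K} (hf : f ∈ invariants p M) :
    ∃ m, X 2 ^ m * f ∈ smallAlgebra p M := by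
  obtain ⟨m, hm⟩ := exists_X_pow_mul_mem_adjoin_pair (M := M) (p := p) f
  refine ⟨m, ?_⟩
  have hpq : 2 * p < p ^ 2 := by nlinarith
  obtain ⟨c, hcA, hc⟩ := exists_sum_of_mem_adjoin_pair_subalgebra (p := p) (by omega) hpq
    (y_pow_reduction h2 ha hb) (discr_pow_reduction h2 ha hb) hm
  have hp : 0 < p ^ 2 := by positivity
  have hinv : X 2 ^ m * f ∈ invariants p M := mul_mem (pow_mem X_mem _) hf
  have hsum := fun a => toFrac_act_sum (fun k => smallAlgebra_le_invariants h2 ha hb (hcA k)) a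
  rw [hc] at hsum
  have key := coeff_eq_of_sum_smul_eq_const (linearIndependent_shift h2 ha hb)
    (⟨0, hp⟩, ⟨0, hp⟩) (by simp) (d := fun k => toFrac (c k) *
      toFrac (X 2) ^ ((k.1 : ℕ) + 2 * (k.2 : ℕ))) (g := toFrac (X 2 ^ m * f))
      fun a => (hsum a).symm.trans (by rw [hinv a])
  rw [mul_zero, add_zero, pow_zero, mul_one] at key
  rw [← toFrac_injective key]
  exact hcA _

end Localization

/-! ### Lead monomials for a second order -/

section WeightOrder

variable {K : Type*} [Field K]

/-- The key `(2 deg_z + deg_y, deg_z, deg_x)`. -/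
def wKey : (Fin 3 →₀ ℕ) →+ ℕ ×ₗ (ℕ ×ₗ ℕ) where
  toFun a := toLex (2 * a 0 + a 1, toLex (a 0, a 2))
  map_zero' := by simp
  map_add' a b := by
    simp only [Finsupp.add_apply, ← toLex_add, Prod.mk_add_mk]
    ring_nf

theorem wKey_injective : Function.Injective wKey := by
  intro a b h
  simp only [wKey, AddMonoidHom.coe_mk, ZeroHom.coe_mk, EmbeddingLike.apply_eq_iff_eq,
    Prod.mk.injEq] at h
  obtain ⟨h1, h2, h3⟩ := h
  ext i
  fin_cases i <;> simp <;> omega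

theorem wKey_monotone : Monotone wKey := by
  intro a b h
  have h0 := h 0
  have h1 := h 1
  have h2 := h 2
  simp only [wKey, AddMonoidHom.coe_mk, ZeroHom.coe_mk, Prod.Lex.toLex_le_toLex]
  omega

/-- The monomial order that first compares `2 deg_z + deg_y`. -/
def wOrder : MonomialOrder (Fin 3) := orderOfKey wKey wKey_injective wKey_monotone

theorem wOrder_lt_iff (a b : Fin 3 →₀ ℕ) : wOrder.toSyn a < wOrder.toSyn b ↔
    2 * a 0 + a 1 < 2 * b 0 + b 1 ∨ (2 * a 0 + a 1 = 2 * b 0 + b 1 ∧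
      (a 0 < b 0 ∨ (a 0 = b 0 ∧ a 2 < b 2))) := by
  rw [wOrder, orderOfKey_lt_iff]
  simp only [wKey, AddMonoidHom.coe_mk, ZeroHom.coe_mk, Prod.Lex.toLex_lt_toLex]

/-- All monomials of `f` have weight at most `n`, where `z, y, x` have weights `2, 1, 0`. -/
def WeightLE (n : ℕ) (f : MvPolynomial (Fin 3) K) : Prop :=
  ∀ d ∈ f.support, 2 * d 0 + d 1 ≤ n

namespace WeightLE

variable {m n : ℕ} {f g : MvPolynomial (Fin 3) K}

theorem mono (h : WeightLE m f) (hmn : m ≤ n) : WeightLE n f := fun d hd => (h d hd).trans hmn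

theorem add (hf : WeightLE n f) (hg : WeightLE n g) : WeightLE n (f + g) := by
  classical
  intro d hd
  rcases Finset.mem_union.1 (support_add hd) with h | h
  exacts [hf d h, hg d h]

theorem neg (hf : WeightLE n f) : WeightLE n (-f) := fun d hd => hf d (by rwa [support_neg] at hd)

theorem sub (hf : WeightLE n f) (hg : WeightLE n g) : WeightLE n (f - g) := by
  rw [sub_eq_add_neg]
  exact hf.add hg.neg

theorem mul (hf : WeightLE m f) (hg : WeightLE n g) : WeightLE (m + n) (f * g) := by
  classical
  intro d hd
  obtain ⟨a, ha, b, hb, rfl⟩ := Finset.mem_add.1 (support_mul f g hd)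
  have h1 := hf a ha
  have h2 := hg b hb
  simp only [Finsupp.add_apply]
  omega

theorem monomial (d : Fin 3 →₀ ℕ) (c : K) :
    WeightLE (2 * d 0 + d 1) (MvPolynomial.monomial d c) := by
  intro e he
  rw [Finset.mem_singleton.1 (support_monomial_subset he)]

theorem C (c : K) : WeightLE 0 (C c) := by
  simpa using WeightLE.monomial (0 : Fin 3 →₀ ℕ) c

theorem pow (hf : WeightLE m f) (k : ℕ) : WeightLE (k * m) (f ^ k) := by
  induction k with
  | zero => simpa using WeightLE.C (1 : K)
  | succ k ih =>
    rw [pow_succ, add_mul, one_mul]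
    exact ih.mul hf

theorem sum {ι : Type*} {s : Finset ι} {f : ι → MvPolynomial (Fin 3) K}
    (h : ∀ i ∈ s, WeightLE n (f i)) : WeightLE n (∑ i ∈ s, f i) := by
  classical
  induction s using Finset.induction_on with
  | empty => intro d hd; simp at hd
  | insert i s hi ih =>
    rw [Finset.sum_insert hi]
    exact (h i (Finset.mem_insert_self _ _)).add
      (ih fun j hj => h j (Finset.mem_insert_of_mem hj))

theorem X0 : WeightLE 2 (X 0 : MvPolynomial (Fin 3) K) := by
  have := WeightLE.monomial (Finsupp.single 0 1 : Fin 3 →₀ ℕ) (1 : K)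
  simp only [Finsupp.single_eq_same, Finsupp.single_eq_of_ne (show (1 : Fin 3) ≠ 0 by decide),
    mul_one, add_zero] at this
  exact this

theorem X1 : WeightLE 1 (X 1 : MvPolynomial (Fin 3) K) := by
  have := WeightLE.monomial (Finsupp.single 1 1 : Fin 3 →₀ ℕ) (1 : K)
  simp only [Finsupp.single_eq_same, Finsupp.single_eq_of_ne (show (0 : Fin 3) ≠ 1 by decide),
    mul_zero, zero_add] at this
  exact this

theorem X2_pow (k : ℕ) : WeightLE 0 (X 2 ^ k : MvPolynomial (Fin 3) K) := by
  simpa [X_pow_eq_monomial] using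
    WeightLE.monomial (Finsupp.single 2 k : Fin 3 →₀ ℕ) (1 : K)

theorem of_degree (h : 2 * (wOrder.degree f) 0 + (wOrder.degree f) 1 ≤ n) : WeightLE n f := by
  intro d hd
  have := wOrder.le_degree hd
  rw [← not_lt, wOrder_lt_iff] at this
  omega

theorem degree_lt (hf : WeightLE n f) {d : Fin 3 →₀ ℕ} (hd : n < 2 * d 0 + d 1) :
    wOrder.toSyn (wOrder.degree f) < wOrder.toSyn d := by
  rw [wOrder_lt_iff]
  left
  by_cases h0 : f = 0
  · rw [h0, wOrder.degree_zero]
    simp only [Finsupp.coe_zero, Pi.zero_apply]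
    omega
  · exact (hf _ (wOrder.degree_mem_support h0)).trans_lt hd

theorem degree_eq (hg : WeightLE n g) {c : K} (hc : c ≠ 0) {d : Fin 3 →₀ ℕ}
    (hd : n < 2 * d 0 + d 1) (e : f = MvPolynomial.monomial d c + g) : wOrder.degree f = d := by
  classical
  have h1 : wOrder.degree (MvPolynomial.monomial d c) = d := by
    rw [MonomialOrder.degree_monomial, if_neg hc]
  rw [e, wOrder.degree_add_of_lt (by rw [h1]; exact hg.degree_lt hd), h1]

end WeightLE

variable {p : ℕ} {M : Matrix (Fin 2) (Fin 4) K} [Fact p.Prime] [CharP K p]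

/-- The lower order part of `f₁`, divided by a power of `x`. -/
def lowerPoly (p : ℕ) (b c d e : K) : MvPolynomial (Fin 3) K :=
  C b * (X 1 ^ (2 * p) - X 2 ^ p * X 0 ^ p) + C c * (X 2 ^ p * X 1 ^ p) +
    C d * (X 2 ^ (2 * p - 2) * (X 1 ^ 2 - X 2 ^ 1 * X 0)) + C e * (X 2 ^ (2 * p - 1) * X 1)

omit [Fact p.Prime] [CharP K p] in
theorem weightLE_lowerPoly (hp : 1 ≤ p) (b c d e : K) : WeightLE (2 * p) (lowerPoly p b c d e) := by
  have h0 := WeightLE.X0 (K := K)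
  have h1 := WeightLE.X1 (K := K)
  have h2 := WeightLE.X2_pow (K := K)
  refine WeightLE.add (WeightLE.add (WeightLE.add ?_ ?_) ?_) ?_
  · refine ((WeightLE.C b).mul (((h1.pow (2 * p)).mono ?_).sub
      (((h2 p).mul (h0.pow p)).mono ?_))).mono (n := 2 * p) (m := 0 + 2 * p) ?_ <;> omega
  · exact ((WeightLE.C c).mul ((h2 p).mul (h1.pow p))).mono (by omega)
  · refine ((WeightLE.C d).mul ((h2 _).mul (((h1.pow 2).mono ?_).sub
      (((h2 1).mul h0).mono ?_)))).mono (m := 0 + (0 + 2)) ?_ <;> omega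
  · exact ((WeightLE.C e).mul ((h2 _).mul h1)).mono (by omega)

omit [Fact p.Prime] [CharP K p] in
theorem toFrac_lowerPoly (hp : 1 ≤ p) (b c d e : K) :
    toFrac (lowerPoly p b c d e) = toFrac (X 2) ^ (2 * p) *
      (algebraMap K _ b * ((fracU ^ p) ^ 2 - fracW ^ p) + algebraMap K _ c * fracU ^ p +
        algebraMap K _ d * (fracU ^ 2 - fracW) + algebraMap K _ e * fracU) := by
  obtain ⟨k, hk⟩ := Nat.exists_eq_add_of_le (show 2 ≤ 2 * p by omega)
  have k1 : 2 * p - 2 = k := by omega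
  have k2 : 2 * p - 1 = k + 1 := by omega
  rw [lowerPoly, k1, k2]
  simp only [map_add, map_sub, map_mul, map_pow, ← X_mul_fracU, ← X_mul_fracW]
  simp only [toFrac, algebraMap_C]
  generalize algebraMap (MvPolynomial (Fin 3) K) (Frac K) (X 2) = x
  have e1 : x ^ k * x ^ 2 = x ^ (2 * p) := by rw [← pow_add, hk, add_comm]
  have e2 : x ^ p * x ^ p = x ^ (2 * p) := by rw [← pow_add]; congr 1; ring
  simp only [mul_pow, pow_one]
  rw [← pow_mul (fracU : Frac K) p 2, mul_comm p 2]
  linear_combination (algebraMap K _ c * fracU ^ p - algebraMap K _ b * fracW ^ p) * e2 +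
    (algebraMap K _ d * (fracU ^ 2 - fracW) + algebraMap K _ e * fracU) * e1

theorem wOrder_degree_f₁ (h2 : 2 < p)
    (ha : gam p M ![1, 2, 3, 4] ≠ 0) (hb : gam p M ![1, 2, 3, 5] ≠ 0) :
    wOrder.degree (f₁ p M) = Finsupp.single 1 (p ^ 2) := by
  have hp2 : 3 * p ≤ p ^ 2 := by nlinarith
  have hl := weightLE_lowerPoly (p := p) (by omega) (gam p M ![1, 2, 3, 5])
    (gam p M ![1, 2, 4, 5]) (gam p M ![1, 3, 4, 5]) (gam p M ![2, 3, 4, 5])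
  refine WeightLE.degree_eq (((WeightLE.X2_pow (p ^ 2 - 2 * p)).mul hl)) ha (n := 0 + 2 * p)
    (by simp; omega) ?_
  rw [← C_mul_X_pow_eq_monomial]
  apply toFrac_injective
  rw [(f₁_spec ha hb h2).2.1, map_add, map_mul, map_mul, toFrac_lowerPoly (by omega), map_pow,
    map_pow, ← X_mul_fracU, MinorData.F₁, MinorData.s]
  have e1 : toFrac (X 2 : MvPolynomial (Fin 3) K) ^ (p ^ 2 - 2 * p) * toFrac (X 2) ^ (2 * p) =
      toFrac (X 2) ^ p ^ 2 := by rw [← pow_add]; congr 1; omega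
  simp only [minorData]
  rw [← mul_assoc, e1, mul_pow, toFrac, algebraMap_C]
  ring

/-- In this weight z counts as much as y². The term 2⁻¹ a² w^(p²) has weight 2p² and beats the
grevlex leader u^(p²+2p); this is why the second order sees different lead monomials. -/
theorem wOrder_degree_f₂ (h2 : 2 < p)
    (ha : gam p M ![1, 2, 3, 4] ≠ 0) (hb : gam p M ![1, 2, 3, 5] ≠ 0) :
    wOrder.degree (f₂ p M) = Finsupp.single 2 (2 * p) + Finsupp.single 0 (p ^ 2) := by
  have hp2 : 3 * p ≤ p ^ 2 := by nlinarith
  have two := two_ne_zero_of_lt h2 K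
  have two' := two_ne_zero_of_lt h2 (Frac K)
  have hl := weightLE_lowerPoly (p := p) (by omega) (gam p M ![1, 2, 3, 5])
    (gam p M ![1, 2, 4, 5]) (gam p M ![1, 3, 4, 5]) (gam p M ![2, 3, 4, 5])
  have hl' := weightLE_lowerPoly (p := p) (by omega) (gam p M ![1, 2, 3, 6])
    (gam p M ![1, 2, 4, 6]) (gam p M ![1, 3, 4, 6]) (gam p M ![2, 3, 4, 6])
  have t := toFrac_lowerPoly (p := p) (by omega) (gam p M ![1, 2, 3, 5])
    (gam p M ![1, 2, 4, 5]) (gam p M ![1, 3, 4, 5]) (gam p M ![2, 3, 4, 5])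
  have t' := toFrac_lowerPoly (p := p) (by omega) (gam p M ![1, 2, 3, 6])
    (gam p M ![1, 2, 4, 6]) (gam p M ![1, 3, 4, 6]) (gam p M ![2, 3, 4, 6])
  generalize lowerPoly p (gam p M ![1, 2, 3, 5]) (gam p M ![1, 2, 4, 5]) (gam p M ![1, 3, 4, 5])
    (gam p M ![2, 3, 4, 5]) = S at hl t
  generalize lowerPoly p (gam p M ![1, 2, 3, 6]) (gam p M ![1, 2, 4, 6]) (gam p M ![1, 3, 4, 6])
    (gam p M ![2, 3, 4, 6]) = S' at hl' t'
  set a := gam p M ![1, 2, 3, 4] with hadef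
  have hw : WeightLE (p ^ 2 + 2 * p) (C a * (X 1 ^ p ^ 2 * S) +
      C (2⁻¹) * (X 2 ^ (p ^ 2 - 2 * p) * S ^ 2) + C (2⁻¹ * a) * (X 2 ^ p ^ 2 * S')) := by
    refine WeightLE.add (WeightLE.add ?_ ?_) ?_
    · exact ((WeightLE.C a).mul ((WeightLE.X1.pow _).mul hl)).mono (by omega)
    · exact ((WeightLE.C _).mul ((WeightLE.X2_pow _).mul (hl.pow 2))).mono (by omega)
    · exact ((WeightLE.C _).mul ((WeightLE.X2_pow _).mul hl')).mono (by omega)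
  refine WeightLE.degree_eq hw (c := 2⁻¹ * a ^ 2) (mul_ne_zero (inv_ne_zero two)
    (pow_ne_zero _ ha)) (by simp; omega) ?_
  have em : monomial (Finsupp.single 2 (2 * p) + Finsupp.single 0 (p ^ 2)) (2⁻¹ * a ^ 2) =
      (C (2⁻¹ * a ^ 2) : MvPolynomial (Fin 3) K) * (X 2 ^ (2 * p) * X 0 ^ p ^ 2) := by
    rw [X_pow_eq_monomial, X_pow_eq_monomial, monomial_mul, C_mul_monomial, mul_one, mul_one]
  rw [em]
  apply toFrac_injective
  rw [(f₂_spec ha hb h2).2.1]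
  simp only [map_add, map_mul, map_pow, t, t', ← X_mul_fracU, ← X_mul_fracW]
  rw [MinorData.F₂, MinorData.F₁, MinorData.G, MinorData.s, MinorData.s']
  simp only [minorData, toFrac, algebraMap_C, map_inv₀, map_ofNat]
  rw [← hadef]
  generalize algebraMap (MvPolynomial (Fin 3) K) (Frac K) (X 2) = x
  generalize algebraMap K (Frac K) (gam p M ![1, 2, 3, 5]) * ((fracU ^ p) ^ 2 - fracW ^ p) +
    algebraMap K (Frac K) (gam p M ![1, 2, 4, 5]) * fracU ^ p +
    algebraMap K (Frac K) (gam p M ![1, 3, 4, 5]) * (fracU ^ 2 - fracW) +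
    algebraMap K (Frac K) (gam p M ![2, 3, 4, 5]) * fracU = s
  generalize algebraMap K (Frac K) (gam p M ![1, 2, 3, 6]) * ((fracU ^ p) ^ 2 - fracW ^ p) +
    algebraMap K (Frac K) (gam p M ![1, 2, 4, 6]) * fracU ^ p +
    algebraMap K (Frac K) (gam p M ![1, 3, 4, 6]) * (fracU ^ 2 - fracW) +
    algebraMap K (Frac K) (gam p M ![2, 3, 4, 6]) * fracU = s'
  generalize algebraMap K (Frac K) a = a
  have e1 : x ^ (2 * p) * x ^ p ^ 2 = x ^ (p ^ 2 + 2 * p) := by rw [← pow_add, add_comm]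
  have e2 : x ^ (p ^ 2 - 2 * p) * (x ^ (2 * p)) ^ 2 = x ^ (p ^ 2 + 2 * p) := by
    rw [← pow_mul, ← pow_add]; congr 1; omega
  rw [mul_pow, mul_pow, mul_pow]
  generalize (fracU : Frac K) ^ p ^ 2 = U
  generalize (fracW : Frac K) ^ p ^ 2 = W
  have h22 : (2 : Frac K)⁻¹ * 2 = 1 := inv_mul_cancel₀ two'
  linear_combination (-(2⁻¹ * a ^ 2 * W) - a * U * s - 2⁻¹ * a * s') * e1 - 2⁻¹ * s ^ 2 * e2 +
    x ^ (p ^ 2 + 2 * p) * a * U * s * h22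

theorem WeightLE.startSet (h2 : 2 < p)
    (ha : gam p M ![1, 2, 3, 4] ≠ 0) (hb : gam p M ![1, 2, 3, 5] ≠ 0) [Algebra (ZMod p) K]
    {J : Fin 4 →₀ ℕ} (hJ : J 3 = 0) :
    WeightLE (p ^ 2 * J 1 + 2 * p ^ 2 * J 2) (powProd (startSet p M) J) := by
  have w1 : WeightLE (p ^ 2) (f₁ p M) :=
    .of_degree (by rw [wOrder_degree_f₁ h2 ha hb]; simp)
  have w2 : WeightLE (2 * p ^ 2) (f₂ p M) :=
    .of_degree (by rw [wOrder_degree_f₂ h2 ha hb]; simp)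
  have e : powProd (RankFour.startSet p M) J = X 2 ^ J 0 * f₁ p M ^ J 1 * f₂ p M ^ J 2 := by
    rw [powProd, Fin.prod_univ_four, hJ, pow_zero, mul_one]
    rfl
  rw [e]
  exact (((WeightLE.X2_pow _).mul (w1.pow _)).mul (w2.pow _)).mono (by
    rw [mul_comm (J 1), mul_comm (J 2), zero_add])

/-- In the equation that defines f₃, the power f₂^p has weight 2p³ and all other products have
smaller weight. Hence c x^(2p²-2) f₃ has the lead monomial x^(2p²) z^(p³) of f₂^p. -/
theorem IsThirdInvariant.wOrder_degree [Algebra (ZMod p) K] (h2 : 2 < p)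
    (ha : gam p M ![1, 2, 3, 4] ≠ 0) (hb : gam p M ![1, 2, 3, 5] ≠ 0)
    (hc : gam p M ![1, 3, 5, 7] ≠ 0) {f : MvPolynomial (Fin 3) K}
    (H : IsThirdInvariant p M f) :
    wOrder.degree f = Finsupp.single 2 2 + Finsupp.single 0 (p ^ 3) := by
  obtain ⟨hd, -, -, c, q, e, hq⟩ := H.spec h2 ha hb hc
  have hf0 : f ≠ 0 := by
    rintro rfl
    rw [grevLex.degree_zero] at hd
    simpa using congrArg (· 1) hd
  have e3 : p ^ 3 = p * p ^ 2 := by ring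
  have h3 : 3 * p ^ 2 ≤ p ^ 3 := by rw [e3]; exact Nat.mul_le_mul_right _ h2
  have h4 : 3 * p ≤ p ^ 2 := by nlinarith
  have w1 : WeightLE (p ^ 2) (f₁ p M) :=
    .of_degree (by rw [wOrder_degree_f₁ h2 ha hb]; simp)
  set N := 2 * p ^ 3 - 1
  have hA : WeightLE N (aeval (startSet p M) q) := by
    rw [aeval_eq_sum_powProd]
    refine WeightLE.sum fun J hJ => ?_
    obtain ⟨g1, g2, g3⟩ := exponents_of_startSet_lt h2 ha hb (hq J hJ)
    refine ((WeightLE.C _).mul (WeightLE.startSet h2 ha hb g2)).mono ?_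
    -- With p = 2 + r, passing from degree to weight adds rp = p² - 2p for each factor f₂, and there
    -- are at most p - 1 of these; the total stays p² - 2p below 2p³.
    obtain ⟨r, hr⟩ := Nat.exists_eq_add_of_le h2.le
    have g4 : r * p * J 2 ≤ r * p * (r + 1) := Nat.mul_le_mul_left _ (by omega)
    have g5 : 2 * p ^ 2 * J 2 = (p ^ 2 + 2 * p) * J 2 + r * p * J 2 := by rw [hr]; ring
    have g6 : p ^ 3 + 2 * p ^ 2 + r * p * (r + 1) + p ^ 2 = 2 * p ^ 3 + 2 * p := by rw [hr]; ring
    omega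
  have hR : WeightLE N (-(C (gam p M ![1, 2, 3, 5] ^ p / gam p M ![1, 2, 3, 4] ^ 2) *
      f₁ p M ^ (p + 2)) - aeval (startSet p M) q) := by
    refine (WeightLE.neg (((WeightLE.C _).mul (w1.pow _)).mono ?_)).sub hA
    have : 0 + (p + 2) * p ^ 2 = p ^ 3 + 2 * p ^ 2 := by ring
    omega
  have e' : C c * X 2 ^ (2 * p ^ 2 - 2) * f = f₂ p M ^ p +
      (-(C (gam p M ![1, 2, 3, 5] ^ p / gam p M ![1, 2, 3, 4] ^ 2) *
      f₁ p M ^ (p + 2)) - aeval (startSet p M) q) := by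
    rw [tatDiff_startSet h2 ha hb] at e
    linear_combination -e
  have d2 : wOrder.degree (f₂ p M ^ p) =
      Finsupp.single 2 (2 * p ^ 2) + Finsupp.single 0 (p ^ 3) := by
    rw [wOrder.degree_pow, wOrder_degree_f₂ h2 ha hb, smul_add, Finsupp.smul_single,
      Finsupp.smul_single]
    congr 2 <;> rw [smul_eq_mul] <;> ring
  have hlt := hR.degree_lt (d := wOrder.degree (f₂ p M ^ p)) (by rw [d2]; simp; omega)
  have hd3 := congrArg wOrder.degree e'
  rw [wOrder.degree_add_of_lt hlt, d2] at hd3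
  have hc0 : c ≠ 0 := by
    rintro rfl
    rw [C_0, zero_mul, zero_mul, wOrder.degree_zero] at hd3
    have := congrArg (· 0) hd3
    simp at this
    omega
  rw [degree_C_mul_X_pow_mul hc0 hf0] at hd3
  apply add_left_cancel (hd3.trans _)
  rw [← add_assoc, ← Finsupp.single_add]
  congr 2
  omega

end WeightOrder

/-! ### The second relation -/

section Homogeneous

variable {K : Type*} [Field K] {n : ℕ} {h : Fin n → MvPolynomial (Fin 3) K} {d : Fin n → ℕ}

theorem isHomogeneous_powProd (hh : ∀ j, (h j).IsHomogeneous (d j)) (J : Fin n →₀ ℕ) :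
    (powProd h J).IsHomogeneous (Finsupp.weight d J) := by
  rw [Finsupp.weight_apply, Finsupp.sum_fintype _ _ (by simp)]
  refine IsHomogeneous.prod _ _ _ fun j _ => ?_
  rw [smul_eq_mul, mul_comm]
  exact (hh j).pow (J j)

/-- Allows any expression or relation to be replaced by its part of one degree. -/
theorem aeval_weightedHomogeneousComponent (hh : ∀ j, (h j).IsHomogeneous (d j)) (N : ℕ)
    (q : MvPolynomial (Fin n) K) :
    aeval h (weightedHomogeneousComponent d N q) = homogeneousComponent N (aeval h q) := by
  classical
  rw [weightedHomogeneousComponent_apply, map_sum, aeval_eq_sum_powProd, map_sum,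
    Finset.sum_filter]
  refine Finset.sum_congr rfl fun J _ => ?_
  rw [homogeneousComponent_C_mul, homogeneousComponent_of_mem (isHomogeneous_powProd hh J),
    aeval_monomial_eq_powProd]
  simp only [eq_comm (a := N)]
  split_ifs <;> simp

end Homogeneous

section Second

variable {K : Type*} [Field K] {p : ℕ} {h : Fin 5 → MvPolynomial (Fin 3) K}

/-- The lead monomials of the generators for the second order. -/
structure HasWLeads (p : ℕ) (h : Fin 5 → MvPolynomial (Fin 3) K) : Prop where
  deg_one : wOrder.degree (h 1) = Finsupp.single 1 (p ^ 2)
  deg_two : wOrder.degree (h 2) = Finsupp.single 2 (2 * p) + Finsupp.single 0 (p ^ 2)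
  deg_three : wOrder.degree (h 3) = Finsupp.single 2 2 + Finsupp.single 0 (p ^ 3)
  deg_four : wOrder.degree (h 4) = Finsupp.single 0 (p ^ 4)

theorem HasWLeads.degree_powProd (W : HasWLeads p h) (H : HasLeads p h) (I : Fin 5 →₀ ℕ) :
    (wOrder.degree (powProd h I)) 0 = p ^ 2 * I 2 + p ^ 3 * I 3 + p ^ 4 * I 4 ∧
    (wOrder.degree (powProd h I)) 1 = p ^ 2 * I 1 ∧
    (wOrder.degree (powProd h I)) 2 = I 0 + 2 * p * I 2 + 2 * I 3 := by
  rw [RankFour.degree_powProd _ H.ne_zero, Fin.sum_univ_five, H.eq_X, W.deg_one, W.deg_two,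
    W.deg_three, W.deg_four, wOrder.degree_X]
  refine ⟨?_, ?_, ?_⟩ <;> simp <;> ring

/-- `f` is a combination of products `h^J` with `J 4 = 0` and `J 2 < p`. -/
def IsLow (p : ℕ) (h : Fin 5 → MvPolynomial (Fin 3) K) (f : MvPolynomial (Fin 3) K) : Prop :=
  ∃ q : MvPolynomial (Fin 5) K, aeval h q = f ∧ ∀ J ∈ q.support, J 4 = 0 ∧ J 2 < p

theorem IsLow.add {f g : MvPolynomial (Fin 3) K} (hf : IsLow p h f) (hg : IsLow p h g) :
    IsLow p h (f + g) := by
  classical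
  obtain ⟨q, rfl, hq⟩ := hf
  obtain ⟨r, rfl, hr⟩ := hg
  refine ⟨q + r, map_add _ _ _, fun J hJ => ?_⟩
  rcases Finset.mem_union.1 (support_add hJ) with hJ | hJ
  exacts [hq J hJ, hr J hJ]

theorem IsLow.C_mul {f : MvPolynomial (Fin 3) K} (hf : IsLow p h f) (c : K) :
    IsLow p h (C c * f) := by
  obtain ⟨q, rfl, hq⟩ := hf
  refine ⟨C c * q, by rw [map_mul, algHom_C]; rfl, fun J hJ => hq J ?_⟩
  rw [mem_support_iff, coeff_C_mul] at hJ
  exact mem_support_iff.2 (right_ne_zero_of_mul hJ)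

theorem IsLow.sum {ι : Type*} {s : Finset ι} {f : ι → MvPolynomial (Fin 3) K}
    (hf : ∀ i ∈ s, IsLow p h (f i)) : IsLow p h (∑ i ∈ s, f i) := by
  classical
  induction s using Finset.induction_on with
  | empty => exact ⟨0, by simp, by simp⟩
  | insert i s hi ih =>
    rw [Finset.sum_insert hi]
    exact (hf i (Finset.mem_insert_self _ _)).add
      (ih fun j hj => hf j (Finset.mem_insert_of_mem hj))

/-- Substituting for h₂^p strictly lowers the exponent of h₂, because every replacement term has
exponent below p there, and it introduces no factor h₄. -/
theorem isLow_powProd (h2 : IsLow p h (h 2 ^ p)) (J : Fin 5 →₀ ℕ) (hJ : J 4 = 0) :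
    IsLow p h (powProd h J) := by
  classical
  obtain ⟨N, hN⟩ : ∃ N, J 2 = N := ⟨_, rfl⟩
  induction N using Nat.strong_induction_on generalizing J with
  | _ N ih =>
    by_cases hlt : J 2 < p
    · refine ⟨monomial J 1, by rw [aeval_monomial_eq_powProd, C_1, one_mul], fun I hI => ?_⟩
      rw [Finset.mem_singleton.1 (support_monomial_subset hI)]
      exact ⟨hJ, hlt⟩
    · have hle : Finsupp.single 2 p ≤ J := by
        rw [Finsupp.single_le_iff]
        exact not_lt.1 hlt
      obtain ⟨q, hq, hs⟩ := h2
      have e : powProd h J = ∑ I ∈ q.support,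
          C (coeff I q) * powProd h (J - Finsupp.single 2 p + I) := by
        conv_lhs => rw [← tsub_add_cancel_of_le hle]
        rw [powProd_add, powProd_single, ← hq, aeval_eq_sum_powProd, Finset.mul_sum]
        refine Finset.sum_congr rfl fun I _ => ?_
        rw [powProd_add]
        ring
      rw [e]
      refine IsLow.sum fun I hI => (ih _ ?_ _ ?_ rfl).C_mul _
      · have := (hs I hI).2
        rw [Finsupp.add_apply, Finsupp.tsub_apply, Finsupp.single_eq_same]
        omega
      · rw [Finsupp.add_apply, Finsupp.tsub_apply, (hs I hI).1, hJ, Nat.zero_sub]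

theorem isLow_aeval (h2 : IsLow p h (h 2 ^ p)) {q : MvPolynomial (Fin 5) K}
    (hq : ∀ J ∈ q.support, J 4 = 0) : IsLow p h (aeval h q) := by
  rw [aeval_eq_sum_powProd]
  exact IsLow.sum fun J hJ => (isLow_powProd h2 J (hq J hJ)).C_mul _

theorem isLow_of_mem_adjoin (h2 : IsLow p h (h 2 ^ p)) {f : MvPolynomial (Fin 3) K}
    (hf : f ∈ Algebra.adjoin K {h 0, h 1, h 2}) : IsLow p h f := by
  classical
  have hs : ∀ j : Fin 5, j ≠ 4 → IsLow p h (h j) := by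
    intro j hj
    have := isLow_powProd h2 (Finsupp.single j 1) (Finsupp.single_eq_of_ne hj.symm)
    rwa [powProd_single, pow_one] at this
  induction hf using Algebra.adjoin_induction with
  | mem f hf =>
    rcases hf with rfl | rfl | rfl
    exacts [hs 0 (by decide), hs 1 (by decide), hs 2 (by decide)]
  | algebraMap c =>
    have := (isLow_powProd h2 0 rfl).C_mul c
    rwa [powProd, Finset.prod_eq_one fun j _ => by simp, mul_one] at this
  | add f g _ _ hf hg => exact hf.add hg
  | mul f g _ _ hf hg =>
    obtain ⟨q, rfl, hq⟩ := hf
    obtain ⟨r, rfl, hr⟩ := hg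
    rw [← map_mul]
    refine isLow_aeval h2 fun J hJ => ?_
    obtain ⟨a, ha, b, hb, rfl⟩ := Finset.mem_add.1 (support_mul q r hJ)
    rw [Finsupp.add_apply, (hq a ha).1, (hr b hb).1]

/-- The degrees of the generators. -/
def degs (p : ℕ) : Fin 5 → ℕ := ![1, p ^ 2, p ^ 2 + 2 * p, p ^ 3 + 2, p ^ 4]

theorem weight_degs (J : Fin 5 →₀ ℕ) : Finsupp.weight (degs p) J =
    J 0 + p ^ 2 * J 1 + (p ^ 2 + 2 * p) * J 2 + (p ^ 3 + 2) * J 3 + p ^ 4 * J 4 := by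
  rw [Finsupp.weight_apply, Finsupp.sum_fintype _ _ (by simp), Fin.sum_univ_five]
  simp only [degs, smul_eq_mul, Matrix.cons_val_zero, Matrix.cons_val_one, Matrix.cons_val]
  ring

theorem exists_homogeneous_of_isLow (hh : ∀ j, (h j).IsHomogeneous (degs p j))
    {f : MvPolynomial (Fin 3) K} {N : ℕ} (hN : f.IsHomogeneous N) (hf : IsLow p h f) :
    ∃ q : MvPolynomial (Fin 5) K, aeval h q = f ∧
      ∀ J ∈ q.support, J 4 = 0 ∧ J 2 < p ∧ Finsupp.weight (degs p) J = N := by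
  classical
  obtain ⟨q, rfl, hq⟩ := hf
  refine ⟨weightedHomogeneousComponent (degs p) N q, ?_, fun J hJ => ?_⟩
  · rw [aeval_weightedHomogeneousComponent hh, homogeneousComponent_of_mem hN, if_pos rfl]
  · rw [mem_support_iff, coeff_weightedHomogeneousComponent] at hJ
    obtain ⟨h1, h2⟩ := ite_ne_right_iff.1 hJ
    exact ⟨(hq J (mem_support_iff.2 h2)).1, (hq J (mem_support_iff.2 h2)).2, h1⟩

/-- The z-exponent divided by p² is I₂ + p I₃, and I₂ < p makes this a base p expansion. -/
theorem HasWLeads.injOn (hp : 0 < p) (W : HasWLeads p h) (H : HasLeads p h)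
    {I J : Fin 5 →₀ ℕ} (hI : I 4 = 0 ∧ I 2 < p) (hJ : J 4 = 0 ∧ J 2 < p)
    (hIJ : wOrder.degree (powProd h I) = wOrder.degree (powProd h J)) : I = J := by
  obtain ⟨a0, a1, a2⟩ := W.degree_powProd H I
  obtain ⟨b0, b1, b2⟩ := W.degree_powProd H J
  rw [hIJ] at a0 a1 a2
  have e0 := a0.symm.trans b0
  rw [hI.1, hJ.1, mul_zero, add_zero, add_zero] at e0
  have e0' : p ^ 2 * (I 2 + p * I 3) = p ^ 2 * (J 2 + p * J 3) := by linarith [e0, pow_succ p 2]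
  have e0'' := Nat.eq_of_mul_eq_mul_left (pow_pos hp 2) e0'
  have c2 : I 2 = J 2 := by
    have := congrArg (· % p) e0''
    simpa [Nat.add_mul_mod_self_left, Nat.mod_eq_of_lt hI.2, Nat.mod_eq_of_lt hJ.2] using this
  have c3 : I 3 = J 3 := Nat.eq_of_mul_eq_mul_left hp (by omega)
  have c1 := Nat.eq_of_mul_eq_mul_left (pow_pos hp 2) (a1.symm.trans b1)
  have e2 := a2.symm.trans b2
  rw [c2, c3] at e2
  ext j
  fin_cases j
  exacts [by simpa using e2, c1, c2, c3, hI.1.trans hJ.1.symm]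

theorem HasLeads.sum_degree_powProd (H : HasLeads p h) (J : Fin 5 →₀ ℕ) :
    (grevLex.degree (powProd h J)) 0 + (grevLex.degree (powProd h J)) 1 +
      (grevLex.degree (powProd h J)) 2 = Finsupp.weight (degs p) J := by
  obtain ⟨a0, a1, a2⟩ := H.degree_powProd J
  rw [a0, a1, a2, weight_degs]
  ring

/-- A multiple of `h 4` by a power of `x` which is a combination of the other generators
contains exactly one multiple of `h 3 ^ p`. -/
theorem exists_unique_third_power (hp : p.Prime) (H : HasLeads p h) (W : HasWLeads p h)
    {m : ℕ} {q : MvPolynomial (Fin 5) K} (hq : aeval h q = X 2 ^ m * h 4)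
    (hs : ∀ J ∈ q.support, J 4 = 0 ∧ J 2 < p ∧ Finsupp.weight (degs p) J = m + p ^ 4) :
    ∃ k c, m = k + 2 * p ∧ c ≠ 0 ∧
      c = coeff (Finsupp.single 0 k + Finsupp.single 3 p) q ∧
      ∀ J ∈ q.support, J ≠ Finsupp.single 0 k + Finsupp.single 3 p → J 3 < p := by
  have hf0 : X 2 ^ m * h 4 ≠ 0 := mul_ne_zero (pow_ne_zero _ (X_ne_zero _)) (H.ne_zero 4)
  have hq0 : q ≠ 0 := by
    rintro rfl
    rw [map_zero] at hq
    exact hf0 hq.symm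
  have hp0 := hp.pos
  obtain ⟨I, hI, -, hd, hmax⟩ := exists_degree_aeval_eq wOrder H.ne_zero hq0
    fun I hI J hJ hIJ => W.injOn hp0 H ⟨(hs I hI).1, (hs I hI).2.1⟩ ⟨(hs J hJ).1, (hs J hJ).2.1⟩ hIJ
  obtain ⟨a0, a1, a2⟩ := W.degree_powProd H I
  obtain ⟨i4, i2, iw⟩ := hs I hI
  have hdx : wOrder.degree (X 2 ^ m * h 4) = Finsupp.single 2 m + Finsupp.single 0 (p ^ 4) := by
    rw [wOrder.degree_mul (pow_ne_zero _ (X_ne_zero _)) (H.ne_zero 4), wOrder.degree_pow,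
      wOrder.degree_X, W.deg_four, Finsupp.smul_single_one]
  rw [← hd, hq, hdx] at a0 a1 a2
  simp only [Finsupp.add_apply, Finsupp.single_eq_same,
    Finsupp.single_eq_of_ne (show (0 : Fin 3) ≠ 2 by decide),
    Finsupp.single_eq_of_ne (show (1 : Fin 3) ≠ 2 by decide),
    Finsupp.single_eq_of_ne (show (1 : Fin 3) ≠ 0 by decide),
    Finsupp.single_eq_of_ne (show (2 : Fin 3) ≠ 0 by decide), zero_add, add_zero] at a0 a1 a2
  have hp2 : 0 < p ^ 2 := by positivity
  have c1 : I 1 = 0 := by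
    rcases Nat.mul_eq_zero.1 a1.symm with h | h
    exacts [absurd h hp2.ne', h]
  -- Matching z-exponents with z^(p⁴): since I₂ < p, the only solution is I₂ = 0, I₃ = p.
  have e0 : p * p = I 2 + p * I 3 := by
    apply Nat.eq_of_mul_eq_mul_left hp2
    rw [i4] at a0
    linarith [pow_succ p 2, pow_succ p 3]
  have c2 : I 2 = 0 := by
    have := congrArg (· % p) e0
    simpa [Nat.add_mul_mod_self_left, Nat.mod_eq_of_lt i2] using this.symm
  have c3 : I 3 = p := (Nat.eq_of_mul_eq_mul_left hp0 (by omega)).symm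
  have eI : I = Finsupp.single 0 (I 0) + Finsupp.single 3 p := by
    ext j
    fin_cases j <;> simp [c1, c2, c3, i4]
  refine ⟨I 0, coeff I q, ?_, mem_support_iff.1 hI, by rw [← eI], fun J hJ hJI => ?_⟩
  · rw [c2, c3] at a2
    omega
  obtain ⟨b0, b1, b2⟩ := W.degree_powProd H J
  obtain ⟨a0', a1', a2'⟩ := W.degree_powProd H I
  obtain ⟨j4, j2, jw⟩ := hs J hJ
  have hle := hmax J hJ
  rw [← not_lt, wOrder_lt_iff, a0', a1', b0, b1, c1, c2, c3, i4, j4] at hle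
  by_contra hlt
  have h3 := Nat.mul_le_mul_left (p ^ 3) (not_lt.1 hlt)
  -- Another term with J₃ ≥ p already reaches the maximal weight 2p⁴, so it has no factors h₁, h₂,
  -- and homogeneity makes it equal to I.
  have d1 : p ^ 2 * J 1 = 0 := by omega
  have d2 : p ^ 2 * J 2 = 0 := by omega
  have d3 : p ^ 3 * J 3 = p ^ 3 * p := by omega
  have d1' : J 1 = 0 := (Nat.mul_eq_zero.1 d1).resolve_left hp2.ne'
  have d2' : J 2 = 0 := (Nat.mul_eq_zero.1 d2).resolve_left hp2.ne'
  have d3' := Nat.eq_of_mul_eq_mul_left (pow_pos hp0 3) d3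
  rw [weight_degs, c1, c2, c3, i4] at iw
  rw [weight_degs, d1', d2', d3', j4] at jw
  apply hJI
  have d0 : J 0 = I 0 := by omega
  ext j
  fin_cases j <;> simp [d0, d1', d2', d3', j4]

/-- Cancelling a power of `x` in a combination with distinct lead monomials. -/
theorem exists_shift (hp : p.Prime) (h2 : 2 < p) (H : HasLeads p h) {k N : ℕ}
    {q : MvPolynomial (Fin 5) K} {s : MvPolynomial (Fin 3) K} (hq : aeval h q = X 2 ^ k * s)
    (hs : ∀ J ∈ q.support, J 2 < p ∧ J 3 < p ∧ Finsupp.weight (degs p) J = N) :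
    ∃ q' : MvPolynomial (Fin 5) K, aeval h q' = s ∧
      ∀ J ∈ q'.support, Finsupp.single 0 k + J ∈ q.support := by
  have hmin : ∀ J ∈ q.support, k ≤ J 0 := by
    intro J hJ
    have hq0 : q ≠ 0 := by
      rintro rfl
      simp at hJ
    obtain ⟨I, hI, h0, hd, hmax⟩ := exists_degree_aeval_eq grevLex H.ne_zero hq0
      fun I hI J hJ hIJ => H.injective hp h2 (hs I hI).1 (hs I hI).2.1 (hs J hJ).1 (hs J hJ).2.1 hIJ
    have hs0 : s ≠ 0 := by
      rintro rfl
      rw [mul_zero] at hq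
      exact h0 hq
    obtain ⟨-, -, a2⟩ := H.degree_powProd I
    obtain ⟨-, -, b2⟩ := H.degree_powProd J
    have hle := hmax J hJ
    have t1 := H.sum_degree_powProd I
    have t2 := H.sum_degree_powProd J
    rw [(hs I hI).2.2] at t1
    rw [(hs J hJ).2.2] at t2
    rw [← not_lt, grevLex_lt_iff] at hle
    -- The grevlex-leading term carries x^k because the whole sum does; within one degree all
    -- smaller lead monomials either have more factors x or have the same number.
    have hk : k ≤ I 0 := by
      rw [← a2, ← hd, hq, grevLex.degree_mul (pow_ne_zero _ (X_ne_zero _)) hs0,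
        grevLex.degree_pow, grevLex.degree_X, Finsupp.smul_single_one, Finsupp.add_apply,
        Finsupp.single_eq_same]
      exact Nat.le_add_right _ _
    omega
  have hmod : q.modMonomial (Finsupp.single 0 k) = 0 := by
    ext d
    rw [coeff_zero]
    by_cases hd : Finsupp.single 0 k ≤ d
    · exact coeff_modMonomial_of_le _ hd
    · rw [coeff_modMonomial_of_not_le _ hd]
      by_contra hne
      exact hd (Finsupp.single_le_iff.2 (hmin d (mem_support_iff.2 hne)))
  have e := divMonomial_add_modMonomial q (Finsupp.single 0 k)
  rw [hmod, add_zero] at e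
  refine ⟨q.divMonomial (Finsupp.single 0 k), ?_, fun J hJ => ?_⟩
  · rw [← e, map_mul, aeval_monomial_eq_powProd, powProd_single, H.eq_X, C_1, one_mul] at hq
    exact mul_left_cancel₀ (pow_ne_zero _ (X_ne_zero _)) hq
  · rw [mem_support_iff, coeff_divMonomial] at hJ
    exact mem_support_iff.2 hJ

/-- One order isolates the term in h₃^p, the other allows the spare power of x to be cancelled,
leaving x^(2p) h₄ - c h₃^p as a combination with all exponents of h₂, h₃ below p. -/
theorem exists_second_relation [NeZero p] (hp : p.Prime) (h2 : 2 < p) (H : HasLeads p h)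
    (W : HasWLeads p h) (hh : ∀ j, (h j).IsHomogeneous (degs p j)) (hlow : IsLow p h (h 2 ^ p))
    (hx : ∃ m, X 2 ^ m * h 4 ∈ Algebra.adjoin K {h 0, h 1, h 2}) :
    ∃ ρ, IsMonicRel p h (Finsupp.single 3 p) ρ := by
  classical
  obtain ⟨m, hm⟩ := hx
  have hhom : (X 2 ^ m * h 4).IsHomogeneous (m + p ^ 4) := by
    have := ((isHomogeneous_X K (2 : Fin 3)).pow m).mul (hh 4)
    rwa [one_mul] at this
  obtain ⟨q, hq, hs⟩ := exists_homogeneous_of_isLow hh hhom (isLow_of_mem_adjoin hlow hm)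
  obtain ⟨k, c, rfl, hc, ec, h3⟩ := exists_unique_third_power hp H W hq hs
  set I : Fin 5 →₀ ℕ := Finsupp.single 0 k + Finsupp.single 3 p with hI
  have hsub : ∀ J ∈ (q - monomial I c).support, J ∈ q.support ∧ J ≠ I := by
    intro J hJ
    rw [mem_support_iff, coeff_sub, coeff_monomial] at hJ
    by_cases hJI : I = J
    · rw [if_pos hJI, ec, ← hJI, sub_self] at hJ
      exact absurd rfl hJ
    · rw [if_neg hJI, sub_zero] at hJ
      exact ⟨mem_support_iff.2 hJ, Ne.symm hJI⟩
  have e1 : aeval h (q - monomial I c) = X 2 ^ k * (X 2 ^ (2 * p) * h 4 - C c * h 3 ^ p) := by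
    rw [map_sub, hq, aeval_monomial_eq_powProd, hI, powProd_add, powProd_single, powProd_single,
      H.eq_X]
    ring
  obtain ⟨q', e2, hs'⟩ := exists_shift hp h2 H e1 fun J hJ =>
    ⟨(hs J (hsub J hJ).1).2.1, h3 J (hsub J hJ).1 (hsub J hJ).2, (hs J (hsub J hJ).1).2.2⟩
  refine ⟨_, isMonicRel_of_lt (q := C c⁻¹ *
    (q' - monomial (Finsupp.single 0 (2 * p) + Finsupp.single 4 1) 1)) ?_ ?_ rfl ?_⟩
  · rw [map_add, map_mul, map_sub, e2, aeval_monomial_eq_powProd, aeval_monomial_eq_powProd,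
      powProd_add, powProd_single, powProd_single, powProd_single, H.eq_X, algHom_C,
      algebraMap_eq, pow_one, C_1, one_mul, one_mul]
    have : (C c⁻¹ * C c : MvPolynomial (Fin 3) K) = 1 := by
      rw [← C_mul, inv_mul_cancel₀ hc, C_1]
    linear_combination (-h 3 ^ p) * this
  · simpa using hp.ne_zero
  · intro J hJ
    obtain ⟨b0, b1, b2⟩ := H.degree_powProd (Finsupp.single 3 p)
    obtain ⟨a0, a1, a2⟩ := H.degree_powProd J
    rw [H.tOrder_lt_iff]
    have t1 := H.sum_degree_powProd J
    have t2 := H.sum_degree_powProd (Finsupp.single 3 p)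
    have ew : Finsupp.weight (degs p) (Finsupp.single 3 p) = p ^ 4 + 2 * p := by
      rw [weight_degs]
      simp
      ring
    have hJ' : J ∈ (q' - monomial (Finsupp.single 0 (2 * p) + Finsupp.single 4 1) 1).support := by
      rw [mem_support_iff, coeff_C_mul] at hJ
      exact mem_support_iff.2 (right_ne_zero_of_mul hJ)
    rw [ew] at t2
    simp only [Finsupp.single_eq_of_ne (show (4 : Fin 5) ≠ 3 by decide),
      Finsupp.single_eq_of_ne (show (0 : Fin 5) ≠ 3 by decide), mul_zero] at b0 b2
    rcases Finset.mem_union.1 (support_sub _ _ _ hJ') with hJ | hJ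
    · have hJ1 := hs' J hJ
      obtain ⟨j4, j2, jw⟩ := hs _ (hsub _ hJ1).1
      have j3 := h3 _ (hsub _ hJ1).1 (hsub _ hJ1).2
      simp only [Finsupp.add_apply, Finsupp.single_eq_of_ne (show (4 : Fin 5) ≠ 0 by decide),
        Finsupp.single_eq_of_ne (show (3 : Fin 5) ≠ 0 by decide), zero_add] at j4 j3
      have jw' : Finsupp.weight (degs p) J = p ^ 4 + 2 * p := by
        rw [map_add] at jw
        have : Finsupp.weight (degs p) (Finsupp.single 0 k) = k := by
          rw [weight_degs]
          simp
        omega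
      rw [jw'] at t1
      rw [j4, mul_zero] at a0
      -- A term of the same degree without x may tie with the lead monomial of h₃^p; its smaller
      -- exponent of h₃ then decides. With a factor x it is strictly smaller.
      by_cases hJ0 : J 0 = 0
      · right
        refine ⟨?_, Or.inl (by simpa using j3)⟩
        ext i
        fin_cases i
        · exact a0.trans b0.symm
        · change (grevLex.degree (powProd h J)) 1 = _
          simp only [Fin.mk_one]
          omega
        · exact (a2.trans hJ0).trans b2.symm
      · left
        rw [grevLex_lt_iff]
        right
        omega
    · left
      obtain rfl := Finset.mem_singleton.1 (support_monomial_subset hJ)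
      have jw' : Finsupp.weight (degs p) (Finsupp.single 0 (2 * p) + Finsupp.single 4 1) =
          p ^ 4 + 2 * p := by
        rw [weight_degs]
        simp
        ring
      have j0 : (Finsupp.single 0 (2 * p) + Finsupp.single 4 1 : Fin 5 →₀ ℕ) 0 = 2 * p := by
        simp
      rw [jw'] at t1
      rw [grevLex_lt_iff]
      right
      omega

end Second

/-! ### Consequences of the two relations -/

section Consequences

variable {K : Type*} [Field K] {p : ℕ} [NeZero p] {h : Fin 5 → MvPolynomial (Fin 3) K}
  {ρ₁ ρ₂ : MvPolynomial (Fin 5) K} {A : Subalgebra K (MvPolynomial (Fin 3) K)}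

/-- Iterated division by x brings elements of the localization back into the algebra. -/
theorem exists_aeval_eq_of_X_pow_mul (hp : p.Prime) (hp2 : 2 < p) (H : HasLeads p h)
    (h1 : IsMonicRel p h (Finsupp.single 2 p) ρ₁) (h2 : IsMonicRel p h (Finsupp.single 3 p) ρ₂)
    (m : ℕ) {f : MvPolynomial (Fin 3) K} (hf : ∃ q : MvPolynomial (Fin 5) K,
      aeval h q = X 2 ^ m * f) : ∃ q : MvPolynomial (Fin 5) K, aeval h q = f := by
  induction m with
  | zero => simpa using hf
  | succ m ih =>
    apply ih
    obtain ⟨q, hq⟩ := hf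
    rw [pow_succ', mul_assoc] at hq
    obtain ⟨q', hq'⟩ := exists_eq_X_mul hp hp2 H h1 h2 q (hq ▸ dvd_mul_right _ _)
    exact ⟨q', mul_left_cancel₀ (X_ne_zero _) (hq'.symm.trans hq)⟩

theorem isSagbiBasis_of_relations (hp : p.Prime) (hp2 : 2 < p) (H : HasLeads p h)
    (h1 : IsMonicRel p h (Finsupp.single 2 p) ρ₁) (h2 : IsMonicRel p h (Finsupp.single 3 p) ρ₂)
    (hA : Algebra.adjoin K (Set.range h) = A) : IsSagbiBasis (Set.range h) A := by
  have hsub : Set.range h ⊆ A := by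
    rw [← hA]
    exact Algebra.subset_adjoin
  refine ⟨hsub, le_antisymm (Algebra.adjoin_le ?_) (Algebra.adjoin_le ?_)⟩
  · rintro _ ⟨f, ⟨j, rfl⟩, rfl⟩
    have hc := grevLex.leadingCoeff_ne_zero_iff.2 (H.ne_zero j)
    have e : monomial (grevLex.degree (h j)) (1 : K) =
        (grevLex.leadingCoeff (h j))⁻¹ • grevLex.leadingTerm (h j) := by
      rw [leadingTerm_eq_monomial, smul_monomial, smul_eq_mul, inv_mul_cancel₀ hc]
    change monomial (grevLex.degree (h j)) (1 : K) ∈ leadTermAlgebra A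
    rw [e]
    refine Subalgebra.smul_mem _ ?_ _
    exact Algebra.subset_adjoin ⟨h j, hsub ⟨j, rfl⟩, rfl⟩
  · rintro _ ⟨f, hf, rfl⟩
    rw [SetLike.mem_coe, ← hA, Algebra.adjoin_range_eq_range_aeval] at hf
    obtain ⟨q, rfl⟩ := hf
    change grevLex.leadingTerm (aeval h q) ∈ _
    by_cases h0 : aeval h q = 0
    · rw [h0, grevLex.leadingTerm_zero]
      exact zero_mem _
    obtain ⟨I, hI⟩ := exists_lead hp hp2 H h1 h2 q h0
    have e : monomial (grevLex.degree (aeval h q)) (1 : K) =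
        ∏ j, monomial (grevLex.degree (h j)) (1 : K) ^ I j := by
      rw [hI, RankFour.degree_powProd _ H.ne_zero, monomial_sum_one]
      exact Finset.prod_congr rfl fun j _ => by rw [monomial_pow, one_pow]
    have e' : grevLex.leadingTerm (aeval h q) = grevLex.leadingCoeff (aeval h q) •
        ∏ j, monomial (grevLex.degree (h j)) (1 : K) ^ I j := by
      rw [← e, leadingTerm_eq_monomial, smul_monomial, smul_eq_mul, mul_one]
    rw [e']
    refine Subalgebra.smul_mem _ ?_ _
    refine prod_mem fun j _ => pow_mem ?_ _
    exact Algebra.subset_adjoin ⟨h j, ⟨j, rfl⟩, rfl⟩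

/-- The presentation of `A` by the family `h`. -/
def presentation (hA : Algebra.adjoin K (Set.range h) = A) : MvPolynomial (Fin 5) K →ₐ[K] A :=
  (aeval h).codRestrict A fun q => by
    rw [← hA, Algebra.adjoin_range_eq_range_aeval]
    exact ⟨q, rfl⟩

omit [NeZero p] in
theorem coe_presentation (hA : Algebra.adjoin K (Set.range h) = A) (q : MvPolynomial (Fin 5) K) :
    (presentation hA q : MvPolynomial (Fin 3) K) = aeval h q := rfl

omit [NeZero p] in
theorem presentation_surjective (hA : Algebra.adjoin K (Set.range h) = A) :
    Function.Surjective (presentation hA) := by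
  rintro ⟨f, hf⟩
  have hf' := hf
  rw [← hA, Algebra.adjoin_range_eq_range_aeval] at hf'
  obtain ⟨q, hq⟩ := hf'
  exact ⟨q, Subtype.ext hq⟩

theorem isCompleteIntersection_of_relations (hp : p.Prime) (hp2 : 2 < p) (H : HasLeads p h)
    (h1 : IsMonicRel p h (Finsupp.single 2 p) ρ₁) (h2 : IsMonicRel p h (Finsupp.single 3 p) ρ₂)
    (hA : Algebra.adjoin K (Set.range h) = A) : IsCompleteIntersection K A := by
  refine ⟨5, presentation hA, [ρ₁, ρ₂], presentation_surjective hA,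
    isRegular_pair hp hp2 H h1 h2, ?_⟩
  have e : RingHom.ker (presentation hA) =
      RingHom.ker (aeval h : MvPolynomial (Fin 5) K →ₐ[K] MvPolynomial (Fin 3) K) := by
    ext q
    rw [RingHom.mem_ker, RingHom.mem_ker, ← coe_presentation hA, ZeroMemClass.coe_eq_zero]
  rw [e, ker_aeval_eq hp hp2 H h1 h2, Ideal.ofList_cons, Ideal.ofList_singleton,
    Ideal.span_insert]

/-- The difference of a tête-à-tête lies in the algebra, where every nonzero element can be reduced.
-/
theorem exists_isTatRelation (hp : p.Prime) (hp2 : 2 < p) (H : HasLeads p h)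
    (h1 : IsMonicRel p h (Finsupp.single 2 p) ρ₁) (h2 : IsMonicRel p h (Finsupp.single 3 p) ρ₂)
    {I J : Fin 5 →₀ ℕ} (hIJ : IsTat h I J) : ∃ ρ, IsTatRelation h I J ρ := by
  obtain ⟨q, hq⟩ := exists_subduction_zero H.ne_zero (exists_lead hp hp2 H h1 h2)
    (monomial I 1 - monomial J (tatScalar h I J))
  refine ⟨_, hIJ, q, ?_, rfl⟩
  rwa [map_sub, aeval_monomial_eq_powProd, aeval_monomial_eq_powProd, C_1, one_mul] at hq

omit [NeZero p] in
theorem HasLeads.isTat_first (H : HasLeads p h) :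
    IsTat h (Finsupp.single 2 p) (Finsupp.single 1 (p + 2)) := by
  obtain ⟨a0, a1, a2⟩ := H.degree_powProd (Finsupp.single 2 p)
  obtain ⟨b0, b1, b2⟩ := H.degree_powProd (Finsupp.single 1 (p + 2))
  rw [IsTat]
  ext i
  fin_cases i
  · exact a0.trans (Eq.trans (by simp) b0.symm)
  · refine a1.trans (Eq.trans ?_ b1.symm)
    rw [Finsupp.single_eq_same, Finsupp.single_eq_same, Finsupp.single_eq_of_ne (by decide),
      Finsupp.single_eq_of_ne (by decide), Finsupp.single_eq_of_ne (by decide),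
      Finsupp.single_eq_of_ne (by decide)]
    ring
  · exact a2.trans (Eq.trans (by
      rw [Finsupp.single_eq_of_ne (by decide), Finsupp.single_eq_of_ne (by decide)]) b2.symm)

omit [NeZero p] in
theorem HasLeads.isTat_second (H : HasLeads p h) (hp : 0 < p) :
    IsTat h (Finsupp.single 3 p) (Finsupp.single 2 1 + Finsupp.single 1 (p ^ 2 - 1)) := by
  obtain ⟨a0, a1, a2⟩ := H.degree_powProd (Finsupp.single 3 p)
  obtain ⟨b0, b1, b2⟩ := H.degree_powProd (Finsupp.single 2 1 + Finsupp.single 1 (p ^ 2 - 1))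
  obtain ⟨k, hk⟩ := Nat.exists_eq_add_of_le (show 1 ≤ p ^ 2 from Nat.one_le_pow _ _ hp)
  have hk' : p ^ 2 - 1 = k := by omega
  rw [hk'] at b0 b1 b2 ⊢
  rw [IsTat]
  ext i
  fin_cases i
  · exact a0.trans (Eq.trans (by simp) b0.symm)
  · refine a1.trans (Eq.trans ?_ b1.symm)
    rw [Finsupp.add_apply, Finsupp.add_apply, Finsupp.add_apply, Finsupp.single_eq_same,
      Finsupp.single_eq_same, Finsupp.single_eq_same, Finsupp.single_eq_of_ne (by decide),
      Finsupp.single_eq_of_ne (by decide), Finsupp.single_eq_of_ne (by decide),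
      Finsupp.single_eq_of_ne (by decide), Finsupp.single_eq_of_ne (by decide),
      Finsupp.single_eq_of_ne (by decide)]
    have : p ^ 2 * p ^ 2 = p ^ 2 * (1 + k) := by rw [← hk]
    linarith [this, pow_succ p 3, pow_succ p 2]
  · exact a2.trans (Eq.trans (by simp) b2.symm)

end Consequences

/-! ### The embedding dimension -/

section EmbeddingDimension

variable {K : Type*} [Field K] {p : ℕ} {h : Fin 5 → MvPolynomial (Fin 3) K}
  {A : Subalgebra K (MvPolynomial (Fin 3) K)}

/-- Relations have no linear terms. -/
theorem coeff_single_eq_zero_of_relation (hp : p.Prime) (h2 : 2 < p) (H : HasLeads p h)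
    (hh : ∀ j, (h j).IsHomogeneous (degs p j)) {ρ : MvPolynomial (Fin 5) K}
    (hρ : aeval h ρ = 0) (j : Fin 5) : coeff (Finsupp.single j 1) ρ = 0 := by
  classical
  by_contra hne
  set σ := weightedHomogeneousComponent (degs p) (degs p j) ρ with hσ
  have hwj : Finsupp.weight (degs p) (Finsupp.single j 1) = degs p j := by
    rw [Finsupp.weight_single, one_smul]
  have hjσ : coeff (Finsupp.single j 1) σ ≠ 0 := by
    rw [hσ, coeff_weightedHomogeneousComponent, if_pos hwj]
    exact hne
  have hσ0 : aeval h σ = 0 := by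
    rw [hσ, aeval_weightedHomogeneousComponent hh, hρ, map_zero]
  have hw : ∀ J ∈ σ.support, Finsupp.weight (degs p) J = degs p j := by
    intro J hJ
    rw [mem_support_iff, hσ, coeff_weightedHomogeneousComponent] at hJ
    exact (ite_ne_right_iff.1 hJ).1
  have hσne : σ ≠ 0 := by
    intro h0
    rw [h0, coeff_zero] at hjσ
    exact hjσ rfl
  have e4 : p ^ 4 = p * p ^ 3 := by ring
  have e3 : p ^ 3 = p * p ^ 2 := by ring
  have g2 : 3 * p ≤ p ^ 2 := by nlinarith
  have g3 : 3 * p ^ 2 ≤ p ^ 3 := by rw [e3]; exact Nat.mul_le_mul_right _ h2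
  have g4 : 3 * p ^ 3 ≤ p ^ 4 := by rw [e4]; exact Nat.mul_le_mul_right _ h2
  have e5 : (p ^ 2 + 2 * p) * p = p ^ 3 + 2 * p ^ 2 := by ring
  have e6 : (p ^ 3 + 2) * p = p ^ 4 + 2 * p := by ring
  by_cases hj : j = 4
  · subst hj
    have hd4 : degs p 4 = p ^ 4 := rfl
    rw [hd4] at hw
    -- Among products of degree p⁴ only h₄ itself contains z^(p⁴); the others have lead monomials
    -- without z, which are smaller.
    have hc : coeff (Finsupp.single 0 (p ^ 4)) (aeval h σ) =
        coeff (Finsupp.single 4 1) σ * coeff (Finsupp.single 0 (p ^ 4)) (h 4) := by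
      rw [aeval_eq_sum_powProd, coeff_sum, Finset.sum_eq_single (Finsupp.single 4 1)]
      · rw [coeff_C_mul, powProd_single, pow_one]
      · intro J hJ hJ4
        rw [coeff_C_mul, grevLex.coeff_eq_zero_of_lt, mul_zero]
        obtain ⟨a0, a1, a2⟩ := H.degree_powProd J
        have t := H.sum_degree_powProd J
        have hJw := hw J hJ
        rw [hJw] at t
        have hJ0 : J 4 = 0 := by
          by_contra h4
          rw [weight_degs] at hJw
          have h5 : p ^ 4 * 1 ≤ p ^ 4 * J 4 :=
            Nat.mul_le_mul_left _ (Nat.one_le_iff_ne_zero.2 h4)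
          have hp2 : 0 < p ^ 2 := pow_pos hp.pos 2
          have c1 : p ^ 2 * J 1 = 0 := by omega
          have c2 : (p ^ 2 + 2 * p) * J 2 = 0 := by omega
          have c3 : (p ^ 3 + 2) * J 3 = 0 := by omega
          have c4 : p ^ 4 * J 4 = p ^ 4 * 1 := by omega
          have c4' := Nat.eq_of_mul_eq_mul_left (pow_pos hp.pos 4) c4
          have c1' := (Nat.mul_eq_zero.1 c1).resolve_left hp2.ne'
          have c2' := (Nat.mul_eq_zero.1 c2).resolve_left (by omega)
          have c3' := (Nat.mul_eq_zero.1 c3).resolve_left (by omega)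
          have c0' : J 0 = 0 := by omega
          apply hJ4
          ext i
          fin_cases i <;> simp [c0', c1', c2', c3', c4']
        rw [hJ0, mul_zero] at a0
        rw [grevLex_lt_iff, t, Finsupp.single_eq_same,
          Finsupp.single_eq_of_ne (show (1 : Fin 3) ≠ 0 by decide),
          Finsupp.single_eq_of_ne (show (2 : Fin 3) ≠ 0 by decide)]
        have hp4 : 0 < p ^ 4 := pow_pos hp.pos 4
        omega
      · intro hn
        rw [notMem_support_iff.1 hn, C_0, zero_mul, coeff_zero]
    rw [hσ0, coeff_zero, ← H.deg_four] at hc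
    exact mul_ne_zero hjσ (grevLex.leadingCoeff_ne_zero_iff.2 (H.ne_zero 4)) hc.symm
  · have hdj : degs p j ≤ p ^ 3 + 2 := by
      fin_cases j
      · change 1 ≤ _; omega
      · change p ^ 2 ≤ _; omega
      · change p ^ 2 + 2 * p ≤ _; omega
      · change p ^ 3 + 2 ≤ _; omega
      · exact absurd rfl hj
    -- Degrees up to p³ + 2 are too small for p-th powers of h₂ or h₃, so this component is in
    -- normal form and cannot be a nonzero relation.
    have hlt : ∀ J ∈ σ.support, J 2 < p ∧ J 3 < p := by
      intro J hJ
      have := hw J hJ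
      rw [weight_degs] at this
      constructor
      · by_contra hlt
        have := Nat.mul_le_mul_left (p ^ 2 + 2 * p) (not_lt.1 hlt)
        omega
      · by_contra hlt
        have := Nat.mul_le_mul_left (p ^ 3 + 2) (not_lt.1 hlt)
        omega
    obtain ⟨-, -, h0, -⟩ := exists_lead_of_normalForm hp h2 H hσne hlt
    exact h0 hσ0

theorem coeff_single_mul_eq_zero {n : ℕ} {q r : MvPolynomial (Fin n) K} (hq : coeff 0 q = 0)
    (hr : coeff 0 r = 0) (j : Fin n) : coeff (Finsupp.single j 1) (q * r) = 0 := by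
  classical
  rw [coeff_mul]
  refine Finset.sum_eq_zero fun x hx => ?_
  have hd := congrArg Finsupp.degree (Finset.HasAntidiagonal.mem_antidiagonal.1 hx)
  rw [map_add, Finsupp.degree_single] at hd
  rcases Nat.eq_zero_or_pos (Finsupp.degree x.1) with h0 | h0
  · rw [(Finsupp.degree_eq_zero_iff _).1 h0, hq, zero_mul]
  · rw [(Finsupp.degree_eq_zero_iff x.2).1 (by omega), hr, mul_zero]

theorem coeff_zero_aeval (hh : ∀ j, coeff 0 (h j) = 0) (q : MvPolynomial (Fin 5) K) :
    coeff 0 (aeval h q) = coeff 0 q := by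
  have : (constantCoeff (R := K) (σ := Fin 3)).comp
      (aeval h : MvPolynomial (Fin 5) K →ₐ[K] MvPolynomial (Fin 3) K).toRingHom =
      constantCoeff := by
    ext i
    · simp
    · simp [constantCoeff_eq, hh i]
  exact RingHom.congr_fun this q

variable (hA : Algebra.adjoin K (Set.range h) = A)

theorem mem_augmentationIdeal_iff (f : A) :
    f ∈ augmentationIdeal A ↔ coeff 0 (f : MvPolynomial (Fin 3) K) = 0 := Iff.rfl

include hA in
theorem exists_coeff_zero_of_mem_sq (hh : ∀ j, coeff 0 (h j) = 0) {f : A}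
    (hf : f ∈ augmentationIdeal A ^ 2) :
    ∃ q : MvPolynomial (Fin 5) K, aeval h q = f ∧ ∀ j, coeff (Finsupp.single j 1) q = 0 := by
  rw [pow_two] at hf
  induction hf using Submodule.mul_induction_on' with
  | mem_mul_mem a ha b hb =>
    obtain ⟨q, rfl⟩ := presentation_surjective hA a
    obtain ⟨r, rfl⟩ := presentation_surjective hA b
    rw [mem_augmentationIdeal_iff, coe_presentation, coeff_zero_aeval hh] at ha hb
    refine ⟨q * r, ?_, fun j => coeff_single_mul_eq_zero ha hb j⟩
    rw [map_mul]
    rfl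
  | add a _ b _ ha hb =>
    obtain ⟨q, hq, hq'⟩ := ha
    obtain ⟨r, hr, hr'⟩ := hb
    refine ⟨q + r, by rw [map_add, hq, hr]; rfl, fun j => by rw [coeff_add, hq', hr', add_zero]⟩

/-- The augmentation, as a map to the augmentation ideal. -/
def toAugmentation (A : Subalgebra K (MvPolynomial (Fin 3) K)) : A →ₗ[K] augmentationIdeal A where
  toFun f := ⟨f - algebraMap K A (coeff 0 (f : MvPolynomial (Fin 3) K)), by
    rw [mem_augmentationIdeal_iff]
    simp⟩
  map_add' f g := by
    ext1
    simp only [AddMemClass.coe_add, coeff_add, map_add]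
    ring
  map_smul' c f := by
    ext1
    simp [Algebra.smul_def, mul_sub]

/-- The class of an element of `A`, minus its constant term, in the cotangent space. -/
def toCotangentSpace (A : Subalgebra K (MvPolynomial (Fin 3) K)) :
    A →ₗ[K] (augmentationIdeal A).Cotangent :=
  ((augmentationIdeal A).toCotangent.restrictScalars K) ∘ₗ toAugmentation A

theorem toCotangentSpace_surjective : Function.Surjective (toCotangentSpace A) := by
  intro y
  obtain ⟨x, rfl⟩ := (augmentationIdeal A).toCotangent_surjective y
  refine ⟨x, ?_⟩
  change (augmentationIdeal A).toCotangent (toAugmentation A x) = _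
  congr 1
  ext1
  have := (mem_augmentationIdeal_iff (x : A)).1 x.2
  simp [toAugmentation, this]

theorem toCotangentSpace_eq_zero_iff {f : A} (hf : coeff 0 (f : MvPolynomial (Fin 3) K) = 0) :
    toCotangentSpace A f = 0 ↔ f ∈ augmentationIdeal A ^ 2 := by
  have e : ((toAugmentation A f : augmentationIdeal A) : A) = f := by
    simp [toAugmentation, hf]
  change (augmentationIdeal A).toCotangent (toAugmentation A f) = 0 ↔ _
  rw [Ideal.toCotangent_eq_zero, e]

theorem toCotangentSpace_algebraMap (c : K) : toCotangentSpace A (algebraMap K A c) = 0 := by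
  have e : toAugmentation A (algebraMap K A c) = 0 := by
    ext1
    change algebraMap K A c - algebraMap K A (coeff 0 (C c : MvPolynomial (Fin 3) K)) = 0
    rw [coeff_zero_C, sub_self]
  rw [toCotangentSpace, LinearMap.comp_apply, e, map_zero]

theorem toCotangentSpace_mul (f : A) {g : A} (hg : coeff 0 (g : MvPolynomial (Fin 3) K) = 0) :
    toCotangentSpace A (f * g) =
      coeff 0 (f : MvPolynomial (Fin 3) K) • toCotangentSpace A g := by
  have e : f * g - coeff 0 (f : MvPolynomial (Fin 3) K) • g =
      (toAugmentation A f : A) * g := by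
    change _ = (f - algebraMap K A _) * g
    rw [sub_mul, Algebra.smul_def]
  have hm : f * g - coeff 0 (f : MvPolynomial (Fin 3) K) • g ∈ augmentationIdeal A ^ 2 := by
    rw [e, pow_two]
    exact Ideal.mul_mem_mul (toAugmentation A f).2 hg
  rw [← map_smul, ← sub_eq_zero, ← map_sub, toCotangentSpace_eq_zero_iff]
  · exact hm
  · exact (mem_augmentationIdeal_iff _).1 (Ideal.pow_le_self two_ne_zero hm)

/-- By the Leibniz-like rule `toCotangentSpace_mul`, a class depends only on the linear part of a
representing polynomial. -/
theorem toCotangentSpace_presentation (hh : ∀ j, coeff 0 (h j) = 0)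
    (q : MvPolynomial (Fin 5) K) : toCotangentSpace A (presentation hA q) =
      ∑ j, coeff (Finsupp.single j 1) q • toCotangentSpace A (presentation hA (X j)) := by
  induction q using MvPolynomial.induction_on with
  | C c =>
    rw [show presentation hA (C c) = algebraMap K A c from (presentation hA).commutes c,
      toCotangentSpace_algebraMap, Finset.sum_eq_zero]
    intro j _
    rw [coeff_C, if_neg (by simp [eq_comm]), zero_smul]
  | add q r hq hr =>
    rw [map_add, map_add, hq, hr, ← Finset.sum_add_distrib]
    exact Finset.sum_congr rfl fun j _ => by rw [coeff_add, add_smul]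
  | mul_X q i hq =>
    have hi : coeff 0 (presentation hA (X i) : MvPolynomial (Fin 3) K) = 0 := by
      rw [coe_presentation, aeval_X, hh]
    rw [map_mul, toCotangentSpace_mul _ hi, coe_presentation, coeff_zero_aeval hh,
      Finset.sum_eq_single i]
    · rw [coeff_mul_X', if_pos (by simp), tsub_self]
    · intro j _ hji
      rw [coeff_mul_X', if_neg, zero_smul]
      simpa [Finsupp.single_apply] using Ne.symm hji
    · simp

-- The classes of the generators span. A linear dependence would place a linear form in A₊², whose
-- elements have representatives without linear terms, and so would give a relation with a linear
-- term.
include hA in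
theorem embeddingDim_eq_five (hp : p.Prime) (h2 : 2 < p) (H : HasLeads p h)
    (hh : ∀ j, (h j).IsHomogeneous (degs p j)) : embeddingDim A = 5 := by
  have hh0 : ∀ j, coeff 0 (h j) = 0 := by
    intro j
    apply (hh j).coeff_eq_zero
    have hp0 := hp.pos
    rw [map_zero]
    apply Ne.symm
    fin_cases j
    · exact one_ne_zero
    · exact (pow_pos hp0 2).ne'
    · change p ^ 2 + 2 * p ≠ 0; positivity
    · change p ^ 3 + 2 ≠ 0; positivity
    · exact (pow_pos hp0 4).ne'
  have hli : LinearIndependent K fun j => toCotangentSpace A (presentation hA (X j)) := by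
    rw [Fintype.linearIndependent_iff]
    intro c hc j
    have e : ∑ j, c j • toCotangentSpace A (presentation hA (X j)) =
        toCotangentSpace A (presentation hA (∑ j, C (c j) * X j)) := by
      rw [map_sum, map_sum]
      refine Finset.sum_congr rfl fun j _ => ?_
      rw [← map_smul, ← map_smul, smul_eq_C_mul]
    have h0 : coeff 0 (presentation hA (∑ j, C (c j) * X j) : MvPolynomial (Fin 3) K) = 0 := by
      rw [coe_presentation, coeff_zero_aeval hh0, coeff_sum]
      exact Finset.sum_eq_zero fun j _ => by rw [coeff_C_mul, coeff_zero_X, mul_zero]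
    rw [e, toCotangentSpace_eq_zero_iff h0] at hc
    obtain ⟨q, hq, hq'⟩ := exists_coeff_zero_of_mem_sq hA hh0 hc
    have := coeff_single_eq_zero_of_relation hp h2 H hh
      (ρ := ∑ j, C (c j) * X j - q) (by rw [map_sub, hq, coe_presentation, sub_self]) j
    rw [coeff_sub, hq', sub_zero, coeff_sum, Finset.sum_eq_single j] at this
    · simpa using this
    · intro i _ hij
      rw [coeff_C_mul, coeff_X, if_neg, mul_zero]
      intro hs
      exact hij ((Finsupp.single_left_inj one_ne_zero).1 hs)
    · simp
  have hsp : ⊤ ≤ Submodule.span K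
      (Set.range fun j => toCotangentSpace A (presentation hA (X j))) := by
    rintro y -
    obtain ⟨f, rfl⟩ := toCotangentSpace_surjective y
    obtain ⟨q, rfl⟩ := presentation_surjective hA f
    rw [toCotangentSpace_presentation hA hh0]
    exact Submodule.sum_mem _ fun j _ => Submodule.smul_mem _ _
      (Submodule.subset_span ⟨j, rfl⟩)
  rw [embeddingDim, Module.finrank_eq_card_basis (Module.Basis.mk hli hsp), Fintype.card_fin]

end EmbeddingDimension

/-! ### The ring of invariants -/

section Invariants

variable {K : Type*} [Field K] {p : ℕ} {M : Matrix (Fin 2) (Fin 4) K} [Algebra (ZMod p) K]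
  [Fact p.Prime] [CharP K p] {f : MvPolynomial (Fin 3) K}

/-- The first relation, solved for f₂^p: its other terms have f₂-exponent below p and no factor
N(z). -/
theorem isLow_f₂_pow (h2 : 2 < p)
    (ha : gam p M ![1, 2, 3, 4] ≠ 0) (hb : gam p M ![1, 2, 3, 5] ≠ 0)
    (hc : gam p M ![1, 3, 5, 7] ≠ 0) (H : IsThirdInvariant p M f) :
    IsLow p (gens p M f) (gens p M f 2 ^ p) := by
  obtain ⟨-, -, -, c, q, e, hq⟩ := H.spec h2 ha hb hc
  have low : ∀ J : Fin 5 →₀ ℕ, J 4 = 0 → J 2 < p → IsLow p (gens p M f) (powProd (gens p M f) J) := by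
    intro J h4 hJ
    refine ⟨monomial J 1, by rw [aeval_monomial_eq_powProd, C_1, one_mul], fun I hI => ?_⟩
    rw [Finset.mem_singleton.1 (support_monomial_subset hI)]
    exact ⟨h4, hJ⟩
  have hp0 : 0 < p := by omega
  have e1 : gens p M f 2 ^ p = C (gam p M ![1, 2, 3, 5] ^ p / gam p M ![1, 2, 3, 4] ^ 2) *
      powProd (gens p M f) (Finsupp.single 1 (p + 2)) + (aeval (startSet p M) q +
      C c * powProd (gens p M f) (Finsupp.single 0 (2 * p ^ 2 - 2) + Finsupp.single 3 1)) := by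
    rw [tatDiff_startSet h2 ha hb] at e
    rw [powProd_add, powProd_single, powProd_single, powProd_single, pow_one]
    change f₂ p M ^ p = _ * f₁ p M ^ (p + 2) + (_ + C c * (X 2 ^ (2 * p ^ 2 - 2) * f))
    linear_combination e
  rw [e1]
  refine ((low _ ?_ ?_).C_mul _).add (IsLow.add ?_ ((low _ ?_ ?_).C_mul _))
  · simp
  · simpa using hp0
  · rw [aeval_eq_sum_powProd]
    refine IsLow.sum fun J hJ => IsLow.C_mul ?_ _
    obtain ⟨j2, j3, -⟩ := exponents_of_startSet_lt h2 ha hb (hq J hJ)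
    rw [← powProd_gens_mapDomain (f := f)]
    refine low _ ?_ ?_
    · exact (Finsupp.mapDomain_apply startIndex_injective J 3).trans j3
    · exact (Finsupp.mapDomain_apply startIndex_injective J 2).trans_lt j2
  · simp
  · simpa using hp0

omit [Algebra (ZMod p) K] in
theorem smallAlgebra_le (h2 : 2 < p)
    (ha : gam p M ![1, 2, 3, 4] ≠ 0) (hb : gam p M ![1, 2, 3, 5] ≠ 0) :
    smallAlgebra p M ≤ Algebra.adjoin K {X 2, f₁ p M, f₂ p M} := by
  have hX : X 2 ∈ Algebra.adjoin K {X 2, f₁ p M, f₂ p M} := Algebra.subset_adjoin (by simp)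
  have h1 : f₁ p M ∈ Algebra.adjoin K {X 2, f₁ p M, f₂ p M} := Algebra.subset_adjoin (by simp)
  have h3 : f₂ p M ∈ Algebra.adjoin K {X 2, f₁ p M, f₂ p M} := Algebra.subset_adjoin (by simp)
  refine Algebra.adjoin_le ?_
  rintro g (rfl | rfl | rfl)
  · exact hX
  · exact h1
  · have e := (f₂_spec ha hb h2).2.2.2
    have hC : (C (gam p M ![1, 2, 3, 4])⁻¹ * C (gam p M ![1, 2, 3, 4]) :
        MvPolynomial (Fin 3) K) = 1 := by rw [← C_mul, inv_mul_cancel₀ ha, C_1]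
    have e' : fJ p M ![1, 2, 3, 4, 6] = (gam p M ![1, 2, 3, 4])⁻¹ •
        (2 * X 2 ^ (p ^ 2 - 2 * p) * f₂ p M - f₁ p M ^ 2) := by
      rw [smul_eq_C_mul]
      linear_combination (-fJ p M ![1, 2, 3, 4, 6]) * hC - C (gam p M ![1, 2, 3, 4])⁻¹ * e
    rw [e', SetLike.mem_coe]
    refine Subalgebra.smul_mem _ (sub_mem (mul_mem (mul_mem ?_ (pow_mem hX _)) h3)
      (pow_mem h1 _)) _
    exact ofNat_mem _ 2

theorem hasWLeads_gens (h2 : 2 < p)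
    (ha : gam p M ![1, 2, 3, 4] ≠ 0) (hb : gam p M ![1, 2, 3, 5] ≠ 0)
    (hc : gam p M ![1, 3, 5, 7] ≠ 0) (H : IsThirdInvariant p M f) :
    HasWLeads p (gens p M f) :=
  ⟨wOrder_degree_f₁ h2 ha hb, wOrder_degree_f₂ h2 ha hb, H.wOrder_degree h2 ha hb hc,
    (degree_orbitNorm ha h2 wOrder (by rw [wOrder_lt_iff]; simp)
      (by rw [wOrder_lt_iff]; simp)).2⟩

theorem exists_relations (h2 : 2 < p)
    (ha : gam p M ![1, 2, 3, 4] ≠ 0) (hb : gam p M ![1, 2, 3, 5] ≠ 0)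
    (hc : gam p M ![1, 3, 5, 7] ≠ 0) (H : IsThirdInvariant p M f) :
    (∃ ρ, IsMonicRel p (gens p M f) (Finsupp.single 2 p) ρ) ∧
      ∃ ρ, IsMonicRel p (gens p M f) (Finsupp.single 3 p) ρ := by
  obtain ⟨hd, hf, -⟩ := H.spec h2 ha hb hc
  refine ⟨exists_first_relation h2 ha hb hc H, exists_second_relation Fact.out h2
    (hasLeads_gens h2 ha hb hd) (hasWLeads_gens h2 ha hb hc H)
    (isHomogeneous_gens h2 ha hb hf) (isLow_f₂_pow h2 ha hb hc H) ?_⟩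
  -- The localization result is applied to the orbit product, which supplies the second relation.
  obtain ⟨m, hm⟩ := exists_X_pow_mul_mem_smallAlgebra h2 ha hb (orbitNorm_mem (M := M) ha h2)
  exact ⟨m, smallAlgebra_le h2 ha hb hm⟩

theorem adjoin_gens_eq_invariants (h2 : 2 < p)
    (ha : gam p M ![1, 2, 3, 4] ≠ 0) (hb : gam p M ![1, 2, 3, 5] ≠ 0)
    (hc : gam p M ![1, 3, 5, 7] ≠ 0) (H : IsThirdInvariant p M f) :
    Algebra.adjoin K (Set.range (gens p M f)) = invariants p M := by
  obtain ⟨hd, -, hinv, -⟩ := H.spec h2 ha hb hc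
  obtain ⟨⟨ρ₁, r1⟩, ⟨ρ₂, r2⟩⟩ := exists_relations h2 ha hb hc H
  refine le_antisymm (Algebra.adjoin_le ?_) fun g hg => ?_
  · rintro _ ⟨j, rfl⟩
    exact gens_mem h2 ha hb hinv j
  · obtain ⟨m, hm⟩ := exists_X_pow_mul_mem_smallAlgebra h2 ha hb hg
    rw [Algebra.adjoin_range_eq_range_aeval]
    refine exists_aeval_eq_of_X_pow_mul Fact.out h2 (hasLeads_gens h2 ha hb hd) r1 r2 m ?_
    have hle : Algebra.adjoin K {X 2, f₁ p M, f₂ p M} ≤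
        Algebra.adjoin K (Set.range (gens p M f)) := by
      refine Algebra.adjoin_mono ?_
      rintro _ (rfl | rfl | rfl)
      exacts [⟨0, rfl⟩, ⟨1, rfl⟩, ⟨2, rfl⟩]
    have := hle (smallAlgebra_le h2 ha hb hm)
    rw [Algebra.adjoin_range_eq_range_aeval] at this
    exact this

end Invariants

/-! ### Minors of the generic matrix -/

variable (p : ℕ) [Fact p.Prime]

instance : CharP (GenericField p) p :=
  charP_of_injective_algebraMap (IsFractionRing.injective
    (MvPolynomial (Fin 2 × Fin 4) (ZMod p)) (GenericField p)) p

/-- Under the substitution `x_{1j} = t^j`, `x_{2j} = t^{2j}`, row `r` of the matrix `Γ` consists of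
the powers of `t ^ nodeExponent p r`. -/
def nodeExponent (p r : ℕ) : ℕ := if Odd r then p ^ ((r - 1) / 2) else 2 * p ^ ((r - 1) / 2)

theorem nodeExponent_inj {p r s : ℕ} (hp : p.Prime) (h2 : 2 < p) (hr : 0 < r) (hs : 0 < s)
    (h : nodeExponent p r = nodeExponent p s) : r = s := by
  have hodd : ∀ k, Odd (p ^ k) := fun k => (hp.odd_of_ne_two h2.ne').pow
  have hinj := Nat.pow_right_injective hp.two_le
  unfold nodeExponent at h
  -- Odd rows have odd exponents and even rows have even ones, so only rows of equal parity need
  -- comparing.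
  by_cases h1 : Odd r <;> by_cases h3 : Odd s
  · rw [if_pos h1, if_pos h3] at h
    have := hinj h
    rw [Nat.odd_iff] at h1 h3
    omega
  · rw [if_pos h1, if_neg h3] at h
    have := hodd ((r - 1) / 2)
    rw [h] at this
    exact absurd this (by simp)
  · rw [if_neg h1, if_pos h3] at h
    have := hodd ((s - 1) / 2)
    rw [← h] at this
    exact absurd this (by simp)
  · rw [if_neg h1, if_neg h3] at h
    have := hinj (Nat.eq_of_mul_eq_mul_left two_pos h)
    rw [Nat.odd_iff] at h1 h3
    omega

/-- The minors of `Γ` with distinct rows do not vanish for the generic matrix. -/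
theorem gam_genericMatrix_ne_zero (h2 : 2 < p) (J : Fin 4 → ℕ) (hJ : Function.Injective J)
    (h0 : ∀ i, 0 < J i) : gam p (genericMatrix p) J ≠ 0 := by
  let R := MvPolynomial (Fin 2 × Fin 4) (ZMod p)
  let N : Matrix (Fin 4) (Fin 4) R := Matrix.of fun i j =>
    if Odd (J i) then X (0, j) ^ p ^ ((J i - 1) / 2) else X (1, j) ^ p ^ ((J i - 1) / 2)
  -- The substitution uses columns j = 0, …, 3, so row i becomes the powers 0 to 3 of one node and
  -- the determinant is a Vandermonde determinant.
  let φ : R →ₐ[ZMod p] Polynomial (ZMod p) :=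
    aeval fun ij => Polynomial.X ^ ((ij.1.val + 1) * ij.2.val)
  have e : gam p (genericMatrix p) J = algebraMap R (GenericField p) N.det := by
    rw [gam, RingHom.map_det]
    congr 1
    ext i j
    simp only [Matrix.of_apply, RingHom.mapMatrix_apply, Matrix.map_apply, N, Gam, genericMatrix]
    split_ifs <;> rw [map_pow]
  have hφ : φ N.det = (Matrix.vandermonde fun i =>
      (Polynomial.X : Polynomial (ZMod p)) ^ nodeExponent p (J i)).det := by
    rw [AlgHom.map_det]
    congr 1
    ext1 i j
    simp only [Matrix.of_apply, AlgHom.mapMatrix_apply, Matrix.map_apply, N, nodeExponent,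
      Matrix.vandermonde_apply, φ]
    split_ifs <;> rw [map_pow, aeval_X, ← pow_mul, ← pow_mul] <;> congr 1 <;> simp <;> ring
  rw [e, Ne, FaithfulSMul.algebraMap_eq_zero_iff]
  intro hN
  rw [hN, map_zero] at hφ
  refine Matrix.det_vandermonde_ne_zero_iff.2 (fun i j hij => hJ ?_) hφ.symm
  refine nodeExponent_inj Fact.out h2 (h0 i) (h0 j) ?_
  simpa using congrArg Polynomial.natDegree hij

end RankFour

end

theorem mainTheorem1 (p : ℕ) [Fact p.Prime] (hp : 2 < p) :
    -- the exact division that defines `f₂`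
    (2 * X 2 ^ (p ^ 2 - 2 * p) * f₂ p (genericMatrix p) =
      f₁ p (genericMatrix p) ^ 2
        + C (gam p (genericMatrix p) ![1, 2, 3, 4]) * fJ p (genericMatrix p) ![1, 2, 3, 4, 6]) ∧
    -- the algorithm produces an `f₃`; for `p ≥ 5` the explicit `f₃` is such an output
    (∃ f₃, IsThirdInvariant p (genericMatrix p) f₃) ∧
    (5 ≤ p → ∃ f₃, IsThirdInvariant p (genericMatrix p) f₃ ∧
      C (-(gam p (genericMatrix p) ![1, 2, 3, 4] ^ (2 * p + 2)
          / gam p (genericMatrix p) ![1, 2, 3, 5])) * X 2 ^ (2 * p ^ 2 - 2) * f₃ =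
        f₃Tilde p (genericMatrix p)) ∧
    ∀ f₃, IsThirdInvariant p (genericMatrix p) f₃ →
      -- SAGBI basis and generating set
      IsSagbiBasis (Set.range (gens p (genericMatrix p) f₃)) (invariants p (genericMatrix p)) ∧
      Algebra.adjoin (GenericField p) (Set.range (gens p (genericMatrix p) f₃)) =
        invariants p (genericMatrix p) ∧
      -- complete intersection of embedding dimension five
      IsCompleteIntersection (GenericField p) (invariants p (genericMatrix p)) ∧
      embeddingDim (invariants p (genericMatrix p)) = 5 ∧
      -- lead term of `f₃`, and degrees of the generators
      grevLex.leadingTerm f₃ =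
        C (gam p (genericMatrix p) ![1, 3, 5, 7]) * X 1 ^ (p ^ 3 + 2) ∧
      (∀ i, (gens p (genericMatrix p) f₃ i).IsHomogeneous
        (![1, p ^ 2, p ^ 2 + 2 * p, p ^ 3 + 2, p ^ 4] i)) ∧
      -- both tête-à-têtes subduct to zero, and any relations obtained from such subductions
      -- form a regular sequence which generates the ideal of relations
      (∃ ρ₁, IsTatRelation (gens p (genericMatrix p) f₃)
        (Finsupp.single 2 p) (Finsupp.single 1 (p + 2)) ρ₁) ∧
      (∃ ρ₂, IsTatRelation (gens p (genericMatrix p) f₃)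
        (Finsupp.single 3 p) (Finsupp.single 2 1 + Finsupp.single 1 (p ^ 2 - 1)) ρ₂) ∧
      ∀ ρ₁ ρ₂,
        IsTatRelation (gens p (genericMatrix p) f₃)
          (Finsupp.single 2 p) (Finsupp.single 1 (p + 2)) ρ₁ →
        IsTatRelation (gens p (genericMatrix p) f₃)
          (Finsupp.single 3 p) (Finsupp.single 2 1 + Finsupp.single 1 (p ^ 2 - 1)) ρ₂ →
        RingHom.ker (aeval (gens p (genericMatrix p) f₃) :
            MvPolynomial (Fin 5) (GenericField p) →ₐ[GenericField p]
              MvPolynomial (Fin 3) (GenericField p)) = Ideal.span {ρ₁, ρ₂} ∧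
        RingTheory.Sequence.IsRegular (MvPolynomial (Fin 5) (GenericField p)) [ρ₁, ρ₂] := by
  have inj : ∀ {a b c d : ℕ}, 0 < a → a < b → b < c → c < d →
      gam p (genericMatrix p) ![a, b, c, d] ≠ 0 := fun h₀ h₁ h₂ h₃ =>
    gam_genericMatrix_ne_zero p hp _
      (StrictMono.injective (Fin.strictMono_iff_lt_succ.2 fun i => by
        fin_cases i <;> assumption))
      (fun i => by fin_cases i <;> simp <;> omega)
  have ha : gam p (genericMatrix p) ![1, 2, 3, 4] ≠ 0 := by apply inj <;> norm_num
  have hb : gam p (genericMatrix p) ![1, 2, 3, 5] ≠ 0 := by apply inj <;> norm_num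
  have hc : gam p (genericMatrix p) ![1, 3, 5, 7] ≠ 0 := by apply inj <;> norm_num
  obtain ⟨k₂, k₃, k₄, f, s, hf, hs, e, hk⟩ := exists_third_form hp ha hb
  have hf3 := isThirdInvariant_of_eq hp ha hb hc hf hs e
  refine ⟨(f₂_spec ha hb hp).2.2.2, ⟨f, hf3⟩, fun h5 => ⟨f, hf3, ?_⟩, fun f₃ H => ?_⟩
  · obtain ⟨rfl, rfl, rfl⟩ := hk h5
    rw [e, thirdSum, add_zero, f₃Tilde]
  · have hpr : p.Prime := Fact.out
    obtain ⟨hd, hhom, -, -⟩ := H.spec hp ha hb hc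
    have L := hasLeads_gens hp ha hb hd
    obtain ⟨⟨ρ₁, r₁⟩, ⟨ρ₂, r₂⟩⟩ := exists_relations hp ha hb hc H
    have hA := adjoin_gens_eq_invariants hp ha hb hc H
    have hh := isHomogeneous_gens hp ha hb hhom
    refine ⟨isSagbiBasis_of_relations hpr hp L r₁ r₂ hA, hA,
      isCompleteIntersection_of_relations hpr hp L r₁ r₂ hA,
      embeddingDim_eq_five hA hpr hp L hh, ?_, hh,
      exists_isTatRelation hpr hp L r₁ r₂ L.isTat_first,
      exists_isTatRelation hpr hp L r₁ r₂ (L.isTat_second hpr.pos), fun σ₁ σ₂ t₁ t₂ => ?_⟩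
    · rw [leadingTerm_eq_monomial, hd, H.2.2.2, C_mul_X_pow_eq_monomial]
    -- Ties are broken by the exponent of f₂ in the first tête-à-tête and by that of f₃ in the
    -- second.
    · have m₁ := t₁.isMonicRel L (by simpa using hpr.ne_zero) (Or.inr (by simpa using hpr.pos))
      have m₂ := t₂.isMonicRel L (by simpa using hpr.ne_zero) (Or.inl (by simpa using hpr.pos))
      exact ⟨ker_aeval_eq hpr hp L m₁ m₂, isRegular_pair hpr hp L m₁ m₂⟩
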